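/- **Finite $n$-quandles of torus links: Cayley graphs, orders and automorphism groups.** *Conventions.* A quandle is a set with operations $\rhd,\rhd^{-1}$ such that $x\rhd x=x$, $(x\rhd y)\rhd^{-1}y=x=(x\rhd^{-1}y)\rhd y$ and $(x\rhd y)\rhd z=(x\rhd z)\rhd(y\rhd z)$. $S_x$ denotes the automorphism $y\mapsto y\rhd x$; $\mathrm{Inn}(Q)\le\mathrm{Aut}(Q)$ is generated by all $S_x$, and $\mathrm{Trans}(Q)$ by all $S_xS_y^{-1}$. If $D$ is a diagram of an oriented link $L$ and $n\ge 2$, then $Q_n(L)$ is the quandle with one generator for each arc of $D$, a relation $z=x\rhd y$ for each crossing with over-arc $y$, under-arc $x$ on its right and under-arc $z$ on its left, and the relations $x\rhd y\rhd\cdots\rhd y=x$ ($n$ letters $y$, bracketed to the left) for all pairs of distinct generators $x,y$. For $2\le p\le q$ let $T_{p,q}$ be the torus link, oriented with all strands parallel, given by the closure of the $p$-strand braid $(\sigma_1\cdots\sigma_{p-1})^q$ (in each factor $\sigma_1\cdots\sigma_{p-1}$ the leftmost strand passes over all others to the rightmost position, by right-handed half twists), and let the generators $a,b$ (for $p=2$),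 respectively $a,b,c$ (for $p=3$), be the arcs at the bottom of the braid from left to right. $T_{2,4}^{+-}$ is $T_{2,4}$ with the orientation of the component of $b$ reversed. $D_m$ is the dihedral group of order $2m$, and $\mathbb Z_q\rtimes\mathbb Z_q^*$ is formed with the action $u\cdot x=ux$. The Cayley graph of a quandle with respect to the generators has the elements as vertices and, for each generator $x$ and each element $y$, an edge labelled $x$ from $y$ to $y\rhd x$. *Statement.* 1. For $2\le p\le q$ and $n\ge2$, $Q_n(T_{p,q})$ is finite if and only if $\frac1p+\frac1q+\frac1n>1$, that is, if and only if $(p,q)=(2,2)$, or $p=n=2$, or $(p,q,n)$ is one of $(2,3,3)$, $(2,3,4)$, $(2,3,5)$, $(2,4,3)$, $(2,5,3)$, $(3,3,2)$, $(3,4,2)$, $(3,5,2)$. 2. If $Q_n(T_{p,q})$ is finite, then reversing the orientation of any set of components of $T_{p,q}$ does not change it up to isomorphism, unless $(p,q,n)=(2,4,3)$; in that case every orientation gives a quandle isomorphic to $Q_3(T_{2,4})$ or to $Q_3(T_{2,4}^{+-})$, and these two are not isomorphic. 3. The orders and groups are as follows, up to isomorphism. | $Q$ | $\lvert Q\rvert$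 | Aut | Inn | Trans | |---|---|---|---|---| | $Q_n(T_{2,2})$, $n\ge2$ | $2$ | $\mathbb Z_2$ | $1$ | $1$ | | $Q_2(T_{2,q})$, $q\ge3$ | $q$ | $\mathbb Z_q\rtimes\mathbb Z_q^*$ | $D_{q/\gcd(2,q)}$ | $\mathbb Z_{q/\gcd(2,q)}$ | | $Q_3(T_{2,3})$ | $4$ | $A_4$ | $A_4$ | $\mathbb Z_2\times\mathbb Z_2$ | | $Q_4(T_{2,3})$ | $6$ | $S_4$ | $S_4$ | $A_4$ | | $Q_5(T_{2,3})$ | $12$ | $A_5$ | $A_5$ | $A_5$ | | $Q_3(T_{2,4})$ | $8$ | $S_4$ | $A_4$ | $A_4$ | | $Q_3(T_{2,4}^{+-})$ | $8$ | $\mathbb Z_2\times A_4$ | $A_4$ | $\mathbb Z_2\times\mathbb Z_2$ | | $Q_3(T_{2,5})$ | $20$ | $S_5$ | $A_5$ | $A_5$ | | $Q_2(T_{3,3})$ | $6$ | $\mathbb Z_2\times S_4$ | $\mathbb Z_2\times\mathbb Z_2$ | $\mathbb Z_2\times\mathbb Z_2$ | | $Q_2(T_{3,4})$ | $12$ | $\mathbb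 Z_2\times S_4$ | $S_4$ | $A_4$ | | $Q_2(T_{3,5})$ | $30$ | $\mathbb Z_2\times S_5$ | $A_5$ | $A_5$ | 4. The Cayley graphs are as follows. The elements can be numbered $0,1,\dots,\lvert Q\rvert-1$, with $a=0$, $b=1$ (and $c=2$ if $p=3$), so that the edges labelled $a$, $b$, $c$ lead from $0,1,2,\dots$ to the entries of the lists $S_a$, $S_b$, $S_c$, in this order. - $Q_n(T_{2,2})$, $n\ge2$: two vertices $a,b$, all edges are loops. - $Q_2(T_{2,q})$, $q\ge2$: the vertices are the elements of $\mathbb Z/q$, with $a=0$, $b=1$, $S_a(w)=-w$, $S_b(w)=2-w$. - $Q_3(T_{2,3})$: $S_a=(0,3,1,2)$, $S_b=(2,1,3,0)$. - $Q_4(T_{2,3})$: $S_a=(0,3,1,5,4,2)$, $S_b=(2,1,4,0,3,5)$. - $Q_5(T_{2,3})$: $S_a=(0,3,1,5,6,7,8,2,10,4,9,11)$, $S_b=(2,1,4,0,6,7,3,9,5,11,10,8)$. - $Q_3(T_{2,4})$: $S_a=(0,3,4,5,6,1,2,7)$, $S_b=(2,1,4,5,0,7,6,3)$. - $Q_3(T_{2,4}^{+-})$: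 $S_a=(0,3,4,6,5,2,1,7)$, $S_b=(2,1,5,7,4,0,3,6)$. - $Q_3(T_{2,5})$: $S_a=(0,3,4,6,8,9,1,5,2,7,14,15,16,11,17,13,18,10,12,19)$, $S_b=(2,1,5,7,6,0,10,11,12,13,4,3,14,16,8,17,9,19,18,15)$. - $Q_2(T_{3,3})$: $S_a=(0,4,5,3,1,2)$, $S_b=(3,1,5,0,4,2)$, $S_c=(3,4,2,0,1,5)$. - $Q_2(T_{3,4})$: $S_a=(0,5,7,9,10,1,8,2,6,3,4,11)$, $S_b=(3,1,8,0,7,11,10,4,2,9,6,5)$, $S_c=(4,6,2,5,0,3,1,11,9,8,10,7)$. - $Q_2(T_{3,5})$: $S_a=(0,5,7,9,11,1,12,2,10,3,8,4,6,22,23,17,25,15,27,24,28,26,13,14,19,16,21,18,20,29)$, $S_b=(3,1,8,0,12,13,15,14,2,18,19,16,4,5,7,6,11,26,9,10,23,25,29,20,28,21,17,27,24,22)$, $S_c=(4,6,2,10,0,14,1,16,17,13,3,20,21,9,5,24,7,8,23,22,11,12,19,18,15,29,27,26,28,25)$. -/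

import Mathlib

open scoped Quandles

/-! ### Quandles given by generators and relations

Mathlib writes quandles with a left action: `y ◃ x` is the point symmetry `S_y` at `y`, applied
to `x`, that is, what is written `x ▷ y` or `x ^ y` for right actions. -/

/-- Formal quandle expressions in generators from `A`. -/
inductive QuandleTerm (A : Type) : Type
  | gen (a : A) : QuandleTerm A
  | act (y x : QuandleTerm A) : QuandleTerm A
  | invAct (y x : QuandleTerm A) : QuandleTerm A

/-- The smallest congruence on quandle expressions that contains the relations `r` and
satisfies the quandle axioms. -/
inductive QuandleTerm.Rel {A : Type} (r : QuandleTerm A → QuandleTerm A → Prop) :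
    QuandleTerm A → QuandleTerm A → Prop
  | of {s t : QuandleTerm A} : r s t → Rel r s t
  | refl (s : QuandleTerm A) : Rel r s s
  | symm {s t : QuandleTerm A} : Rel r s t → Rel r t s
  | trans {s t u : QuandleTerm A} : Rel r s t → Rel r t u → Rel r s u
  | act_congr {s s' t t' : QuandleTerm A} : Rel r s s' → Rel r t t' →
      Rel r (s.act t) (s'.act t')
  | invAct_congr {s s' t t' : QuandleTerm A} : Rel r s s' → Rel r t t' →
      Rel r (s.invAct t) (s'.invAct t')
  | fix (x : QuandleTerm A) : Rel r (x.act x) x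
  | left_inv (y x : QuandleTerm A) : Rel r (y.invAct (y.act x)) x
  | right_inv (y x : QuandleTerm A) : Rel r (y.act (y.invAct x)) x
  | self_distrib (z y x : QuandleTerm A) :
      Rel r (z.act (y.act x)) ((z.act y).act (z.act x))

/-- The setoid of `QuandleTerm.Rel`. -/
def QuandleTerm.relSetoid {A : Type} (r : QuandleTerm A → QuandleTerm A → Prop) :
    Setoid (QuandleTerm A) where
  r := QuandleTerm.Rel r
  iseqv := ⟨QuandleTerm.Rel.refl, QuandleTerm.Rel.symm, QuandleTerm.Rel.trans⟩

/-- The quandle `⟨A ∣ r⟩`. -/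
def PresentedQuandle {A : Type} (r : QuandleTerm A → QuandleTerm A → Prop) : Type :=
  Quotient (QuandleTerm.relSetoid r)

instance PresentedQuandle.instQuandle {A : Type} (r : QuandleTerm A → QuandleTerm A → Prop) :
    Quandle (PresentedQuandle r) where
  act := Quotient.map₂ QuandleTerm.act fun _ _ h _ _ h' => QuandleTerm.Rel.act_congr h h'
  invAct := Quotient.map₂ QuandleTerm.invAct fun _ _ h _ _ h' =>
    QuandleTerm.Rel.invAct_congr h h'
  self_distrib := by
    rintro ⟨z⟩ ⟨y⟩ ⟨x⟩
    exact Quotient.sound (QuandleTerm.Rel.self_distrib z y x)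
  left_inv := by
    rintro ⟨y⟩ ⟨x⟩
    exact Quotient.sound (QuandleTerm.Rel.left_inv y x)
  right_inv := by
    rintro ⟨y⟩ ⟨x⟩
    exact Quotient.sound (QuandleTerm.Rel.right_inv y x)
  fix := by
    rintro ⟨x⟩
    exact Quotient.sound (QuandleTerm.Rel.fix x)

/-- The element of `⟨A ∣ r⟩` represented by a generator. -/
def PresentedQuandle.gen {A : Type} (r : QuandleTerm A → QuandleTerm A → Prop) (a : A) :
    PresentedQuandle r :=
  Quotient.mk (QuandleTerm.relSetoid r) (QuandleTerm.gen a)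

/-! ### Automorphism groups of a quandle -/

/-- The automorphism group of a quandle. -/
def quandleAut (Q : Type) [Quandle Q] : Subgroup (Equiv.Perm Q) where
  carrier := {f | ∀ x y, f (x ◃ y) = f x ◃ f y}
  one_mem' := fun _ _ => rfl
  mul_mem' := by
    intro f g hf hg x y
    simp only [Set.mem_ofPred_eq] at hf hg
    simp only [Equiv.Perm.coe_mul, Function.comp_apply, hg, hf]
  inv_mem' := by
    intro f hf x y
    simp only [Set.mem_ofPred_eq] at hf
    apply f.injective
    rw [hf]
    change f (f.symm _) = f (f.symm _) ◃ f (f.symm _)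
    simp only [Equiv.apply_symm_apply]

/-- The point symmetry `S_x : y ↦ y ▷ x`. -/
def pointSymmetry {Q : Type} [Quandle Q] (x : Q) : quandleAut Q :=
  ⟨Rack.act' x, fun _ _ => Shelf.self_distrib⟩

/-- The inner automorphism group, generated by all `S_x`. -/
def quandleInn (Q : Type) [Quandle Q] : Subgroup (quandleAut Q) :=
  Subgroup.closure {f | ∃ x : Q, f = pointSymmetry x}

/-- The transvection group, generated by all `S_x S_y⁻¹`. -/
def quandleTrans (Q : Type) [Quandle Q] : Subgroup (quandleAut Q) :=
  Subgroup.closure {f | ∃ x y : Q, f = pointSymmetry x * (pointSymmetry y)⁻¹}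

/-- Two quandles are isomorphic. -/
def QuandleIso (Q Q' : Type) [Quandle Q] [Quandle Q'] : Prop :=
  ∃ e : Q ≃ Q', ∀ x y, e (x ◃ y) = e x ◃ e y

/-- The quandle `Q` has order `N`, and its groups `Aut`, `Inn`, `Trans` are isomorphic to
`A`, `I`, `T`. -/
def HasQuandleData (Q : Type) [Quandle Q] (N : ℕ) (A I T : Type) [Group A] [Group I]
    [Group T] : Prop :=
  Nat.card Q = N ∧ Nonempty (quandleAut Q ≃* A) ∧ Nonempty (quandleInn Q ≃* I) ∧
    Nonempty (quandleTrans Q ≃* T)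

/-- The Cayley graph of `Q` with respect to the generators `x i` has one vertex for each element
of `Q` and, for each `i` and each element `y`, an edge labelled `i` from `y` to `y ▷ x i`.
This says that it is isomorphic to the labelled directed graph on `V` with an edge labelled `i`
from `w` to `E i w` for all `i` and `w`, in such a way that `x i` corresponds to the
vertex `v i`. -/
def HasCayleyGraph {Q V ι : Type} [Quandle Q] (x : ι → Q) (v : ι → V) (E : ι → V → V) : Prop :=
  ∃ e : Q ≃ V, ∀ i, e (x i) = v i ∧ ∀ y, e (x i ◃ y) = E i (e y)

/-! ### Link diagrams and their quandles -/

/-- The combinatorial data of an oriented link diagram that its quandle depends on: its arcs, its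
crossings, and for each crossing the over-arc and the two under-arcs that end there, namely the
one to the left and the one to the right of the oriented over-arc. -/
structure LinkDiagram where
  /-- the arcs -/
  Arc : Type
  /-- the crossings -/
  Crossing : Type
  /-- the arc that passes over at a crossing -/
  overArc : Crossing → Arc
  /-- the under-arc on the left of the over-arc -/
  leftArc : Crossing → Arc
  /-- the under-arc on the right of the over-arc -/
  rightArc : Crossing → Arc

namespace LinkDiagram

/-- The defining relations of the `n`-quandle of a diagram: at each crossing
`left = right ▷ over`, and `x ▷ y ▷ ⋯ ▷ y = x` (with `n` letters `y`) for all distinct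
generators `x`, `y`. -/
inductive NQuandleRel (D : LinkDiagram) (n : ℕ) :
    QuandleTerm D.Arc → QuandleTerm D.Arc → Prop
  | crossing (c : D.Crossing) :
      NQuandleRel D n (.gen (D.leftArc c)) (.act (.gen (D.overArc c)) (.gen (D.rightArc c)))
  | power (x y : D.Arc) (h : x ≠ y) :
      NQuandleRel D n ((QuandleTerm.act (.gen y))^[n] (.gen x)) (.gen x)

/-- The `n`-quandle `Q_n(L)` of the link with diagram `D`. -/
abbrev nQuandle (D : LinkDiagram) (n : ℕ) : Type := PresentedQuandle (D.NQuandleRel n)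

/-- The generator of the `n`-quandle that belongs to an arc. -/
def gen (D : LinkDiagram) (n : ℕ) (a : D.Arc) : D.nQuandle n :=
  PresentedQuandle.gen (D.NQuandleRel n) a

/-- A set of arcs is a union of link components if with one under-arc at a crossing
it also contains the other one. -/
def IsUnionOfComponents (D : LinkDiagram) (S : Set D.Arc) : Prop :=
  ∀ c, D.leftArc c ∈ S ↔ D.rightArc c ∈ S

/-- The arcs of the link component of the arc `a`. -/
def component (D : LinkDiagram) (a : D.Arc) : Set D.Arc :=
  {b | Relation.EqvGen (fun x y => ∃ c, x = D.leftArc c ∧ y = D.rightArc c) a b}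

open Classical in
/-- The diagram after reversing the orientation of the arcs in `S`: the left side and the right
side of these arcs are exchanged. -/
noncomputable def reverse (D : LinkDiagram) (S : Set D.Arc) : LinkDiagram where
  Arc := D.Arc
  Crossing := D.Crossing
  overArc := D.overArc
  leftArc c := if D.overArc c ∈ S then D.rightArc c else D.leftArc c
  rightArc c := if D.overArc c ∈ S then D.leftArc c else D.rightArc c

end LinkDiagram

/-! ### Torus links

`T_{p,q}` is the closure of the braid `(σ₁ σ₂ ⋯ σ_{p-1})^q` on `p` parallel strands, oriented
upwards, with `q` levels. From level `i` to level `i + 1` the strand in the leftmost position `0`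
passes over all the others and moves to the rightmost position `p - 1`; each of the others passes
under it and moves from its position `j + 1` to the position `j`. So a new arc starts at each of
the positions `0, …, p - 2` of each level `i + 1`, and the arc in position `p - 1` there is the
one that was in position `0` at level `i`. The arcs are indexed by the level and the position
where they start. For `p = 2` this is the standard diagram with `q` right-handed half twists. -/

/-- The arc of the standard diagram of `T_{p,q}` in position `k` at level `i`. -/
def torusStrand (p q : ℕ) (hp : 1 < p) (i : ZMod q) (k : Fin p) : ZMod q × Fin (p - 1) :=
  if hk : (k : ℕ) + 1 < p then (i, ⟨k, by omega⟩) else (i - 1, ⟨0, by omega⟩)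

/-- The standard diagram of the torus link `T_{p,q}`. -/
def torusLink (p q : ℕ) : LinkDiagram where
  Arc := ZMod q × Fin (p - 1)
  Crossing := ZMod q × Fin (p - 1)
  overArc c := (c.1, ⟨0, by have := c.2.2; omega⟩)
  leftArc c := (c.1 + 1, c.2)
  rightArc c := torusStrand p q (by have := c.2.2; omega) c.1
    ⟨c.2 + 1, by have := c.2.2; omega⟩

/-- The generators `a, b, …` of `Q_n(T_{p,q})`: the arcs in the positions `0, 1, …, p - 1`
at the bottom of the braid. -/
def torusGen (p q n : ℕ) (hp : 1 < p) (k : Fin p) : (torusLink p q).nQuandle n :=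
  (torusLink p q).gen n (torusStrand p q hp 0 k)

/-- `T_{2,4}^{+-}`: the link `T_{2,4}` with the orientation of the component of the
generator `b` reversed. -/
noncomputable def torusLink24pm : LinkDiagram :=
  (torusLink 2 4).reverse
    ((torusLink 2 4).component (torusStrand 2 4 Nat.one_lt_two 0 1))

/-- The generators `a`, `b` of `Q_n(T_{2,4}^{+-})`. -/
noncomputable def torusGen24pm (n : ℕ) (k : Fin 2) : torusLink24pm.nQuandle n :=
  torusLink24pm.gen n (torusStrand 2 4 Nat.one_lt_two 0 k)

/-! ### Some groups -/

/-- The cyclic group of order `m`, written multiplicatively. -/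
abbrev Cyc (m : ℕ) : Type := Multiplicative (ZMod m)

/-- The action `φ(u)(x) = u x` of the units of `ℤ/m` on the additive group `ℤ/m`. -/
def unitsCycHom (m : ℕ) : (ZMod m)ˣ →* MulAut (Cyc m) where
  toFun u :=
    { toFun := fun x => Multiplicative.ofAdd ((u : ZMod m) * Multiplicative.toAdd x)
      invFun := fun x =>
        Multiplicative.ofAdd (((u⁻¹ : (ZMod m)ˣ) : ZMod m) * Multiplicative.toAdd x)
      left_inv := fun x => by simp
      right_inv := fun x => by simp
      map_mul' := fun x y => by simp [mul_add] }
  map_one' := by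
    ext x
    simp
  map_mul' := fun u v => by
    ext x
    simp [mul_assoc]

/-- The group `ℤ_m ⋊ ℤ_m^*`. -/
abbrev CycHol (m : ℕ) : Type := Cyc m ⋊[unitsCycHom m] (ZMod m)ˣ

/-- The symmetric group on `m` letters. -/
abbrev SymGrp (m : ℕ) : Type := Equiv.Perm (Fin m)

/-- The alternating group on `m` letters. -/
abbrev AltGrp (m : ℕ) : Type := alternatingGroup (Fin m)

/-!
Pushing the strands of the braid `(σ₁ ⋯ σ_{p-1})^q` up one level at a time expresses every arc of
`T_{p,q}` by the generators `x_0, …, x_{p-1}` at the bottom: with indices read modulo `p`, the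
strand in position `k` at level `i` is `S_{x_0} ⋯ S_{x_{i-1}} x_{i+k}` (`gen_torusStrand`). So
`Q_n(T_{p,q})` is presented by these generators with the relations
`S_{x_0} ⋯ S_{x_{q-1}} x_{q+k} = x_k` and `S_{x_k} ^ n = 1` (`symmetryProd_torusGenMod`,
`act'_torusGen_pow`, `exists_hom_of_torus_relations`).

*Infinite quandles.* Let `x` and `ρ` be elements of a group for which `x ^ n`, `ρ ^ p` and
`(x ρ) ^ q` are central. Then the conjugates `ρ ^ k x ρ ^ (-k)` satisfy the relations above
(`exists_hom_conj_of_central_powers`). If `1/p + 1/q + 1/n < 1`, such elements of `SL₂(ℝ)` are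
given by rotations about vertices of a hyperbolic triangle with angles `π/p`, `π/q`, `π/n`; if the
sum is `1`, by complex affine maps that are rotations about vertices of a Euclidean triangle. Were
the quandle finite, the sum of the images of its elements in the matrix ring would commute with all
of these images (`commute_sum_of_hom_conj`), so that rotations about different points would have a
common fixed point.

*Finite quandles.* For `p = n = 2` the generators multiply like the elements of the dihedral quandle
`w, w' ↦ 2 w - w'` on `ℤ/q`, whose automorphisms are the affine permutations. In each of the eight
other cases with `1/p + 1/q + 1/n > 1` beside the Hopf link, and for `T_{2,4}` with one component
reversed, the given table is shown to be the Cayley graph of an explicit augmented quandle, that is,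
of a set `X` with an action of a group `A` and an equivariant map from `X` to `A`: the elements of a
given order or in a given conjugacy class of `A_4`, `S_4`, `A_5` or `S_5`, acting by conjugation,
also with their squares in place of them, or in two copies; and for `T_{3,4}` the ordered pairs of
different letters among four. As the relations hold there, the presented quandle maps onto it. A
coset enumeration, which is evaluated by the kernel and proved to be sound
(`exists_equiv_of_complete`), shows that the presented quandle is not larger.

*Groups.* The group `A` acts faithfully by automorphisms. The orbit of the first generator has at
most `N = |Q|` elements, and an automorphism that fixes it is determined by the images of the other
generators, which satisfy the same equations as these; counting the tuples that do bounds the order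
of the automorphism group by that of `A` (`card_quandleAut_le`). The groups `Inn` and `Trans` are
then computed in `A`, by showing that every element is a short product of the generating ones, or
from the simplicity of `A_5`.

*Orientations.* A `2`-quandle does not depend on the orientation at all. What remains is `p = 2`,
where rotating the closed braid and reading it backwards relate all orientations, except that for
`T_{2,4}` the parallel and the antiparallel one are not related. Their `3`-quandles are not
isomorphic, as the transvection groups have the orders `12` and `4`.
-/

/-! ### Homomorphisms out of presented quandles -/

namespace QuandleTerm

/-- The value of a quandle expression in `X` for given values of the generators. -/
def eval {A X : Type} [Quandle X] (c : A → X) : QuandleTerm A → X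
  | gen a => c a
  | act y x => eval c y ◃ eval c x
  | invAct y x => eval c y ◃⁻¹ eval c x

theorem Rel.eval_eq {A X : Type} [Quandle X] {r : QuandleTerm A → QuandleTerm A → Prop}
    (c : A → X) (hr : ∀ s t, r s t → s.eval c = t.eval c) {s t : QuandleTerm A}
    (h : Rel r s t) : s.eval c = t.eval c := by
  induction h with
  | of h => exact hr _ _ h
  | refl => rfl
  | symm _ ih => exact ih.symm
  | trans _ _ ih₁ ih₂ => exact ih₁.trans ih₂
  | act_congr _ _ ih₁ ih₂ => simp only [eval, ih₁, ih₂]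
  | invAct_congr _ _ ih₁ ih₂ => simp only [eval, ih₁, ih₂]
  | fix => exact Quandle.fix
  | left_inv => exact Rack.left_inv _ _
  | right_inv => exact Rack.right_inv _ _
  | self_distrib => exact Shelf.self_distrib

theorem eval_act_iterate {A X : Type} [Quandle X] (c : A → X) (y : A) (t : QuandleTerm A)
    (n : ℕ) : ((act (gen y))^[n] t).eval c = (Rack.act' (c y) ^ n) (t.eval c) := by
  induction n with
  | zero => rfl
  | succ n ih => rw [Function.iterate_succ_apply', pow_succ', Equiv.Perm.mul_apply, ← ih]; rfl

end QuandleTerm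

namespace PresentedQuandle

variable {A : Type} {r : QuandleTerm A → QuandleTerm A → Prop}

/-- The homomorphism out of a presented quandle given by values of the generators that
satisfy the relations. -/
def lift {X : Type} [Quandle X] (c : A → X) (hr : ∀ s t, r s t → s.eval c = t.eval c) :
    PresentedQuandle r →◃ X where
  toFun := Quotient.lift (QuandleTerm.eval c) fun _ _ h => QuandleTerm.Rel.eval_eq c hr h
  map_act' := by
    rintro ⟨x⟩ ⟨y⟩
    rfl

theorem mk_eq_eval (t : QuandleTerm A) :
    (Quotient.mk (QuandleTerm.relSetoid r) t : PresentedQuandle r) = t.eval (gen r) := by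
  induction t with
  | gen a => rfl
  | act y x ihy ihx => rw [QuandleTerm.eval, ← ihy, ← ihx]; rfl
  | invAct y x ihy ihx => rw [QuandleTerm.eval, ← ihy, ← ihx]; rfl

theorem eval_gen_eq {s t : QuandleTerm A} (h : r s t) : s.eval (gen r) = t.eval (gen r) := by
  rw [← mk_eq_eval, ← mk_eq_eval]
  exact Quotient.sound (QuandleTerm.Rel.of h)

theorem induction {P : PresentedQuandle r → Prop} (hgen : ∀ a, P (gen r a))
    (hact : ∀ y x, P y → P x → P (y ◃ x)) (hinv : ∀ y x, P y → P x → P (y ◃⁻¹ x))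
    (x : PresentedQuandle r) : P x := by
  obtain ⟨t, rfl⟩ := Quotient.exists_rep x
  rw [mk_eq_eval]
  induction t with
  | gen a => exact hgen a
  | act y x ihy ihx => exact hact _ _ ihy ihx
  | invAct y x ihy ihx => exact hinv _ _ ihy ihx

end PresentedQuandle

/-! ### Generating families -/

/-- The family `x` generates the quandle `Q`, in the form of an induction principle: a property of
the `x i` that is preserved and reflected by the point symmetries at the `x i` holds
everywhere. So every element is in the orbit of some `x i` under the group generated by these
symmetries. -/
def QuandleGenerates {Q ι : Type} [Quandle Q] (x : ι → Q) : Prop :=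
  ∀ P : Q → Prop, (∀ i, P (x i)) → (∀ i y, P y ↔ P (x i ◃ y)) → ∀ y, P y

theorem PresentedQuandle.generates_gen {A : Type}
    (r : QuandleTerm A → QuandleTerm A → Prop) : QuandleGenerates (PresentedQuandle.gen r) := by
  intro P hgen hact y
  -- the elements whose point symmetry preserves and reflects `P` form a subquandle
  suffices h : P y ∧ ∀ z, P z ↔ P (y ◃ z) from h.1
  induction y using PresentedQuandle.induction with
  | hgen a => exact ⟨hgen a, hact a⟩
  | hact y x hy hx =>
    refine ⟨(hy.2 x).1 hx.1, fun z => ?_⟩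
    obtain ⟨z, rfl⟩ := (Rack.act' y).surjective z
    rw [Rack.act'_apply, ← Shelf.self_distrib, ← hy.2, ← hy.2, ← hx.2]
  | hinv y x hy hx =>
    have hinv : ∀ z, P z ↔ P (y ◃⁻¹ z) := fun z => by
      rw [hy.2 (y ◃⁻¹ z), Rack.act_invAct_eq]
    refine ⟨(hinv x).1 hx.1, fun z => ?_⟩
    rw [hy.2 z, hx.2 (y ◃ z), hy.2 ((y ◃⁻¹ x) ◃ z), Shelf.self_distrib (x := y),
      Rack.act_invAct_eq]

namespace QuandleGenerates

variable {Q ι : Type} [Quandle Q] {x : ι → Q}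

theorem hom_ext {X : Type*} [Quandle X] (hx : QuandleGenerates x) {f g : Q →◃ X}
    (h : ∀ i, f (x i) = g (x i)) (y : Q) : f y = g y := by
  refine hx (fun y => f y = g y) h (fun i y => ?_) y
  simp only [ShelfHom.map_act, h i]
  exact (Rack.left_cancel _).symm

theorem perm_ext (hx : QuandleGenerates x) {f g : quandleAut Q}
    (h : ∀ i, (f : Equiv.Perm Q) (x i) = (g : Equiv.Perm Q) (x i)) : f = g :=
  Subtype.ext <| Equiv.ext <|
    hx.hom_ext (f := ⟨f.1, fun {a b} => f.2 a b⟩) (g := ⟨g.1, fun {a b} => g.2 a b⟩) h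

/-- Generators are carried to generators by a surjective homomorphism. -/
theorem map {X : Type} [Quandle X] (hx : QuandleGenerates x) (f : Q →◃ X)
    (hf : Function.Surjective f) : QuandleGenerates fun i => f (x i) := by
  intro P hP hact y
  obtain ⟨y, rfl⟩ := hf y
  refine hx (fun y => P (f y)) hP (fun i y => ?_) y
  rw [ShelfHom.map_act]
  exact hact i (f y)

/-- If a family `x` generates, it suffices for another family `z` that the properties to which the
induction principle for `z` applies hold for the `x i` and are preserved and reflected by their
point symmetries. -/
theorem of_subset {κ : Type} {z : κ → Q} (hx : QuandleGenerates x)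
    (h : ∀ P : Q → Prop, (∀ k, P (z k)) → (∀ k y, P y ↔ P (z k ◃ y)) →
      ∀ i, P (x i) ∧ ∀ y, P y ↔ P (x i ◃ y)) : QuandleGenerates z :=
  fun P hP hact => hx P (fun i => (h P hP hact i).1) fun i => (h P hP hact i).2

end QuandleGenerates

/-- An automorphism conjugates the point symmetry at `x` to the one at its image. -/
theorem quandleAut.act'_map {Q : Type} [Quandle Q] (f : quandleAut Q) (x : Q) :
    Rack.act' ((f : Equiv.Perm Q) x) = f * Rack.act' x * (f : Equiv.Perm Q)⁻¹ := by
  ext y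
  obtain ⟨y, rfl⟩ := (f : Equiv.Perm Q).surjective y
  simp [(f.2 x y)]

/-! ### The `n`-quandle of a diagram -/

namespace LinkDiagram

variable (D : LinkDiagram) (n : ℕ)

theorem generates_gen : QuandleGenerates (D.gen n) :=
  PresentedQuandle.generates_gen _

theorem gen_leftArc (c : D.Crossing) :
    D.gen n (D.leftArc c) = D.gen n (D.overArc c) ◃ D.gen n (D.rightArc c) :=
  PresentedQuandle.eval_gen_eq (NQuandleRel.crossing (n := n) c)

/-- The relations `x ▷ y ▷ ⋯ ▷ y = x` on generators force `S_y ^ n = 1` on the whole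
quandle. -/
theorem act'_gen_pow (y : D.Arc) : Rack.act' (D.gen n y) ^ n = 1 := by
  have key : (pointSymmetry (D.gen n y)) ^ n = 1 := by
    refine (D.generates_gen n).perm_ext fun x => ?_
    rw [SubgroupClass.coe_pow]
    change (Rack.act' (D.gen n y) ^ n) (D.gen n x) = D.gen n x
    by_cases h : x = y
    · subst h
      exact Function.IsFixedPt.perm_pow
        (show Function.IsFixedPt (Rack.act' (D.gen n x)) (D.gen n x) from
          Quandle.fix (x := D.gen n x)) n
    · have := PresentedQuandle.eval_gen_eq (NQuandleRel.power (n := n) x y h)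
      rwa [QuandleTerm.eval_act_iterate] at this
  exact congrArg Subtype.val key

/-- A colouring of the arcs by elements of a quandle that respects the crossings, with point
symmetries of order dividing `n`, gives a homomorphism out of the `n`-quandle. -/
def lift {X : Type} [Quandle X] (c : D.Arc → X)
    (hc : ∀ k, c (D.leftArc k) = c (D.overArc k) ◃ c (D.rightArc k))
    (hn : ∀ x y, (Rack.act' (c y) ^ n) (c x) = c x) : D.nQuandle n →◃ X :=
  PresentedQuandle.lift c <| by
    rintro _ _ (k | ⟨x, y, -⟩)
    · exact hc k
    · rw [QuandleTerm.eval_act_iterate]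
      exact hn x y

@[simp]
theorem lift_gen {X : Type} [Quandle X] (c : D.Arc → X) (hc) (hn) (a : D.Arc) :
    D.lift n c hc hn (D.gen n a) = c a :=
  rfl

end LinkDiagram

/-! ### The quandle of a torus link in terms of the strands at the bottom -/

/-- The product `S_{y 0} S_{y 1} ⋯ S_{y (i - 1)}` of point symmetries. -/
def symmetryProd {Y : Type} [Quandle Y] (y : ℕ → Y) : ℕ → quandleAut Y
  | 0 => 1
  | i + 1 => symmetryProd y i * pointSymmetry (y i)

theorem symmetryProd_succ_apply {Y : Type} [Quandle Y] (y : ℕ → Y) (i : ℕ) (z : Y) :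
    (symmetryProd y (i + 1) : Equiv.Perm Y) z = (symmetryProd y i : Equiv.Perm Y) (y i ◃ z) :=
  rfl

theorem symmetryProd_act {Y : Type} [Quandle Y] (y : ℕ → Y) (i : ℕ) (w z : Y) :
    (symmetryProd y i : Equiv.Perm Y) (w ◃ z) =
      (symmetryProd y i : Equiv.Perm Y) w ◃ (symmetryProd y i : Equiv.Perm Y) z :=
  (symmetryProd y i).2 w z

theorem torusStrand_of_lt {p q : ℕ} (hp : 1 < p) (i : ZMod q) {k : ℕ} (hk : k + 1 < p) :
    torusStrand p q hp i ⟨k, by omega⟩ = (i, ⟨k, by omega⟩) := by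
  rw [torusStrand, dif_pos (show k + 1 < p from hk)]

theorem torusStrand_of_eq {p q : ℕ} (hp : 1 < p) (i : ZMod q) {k : ℕ} (hk : k + 1 = p) :
    torusStrand p q hp i ⟨k, by omega⟩ = (i - 1, ⟨0, by omega⟩) := by
  rw [torusStrand, dif_neg (show ¬ k + 1 < p by omega)]

/-- The generators at the bottom of the braid, indexed by the residue modulo `p`. -/
def torusGenMod (p q n : ℕ) (hp : 1 < p) (j : ℕ) : (torusLink p q).nQuandle n :=
  torusGen p q n hp ⟨j % p, Nat.mod_lt _ (by omega)⟩

theorem torusGenMod_of_lt {p q n : ℕ} (hp : 1 < p) {j : ℕ} (hj : j < p) :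
    torusGenMod p q n hp j = torusGen p q n hp ⟨j, hj⟩ := by
  simp only [torusGenMod, Nat.mod_eq_of_lt hj]

theorem torusGenMod_add (p q n : ℕ) (hp : 1 < p) (j : ℕ) :
    torusGenMod p q n hp (j + p) = torusGenMod p q n hp j := by
  simp only [torusGenMod, Nat.add_mod_right]

/-- With `x_j` the generator number `j` modulo `p` at the bottom, the strand in position `k` at
level `i` is `S_{x_0} ⋯ S_{x_{i-1}} x_{i+k}`: up to the symmetry `S_{x_0}`, one factor of the
braid permutes the strands cyclically. -/
theorem gen_torusStrand {p q : ℕ} (n : ℕ) (hp : 1 < p) (i : ℕ) {k : ℕ} (hk : k < p) :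
    (torusLink p q).gen n (torusStrand p q hp i ⟨k, hk⟩) =
      (symmetryProd (torusGenMod p q n hp) i : Equiv.Perm _) (torusGenMod p q n hp (i + k)) := by
  induction i generalizing k with
  | zero =>
    rw [zero_add, torusGenMod_of_lt hp hk, Nat.cast_zero]
    rfl
  | succ i ih =>
    have h0 := ih (k := 0) (by omega)
    rw [torusStrand_of_lt hp _ (by omega)] at h0
    rcases Nat.lt_or_ge (k + 1) p with h | h
    · have hc := (torusLink p q).gen_leftArc n ((i : ZMod q), ⟨k, by omega⟩)
      have h1 := ih h
      rw [torusStrand_of_lt hp _ h, Nat.cast_succ]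
      refine hc.trans ?_
      refine (congrArg₂ (· ◃ ·) h0 h1).trans ?_
      rw [symmetryProd_succ_apply, symmetryProd_act, add_zero,
        show i + 1 + k = i + (k + 1) by omega]
    · have h' : k + 1 = p := by omega
      rw [torusStrand_of_eq hp _ h', Nat.cast_succ, add_sub_cancel_right, h0,
        symmetryProd_succ_apply, show i + 1 + k = i + 0 + p by omega, torusGenMod_add]
      simp only [add_zero]
      rw [Quandle.fix]

theorem symmetryProd_torusGenMod {p q : ℕ} (n : ℕ) (hp : 1 < p) {k : ℕ} (hk : k < p) :
    (symmetryProd (torusGenMod p q n hp) q : Equiv.Perm _) (torusGenMod p q n hp (q + k)) =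
      torusGenMod p q n hp k := by
  rw [← gen_torusStrand n hp q hk, torusGenMod_of_lt hp hk, ZMod.natCast_self]
  rfl

theorem act'_torusGen_pow (p q n : ℕ) (hp : 1 < p) (k : Fin p) :
    Rack.act' (torusGen p q n hp k) ^ n = 1 :=
  (torusLink p q).act'_gen_pow n _

theorem generates_torusGen (p q n : ℕ) [NeZero q] (hp : 1 < p) :
    QuandleGenerates (torusGen p q n hp) := by
  refine ((torusLink p q).generates_gen n).of_subset fun P hP hact => ?_
  have hW : ∀ i z, P z ↔ P ((symmetryProd (torusGenMod p q n hp) i : Equiv.Perm _) z) := by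
    intro i
    induction i with
    | zero => exact fun z => Iff.rfl
    | succ i ih =>
      intro z
      rw [symmetryProd_succ_apply, ← ih]
      exact hact _ _
  rintro ⟨i, k⟩
  have hk : (k : ℕ) + 1 < p := by have := k.2; omega
  have hik := gen_torusStrand (q := q) n hp i.val (k := k) (by omega)
  rw [torusStrand_of_lt hp _ hk, ZMod.natCast_val, ZMod.cast_id] at hik
  constructor
  · exact (congrArg P hik).mpr ((hW _ _).1 (hP _))
  · intro y
    obtain ⟨y, rfl⟩ :=
      (symmetryProd (torusGenMod p q n hp) i.val : Equiv.Perm _).surjective y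
    rw [← hW]
    have hj : P y ↔ P (torusGenMod p q n hp (i.val + k) ◃ y) := hact _ y
    rw [hj, hW i.val, symmetryProd_act]
    exact iff_of_eq (congrArg (fun z => P (z ◃ _)) hik.symm)

/-- The relations of `symmetryProd_torusGenMod` together with those for the orders of the point
symmetries present the `n`-quandle of a torus link. -/
theorem exists_hom_of_torus_relations {p q : ℕ} [NeZero q] (n : ℕ) (hp : 1 < p) {Y : Type}
    [Quandle Y] (y : ℕ → Y) (hper : ∀ j, y (j + p) = y j)
    (hclose : ∀ k < p, (symmetryProd y q : Equiv.Perm Y) (y (q + k)) = y k)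
    (hn : ∀ j, Rack.act' (y j) ^ n = 1) :
    ∃ f : (torusLink p q).nQuandle n →◃ Y, ∀ k : Fin p, f (torusGen p q n hp k) = y k := by
  let col : ℕ → ℕ → Y := fun i k => (symmetryProd y i : Equiv.Perm Y) (y (i + k))
  have hcol0 : ∀ k, col 0 k = y k := fun k => by simp [col, symmetryProd]
  have hmod : ∀ k, y k = y (k % p) := fun k => by
    conv_lhs => rw [← Nat.mod_add_div' k p]
    induction k / p with
    | zero => simp
    | succ m ih => rw [add_one_mul, ← add_assoc, hper, ih]
  have hcolq : ∀ k, k < p → col q k = y k := fun k hk => hclose k hk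
  have hcols : ∀ i k, col (i + 1) k = col i 0 ◃ col i (k + 1) := fun i k => by
    simp only [col]
    rw [symmetryProd_succ_apply, symmetryProd_act, add_zero,
        show i + 1 + k = i + (k + 1) by omega]
  have hlast : ∀ i k, k + 1 = p → col (i + 1) k = col i 0 := fun i k hk => by
    simp only [col]
    rw [symmetryProd_succ_apply, show i + 1 + k = i + 0 + p by omega, hper, add_zero,
      Quandle.fix]
  have hval : ∀ (i : ZMod q) k, k < p → col (i + 1).val k = col (i.val + 1) k := fun i k hk => by
    have h1 : i + 1 = ((i.val + 1 : ℕ) : ZMod q) := by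
      rw [Nat.cast_succ, ZMod.natCast_zmod_val]
    rcases Nat.lt_or_ge (i.val + 1) q with h | h
    · rw [h1, ZMod.val_natCast_of_lt h]
    · have h' : i.val + 1 = q := le_antisymm (ZMod.val_lt i) h
      rw [h1, h', ZMod.natCast_self, ZMod.val_zero, hcol0, hcolq k hk]
  have hstrand : ∀ (i : ZMod q) (k : ℕ) (hk : k < p),
      col (torusStrand p q hp i ⟨k, hk⟩).1.val (torusStrand p q hp i ⟨k, hk⟩).2 =
        col i.val k := fun i k hk => by
    rcases Nat.lt_or_ge (k + 1) p with h | h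
    · rw [torusStrand_of_lt hp i h]
    · have h' : k + 1 = p := by omega
      rw [torusStrand_of_eq hp i h', ← hlast _ k h', ← hval _ k hk, sub_add_cancel]
  let f := (torusLink p q).lift n (fun a => col a.1.val a.2) (fun c => by
    have hk : (c.2 : ℕ) + 1 < p := by have := c.2.2; omega
    refine (hval c.1 c.2 (by omega)).trans ?_
    rw [hcols]
    exact congrArg₂ (· ◃ ·) rfl (hstrand c.1 (c.2 + 1) hk).symm) (fun a b => by
    have h1 : Rack.act' (col b.1.val b.2) ^ n = 1 := by
      simp only [col]
      rw [quandleAut.act'_map, conj_pow, hn, mul_one, mul_inv_cancel]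
    rw [h1]
    rfl)
  refine ⟨f, fun k => ?_⟩
  refine ((torusLink p q).lift_gen n _ _ _ _).trans ?_
  rw [hstrand 0 k k.2, ZMod.val_zero, hcol0]

/-! ### Infinite quandles of torus links -/

theorem Quandle.conj_act'_pow_apply {G : Type} [Group G] (x z : Quandle.Conj G) (n : ℕ) :
    (Rack.act' x ^ n) z = (x : G) ^ n * z * ((x : G) ^ n)⁻¹ := by
  induction n with
  | zero => simp
  | succ n ih =>
    rw [pow_succ', Equiv.Perm.mul_apply, ih]
    change (x : G) * _ * (x : G)⁻¹ = _
    group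

/-- Let `x` and `ρ` be elements of a group such that the `n`-th, `p`-th and `q`-th powers of `x`,
`ρ` and `x ρ` are central. Then the `p` conjugates of `x` by the powers of `ρ` colour the diagram of
`T_{p,q}`. For the triangle group with angles `π / p`, `π / q`, `π / n` these are
rotations about the vertices of a regular `p`-gon. -/
theorem exists_hom_conj_of_central_powers {p q : ℕ} [NeZero q] (n : ℕ) (hp : 1 < p)
    {G : Type} [Group G] (x ρ : G) (hx : ∀ g, Commute (x ^ n) g) (hρ : ∀ g, Commute (ρ ^ p) g)
    (hxρ : ∀ g, Commute ((x * ρ) ^ q) g) :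
    ∃ f : (torusLink p q).nQuandle n →◃ Quandle.Conj G,
      ∀ k : Fin p, f (torusGen p q n hp k) = ρ ^ (k : ℕ) * x * (ρ ^ (k : ℕ))⁻¹ := by
  let y : ℕ → Quandle.Conj G := fun j => ρ ^ j * x * (ρ ^ j)⁻¹
  have hprod : ∀ i z, (symmetryProd y i : Equiv.Perm (Quandle.Conj G)) z =
      ((x * ρ) ^ i * (ρ ^ i)⁻¹) * z * ((x * ρ) ^ i * (ρ ^ i)⁻¹)⁻¹ := by
    intro i
    induction i with
    | zero => intro z; simp [symmetryProd]
    | succ i ih =>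
      intro z
      rw [symmetryProd_succ_apply, ih]
      change _ * (ρ ^ i * x * (ρ ^ i)⁻¹ * z * (ρ ^ i * x * (ρ ^ i)⁻¹)⁻¹) * _ = _
      simp only [pow_succ, mul_inv_rev, inv_inv]
      group
  refine exists_hom_of_torus_relations n hp y (fun j => ?_) (fun k _ => ?_) fun j => ?_
  · change ρ ^ (j + p) * x * (ρ ^ (j + p))⁻¹ = ρ ^ j * x * (ρ ^ j)⁻¹
    have := (hρ x).eq
    rw [pow_add, mul_assoc (ρ ^ j), this]
    group
  · rw [hprod]
    change _ * (ρ ^ (q + k) * x * (ρ ^ (q + k))⁻¹) * _ = ρ ^ k * x * (ρ ^ k)⁻¹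
    have h := (hxρ (ρ ^ k * x * (ρ ^ k)⁻¹)).eq
    rw [← mul_inv_eq_iff_eq_mul.2 h]
    simp only [pow_add]
    group
  · ext z
    rw [Quandle.conj_act'_pow_apply]
    change (ρ ^ j * x * (ρ ^ j)⁻¹) ^ n * _ * ((ρ ^ j * x * (ρ ^ j)⁻¹) ^ n)⁻¹ = z
    rw [conj_pow, ← (hx (ρ ^ j)).eq, mul_inv_cancel_right]
    exact mul_inv_eq_of_eq_mul (hx z).eq

/-- The barycentre of a finite quandle of invertible elements of a ring commutes with
all of its elements. -/
theorem commute_sum_of_hom_conj {Q G M : Type} [Quandle Q] [Fintype Q] [Group G] [Ring M]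
    (ι : G →* M) (f : Q →◃ Quandle.Conj G) (x : Q) :
    Commute (∑ z, ι (f z)) (ι (f x)) := by
  have h1 : ∀ z, ι (f x) * ι (f z) = ι (f (x ◃ z)) * ι (f x) := fun z => by
    rw [ShelfHom.map_act, ← map_mul ι, ← map_mul ι]
    change _ = ι ((f x : G) * f z * (f x : G)⁻¹ * f x)
    rw [inv_mul_cancel_right]
  have h2 : ∑ z, ι (f (x ◃ z)) = ∑ z, ι (f z) :=
    Equiv.sum_comp (Rack.act' x) fun z => ι (f z)
  rw [Commute, SemiconjBy, Finset.mul_sum]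
  rw [Finset.sum_congr rfl fun z _ => h1 z, ← Finset.sum_mul, h2]

/-! #### The hyperbolic case -/

section Hyperbolic

open Matrix

/-- By the recursion of the Chebyshev polynomials, the powers of a matrix with determinant `1`
and trace `2 cos θ` are those of a rotation through `θ`. -/
theorem sin_smul_pow_of_sq {A : Matrix (Fin 2) (Fin 2) ℝ} {θ : ℝ}
    (h : A * A = (2 * Real.cos θ) • A - 1) (k : ℕ) :
    Real.sin θ • A ^ k = Real.sin (k * θ) • A - Real.sin (k * θ - θ) • 1 := by
  induction k with
  | zero => simp
  | succ k ih =>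
    rw [pow_succ, ← smul_mul_assoc, ih, sub_mul, smul_mul_assoc, h]
    have e1 : Real.sin ((k + 1 : ℕ) * θ) =
        2 * Real.cos θ * Real.sin (k * θ) - Real.sin (k * θ - θ) := by
      rw [Nat.cast_succ, add_one_mul, Real.sin_add, Real.sin_sub]
      ring
    have e2 : ((k + 1 : ℕ) : ℝ) * θ - θ = k * θ := by push_cast; ring
    rw [e1, e2]
    simp only [smul_sub, smul_smul, sub_smul, smul_mul_assoc, one_mul]
    rw [mul_comm (Real.sin (k * θ))]
    abel

/-- The inclusion of `SL₂(ℝ)` in the matrix ring. -/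
local notation "φ" =>
  (SpecialLinearGroup.coeMonoidHom : SpecialLinearGroup (Fin 2) ℝ →* Matrix (Fin 2) (Fin 2) ℝ)

/-- An element of `SL₂(ℝ)` with trace `± 2 cos (π / n)` has order `n` modulo the centre. -/
theorem commute_pow_of_trace_eq {A : SpecialLinearGroup (Fin 2) ℝ} {n : ℕ} (hn : 2 ≤ n)
    (h : φ A 0 0 + φ A 1 1 = 2 * Real.cos (Real.pi / n) ∨
      φ A 0 0 + φ A 1 1 = -(2 * Real.cos (Real.pi / n))) (g : SpecialLinearGroup (Fin 2) ℝ) :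
    Commute (A ^ n) g := by
  have hn0 : (n : ℝ) ≠ 0 := by positivity
  have hsin : 0 < Real.sin (Real.pi / n) := by
    refine Real.sin_pos_of_pos_of_lt_pi (by positivity) (div_lt_self Real.pi_pos ?_)
    exact_mod_cast hn
  have key : ∀ B : Matrix (Fin 2) (Fin 2) ℝ, B.det = 1 →
      B 0 0 + B 1 1 = 2 * Real.cos (Real.pi / n) → B ^ n = -1 := by
    intro B hdet htr
    rw [det_fin_two] at hdet
    have hsq : B * B = (2 * Real.cos (Real.pi / n)) • B - 1 := by
      rw [← htr]
      ext i j
      fin_cases i <;> fin_cases j <;>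
        simp [Matrix.mul_apply, Fin.sum_univ_two] <;> linarith
    have := sin_smul_pow_of_sq hsq n
    rw [mul_div_cancel₀ _ hn0, Real.sin_pi, Real.sin_pi_sub, zero_smul, zero_sub,
      ← smul_neg] at this
    exact smul_right_injective _ hsin.ne' this
  have hdet : (φ A).det = 1 := A.2
  have hpm : φ (A ^ n) = 1 ∨ φ (A ^ n) = -1 := by
    rw [map_pow]
    rcases h with h | h
    · exact Or.inr (key _ hdet h)
    · have := key (-φ A) (by rw [det_neg, hdet]; simp)
        (by rw [neg_apply, neg_apply]; linarith)
      rw [neg_pow] at this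
      rcases neg_one_pow_eq_or (Matrix (Fin 2) (Fin 2) ℝ) n with e | e <;> rw [e] at this
      · exact Or.inr (by simpa using this)
      · exact Or.inl (by simpa using this)
  apply SpecialLinearGroup.coeMonoidHom_injective
  rw [map_mul, map_mul]
  rcases hpm with e | e <;> rw [e] <;> simp

theorem coeMonoidHom_inv (g : SpecialLinearGroup (Fin 2) ℝ) :
    φ g⁻¹ = !![φ g 1 1, -φ g 0 1; -φ g 1 0, φ g 0 0] :=
  adjugate_fin_two _

/-- An elliptic element of `SL₂(ℝ)` that turns counterclockwise has a positive lower left entry,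
and this is preserved under conjugation. -/
theorem conj_apply_one_zero_pos (g A : SpecialLinearGroup (Fin 2) ℝ) {k s t : ℝ} (hs : 0 < s)
    (ht : 0 < t) (hA : φ A = !![k, -s; t, k]) : 0 < φ (g * A * g⁻¹) 1 0 := by
  have hdet : (φ g).det = 1 := g.2
  rw [det_fin_two] at hdet
  have e : φ (g * A * g⁻¹) 1 0 = t * φ g 1 1 ^ 2 + s * φ g 1 0 ^ 2 := by
    rw [map_mul, map_mul, coeMonoidHom_inv, hA]
    generalize φ g = B
    simp [Matrix.mul_apply, Fin.sum_univ_two]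
    ring
  rw [e]
  rcases eq_or_ne (φ g 1 1) 0 with h | h
  · have : φ g 1 0 ≠ 0 := fun h' => by rw [h, h'] at hdet; simp at hdet
    positivity
  · positivity

/-- A matrix with nonzero lower left entry does not commute both with `X = !![k, -s; t, k]` and
with its conjugate under a proper rotation, unless `X` is itself a multiple of a
rotation. -/
theorem false_of_commute_of_commute_conj {S : Matrix (Fin 2) (Fin 2) ℝ} {k s t a b : ℝ}
    (hs : 0 < s) (ht : 0 < t) (hst : s ≠ t) (hb : b ≠ 0) (hS : S 1 0 ≠ 0)
    (h : Commute S !![k, -s; t, k])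
    (h' : Commute S (!![a, -b; b, a] * !![k, -s; t, k] * !![a, b; -b, a])) : False := by
  have e := congrFun (congrFun h.eq 0) 0
  have f := congrFun (congrFun h'.eq 0) 0
  simp [Matrix.mul_apply, Fin.sum_univ_two] at e f
  have e' : S 0 1 * t = -s * S 1 0 := by linear_combination e
  have : b ^ 2 * ((t - s) * (t + s) * S 1 0) = 0 := by
    linear_combination t * f - (a ^ 2 * t + b ^ 2 * s) * e'
  simp [hb, sub_eq_zero, hst.symm, hS, (add_pos ht hs).ne'] at this

/-- The quandle maps to the conjugates of an elliptic element `X` of `SL₂(ℝ)`. If it were finite,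
the sum of its images would have a positive lower left entry and would commute with two rotations
about different points. -/
theorem infinite_nQuandle_of_hyperbolic {p q n : ℕ} (hp : 2 ≤ p) (hq : 2 ≤ q) (hn : 2 ≤ n)
    (h : (1 / p + 1 / q + 1 / n : ℝ) < 1) : Infinite ((torusLink p q).nQuandle n) := by
  have : NeZero q := ⟨by omega⟩
  have hpi := Real.pi_pos
  have hangle : ∀ m : ℕ, 2 ≤ m → 0 < Real.pi / m ∧ Real.pi / m < Real.pi := fun m hm =>
    ⟨by positivity, div_lt_self hpi (by exact_mod_cast hm)⟩
  obtain ⟨hα0, hαπ⟩ := hangle p hp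
  obtain ⟨hβ0, hβπ⟩ := hangle q hq
  obtain ⟨hγ0, hγπ⟩ := hangle n hn
  have hsum : Real.pi / p + Real.pi / q + Real.pi / n < Real.pi := by
    have := mul_lt_mul_of_pos_left h hpi
    calc _ = Real.pi * (1 / p + 1 / q + 1 / n) := by ring
      _ < _ := by linarith
  set α := Real.pi / p with hα
  set β := Real.pi / q with hβ
  set γ := Real.pi / n with hγ
  have hsα := Real.sin_pos_of_pos_of_lt_pi hα0 hαπ
  have hsγ := Real.sin_pos_of_pos_of_lt_pi hγ0 hγπ
  -- the angle sum is less than `π`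
  have hcos : Real.sin α * Real.sin γ < Real.cos β + Real.cos α * Real.cos γ := by
    have h1 : Real.cos (Real.pi - (α + γ)) < Real.cos β :=
      Real.cos_lt_cos_of_nonneg_of_le_pi hβ0.le (by linarith) (by linarith)
    rw [Real.cos_pi_sub, Real.cos_add] at h1
    linarith
  -- `R` is a rotation through `2 α` about the point `i` of the upper half-plane, and `X` a
  -- rotation through `2 γ`; `m` is chosen so that `X * R` has trace `-2 cos β`, and `d` so
  -- that `det X = 1`
  set m := (Real.cos β + Real.cos α * Real.cos γ) / Real.sin α with hm
  have hmγ : Real.sin γ < m := by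
    rw [hm, lt_div_iff₀ hsα]
    linarith
  have hD : 0 < m ^ 2 - Real.sin γ ^ 2 := by nlinarith
  set d := Real.sqrt (m ^ 2 - Real.sin γ ^ 2) with hd
  have hd0 : 0 < d := Real.sqrt_pos.2 hD
  have hd2 : d ^ 2 = m ^ 2 - Real.sin γ ^ 2 := Real.sq_sqrt hD.le
  have hdm : d < m := by nlinarith
  have hs : 0 < m - d := by linarith
  have ht : 0 < m + d := by linarith
  let X : SpecialLinearGroup (Fin 2) ℝ := ⟨!![Real.cos γ, -(m - d); m + d, Real.cos γ], by
    rw [det_fin_two_of]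
    nlinarith [Real.sin_sq_add_cos_sq γ]⟩
  let R : SpecialLinearGroup (Fin 2) ℝ :=
    ⟨!![Real.cos α, -Real.sin α; Real.sin α, Real.cos α], by
    rw [det_fin_two_of]
    nlinarith [Real.sin_sq_add_cos_sq α]⟩
  have hX : φ X = !![Real.cos γ, -(m - d); m + d, Real.cos γ] := rfl
  have hR : φ R = !![Real.cos α, -Real.sin α; Real.sin α, Real.cos α] := rfl
  obtain ⟨f, hf⟩ := exists_hom_conj_of_central_powers (p := p) (q := q) n hp X R
    (commute_pow_of_trace_eq hn (Or.inl (by simp [hX, hγ]; ring)))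
    (commute_pow_of_trace_eq hp (Or.inl (by simp [hR, hα]; ring)))
    (commute_pow_of_trace_eq hq (Or.inr (by
      rw [map_mul, hX, hR]
      simp [Matrix.mul_apply, Fin.sum_univ_two]
      have : m * Real.sin α = Real.cos β + Real.cos α * Real.cos γ :=
        div_mul_cancel₀ _ hsα.ne'
      rw [hβ] at this
      linarith)))
  -- every element is mapped to a conjugate of `X`
  have hconj : ∀ z, ∃ g : SpecialLinearGroup (Fin 2) ℝ, f z = g * X * g⁻¹ := by
    refine generates_torusGen p q n hp _ (fun k => ⟨_, hf k⟩) fun k z => ?_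
    have e : f (torusGen p q n hp k ◃ z) =
        (R ^ (k : ℕ) * X * (R ^ (k : ℕ))⁻¹) * f z * (R ^ (k : ℕ) * X * (R ^ (k : ℕ))⁻¹)⁻¹ := by
      rw [ShelfHom.map_act, hf]
      rfl
    rw [e]
    constructor
    · rintro ⟨g, hg⟩
      refine ⟨(R ^ (k : ℕ) * X * (R ^ (k : ℕ))⁻¹) * g, ?_⟩
      rw [hg]
      group
    · rintro ⟨g, hg⟩
      refine ⟨(R ^ (k : ℕ) * X * (R ^ (k : ℕ))⁻¹)⁻¹ * g, ?_⟩
      rw [mul_inv_eq_iff_eq_mul, ← eq_inv_mul_iff_mul_eq] at hg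
      rw [hg]
      group
  by_contra hfin
  rw [not_infinite_iff_finite] at hfin
  have := Fintype.ofFinite ((torusLink p q).nQuandle n)
  set S : Matrix (Fin 2) (Fin 2) ℝ := ∑ z, φ (f z) with hS
  have hS10 : 0 < S 1 0 := by
    rw [hS, Matrix.sum_apply]
    refine Finset.sum_pos (fun z _ => ?_) ⟨torusGen p q n hp ⟨0, by omega⟩, Finset.mem_univ _⟩
    obtain ⟨g, hg⟩ := hconj z
    rw [hg]
    exact conj_apply_one_zero_pos g X hs ht hX
  have hSX := commute_sum_of_hom_conj φ f (torusGen p q n hp ⟨0, by omega⟩)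
  have hSR := commute_sum_of_hom_conj φ f (torusGen p q n hp ⟨1, by omega⟩)
  rw [hf, ← hS] at hSX hSR
  simp only [pow_zero, one_mul, inv_one, mul_one, pow_one, map_mul,
    coeMonoidHom_inv, hX, hR] at hSX hSR
  refine false_of_commute_of_commute_conj hs ht (by linarith) hsα.ne' hS10.ne' hSX
    (a := Real.cos α) (b := Real.sin α) ?_
  simpa [Commute, SemiconjBy] using hSR

end Hyperbolic

/-! #### The Euclidean case -/

section Euclidean

open Matrix

/-- The matrix of the affine map `w ↦ u w + v` of the plane. -/
def affineMatrix (u v : ℂ) : Matrix (Fin 2) (Fin 2) ℂ := !![u, v; 0, 1]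

theorem affineMatrix_mul (u v u' v' : ℂ) :
    affineMatrix u v * affineMatrix u' v' = affineMatrix (u * u') (u * v' + v) := by
  simp [affineMatrix]

theorem affineMatrix_pow_eq_one {u : ℂ} (v : ℂ) {m : ℕ} (hu : u ≠ 1) (hm : u ^ m = 1) :
    affineMatrix u v ^ m = 1 := by
  have key : ∀ k : ℕ, affineMatrix u v ^ k =
      affineMatrix (u ^ k) (v * ((u ^ k - 1) / (u - 1))) := by
    intro k
    have := sub_ne_zero.2 hu
    induction k with
    | zero => simp [affineMatrix, one_fin_two]
    | succ k ih =>
      rw [pow_succ, ih, affineMatrix_mul, pow_succ]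
      congr 1
      field_simp
      ring
  rw [key, hm, sub_self, zero_div, mul_zero, affineMatrix, one_fin_two]

/-- The affine map `w ↦ u w + v` as an element of `GL₂(ℂ)`. -/
noncomputable def affineUnit (u v : ℂ) (hu : u ≠ 0) : (Matrix (Fin 2) (Fin 2) ℂ)ˣ where
  val := affineMatrix u v
  inv := affineMatrix u⁻¹ (-(u⁻¹ * v))
  val_inv := by simp [hu, affineMatrix, one_fin_two]
  inv_val := by simp [hu, affineMatrix, one_fin_two]

/-- The quandle maps to the rotations of the plane through a fixed angle. If it were finite, the
barycentre of their centres would be fixed by rotations about different points. -/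
theorem infinite_nQuandle_of_euclidean {p q n : ℕ} (hp : 2 ≤ p) (hq : 2 ≤ q) (hn : 2 ≤ n)
    (h : (1 / p + 1 / q + 1 / n : ℂ) = 1) : Infinite ((torusLink p q).nQuandle n) := by
  have : NeZero q := ⟨by omega⟩
  have hroot : ∀ m : ℕ, 2 ≤ m → ∃ ζ : ℂ, ζ = Complex.exp (2 * Real.pi * Complex.I / m) ∧
      ζ ^ m = 1 ∧ ζ ≠ 1 ∧ ζ ≠ 0 := fun m hm => by
    have hprim := Complex.isPrimitiveRoot_exp m (by omega)
    exact ⟨_, rfl, hprim.pow_eq_one, hprim.ne_one (by omega), Complex.exp_ne_zero _⟩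
  obtain ⟨ζ, hζ, hζn, hζ1, hζ0⟩ := hroot n hn
  obtain ⟨ω, hω, hωp, hω1, hω0⟩ := hroot p hp
  obtain ⟨μ, hμ, hμq, hμ1, hμ0⟩ := hroot q hq
  -- the angle sum is `π`
  have hprod : ζ * ω * μ = 1 := by
    rw [hζ, hω, hμ, ← Complex.exp_add, ← Complex.exp_add]
    calc _ = Complex.exp (2 * Real.pi * Complex.I * (1 / p + 1 / q + 1 / n)) := by
          congr 1; ring
      _ = 1 := by rw [h, mul_one, Complex.exp_two_pi_mul_I]
  have hζω : ζ * ω = μ⁻¹ := eq_inv_of_mul_eq_one_left hprod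
  -- rotations about the points `1` and `0`
  let x := affineUnit ζ (1 - ζ) hζ0
  let ρ := affineUnit ω 0 hω0
  have hone : ∀ {y : (Matrix (Fin 2) (Fin 2) ℂ)ˣ} {m : ℕ}, (y : Matrix (Fin 2) (Fin 2) ℂ) ^ m = 1 →
      ∀ g, Commute (y ^ m) g := fun hy g => by
    rw [← Units.val_pow_eq_pow_val, ← Units.val_one] at hy
    rw [Units.ext hy]
    exact Commute.one_left g
  obtain ⟨f, hf⟩ := exists_hom_conj_of_central_powers (p := p) (q := q) n hp x ρ
    (hone (affineMatrix_pow_eq_one _ hζ1 hζn)) (hone (affineMatrix_pow_eq_one _ hω1 hωp))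
    (hone (by
      rw [Units.val_mul]
      change (affineMatrix ζ (1 - ζ) * affineMatrix ω 0) ^ q = 1
      rw [affineMatrix_mul, hζω]
      exact affineMatrix_pow_eq_one _ (inv_ne_one.2 hμ1) (by rw [inv_pow, hμq, inv_one])))
  have hconj : ∀ (u v w : ℂ) (hu : u ≠ 0), ∃ w', affineUnit u v hu * affineUnit ζ w hζ0 *
      (affineUnit u v hu)⁻¹ = affineUnit ζ w' hζ0 := fun u v w hu => by
    refine ⟨u * w + v - ζ * v, mul_inv_eq_of_eq_mul (Units.ext ?_)⟩
    change affineMatrix _ _ * affineMatrix _ _ = affineMatrix _ _ * affineMatrix _ _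
    rw [affineMatrix_mul, affineMatrix_mul, mul_comm u ζ]
    congr 1
    ring
  have hρ : ∀ k : ℕ, ρ ^ k * x * (ρ ^ k)⁻¹ = affineUnit ζ (ω ^ k * (1 - ζ)) hζ0 := fun k => by
    have hk : ((ρ ^ k : (Matrix (Fin 2) (Fin 2) ℂ)ˣ) : Matrix _ _ ℂ) =
        affineMatrix (ω ^ k) 0 := by
      induction k with
      | zero => simp [affineMatrix, one_fin_two]
      | succ k ih =>
        rw [pow_succ, Units.val_mul, ih]
        change _ * affineMatrix _ _ = _
        rw [affineMatrix_mul, mul_zero, add_zero, pow_succ]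
    refine mul_inv_eq_of_eq_mul (Units.ext ?_)
    rw [Units.val_mul, Units.val_mul, hk]
    change affineMatrix _ _ * affineMatrix _ _ = affineMatrix _ _ * affineMatrix _ _
    rw [affineMatrix_mul, affineMatrix_mul, mul_comm (ω ^ k) ζ]
    congr 1
    ring
  have hform : ∀ z, ∃ w, f z = affineUnit ζ w hζ0 := by
    refine generates_torusGen p q n hp _ (fun k => ⟨_, (hf k).trans (hρ k)⟩) fun k z => ?_
    have e : f (torusGen p q n hp k ◃ z) = affineUnit ζ (ω ^ (k : ℕ) * (1 - ζ)) hζ0 * f z *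
        (affineUnit ζ (ω ^ (k : ℕ) * (1 - ζ)) hζ0)⁻¹ := by
      rw [ShelfHom.map_act, hf, hρ]
      rfl
    rw [e]
    constructor
    · rintro ⟨w, hw⟩
      rw [hw]
      exact hconj _ _ _ _
    · rintro ⟨w, hw⟩
      obtain ⟨w', hw'⟩ := hconj ζ⁻¹ (-(ζ⁻¹ * (ω ^ (k : ℕ) * (1 - ζ)))) w (inv_ne_zero hζ0)
      refine ⟨w', hw' ▸ ?_⟩
      have einv : affineUnit ζ⁻¹ (-(ζ⁻¹ * (ω ^ (k : ℕ) * (1 - ζ)))) (inv_ne_zero hζ0) =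
          (affineUnit ζ (ω ^ (k : ℕ) * (1 - ζ)) hζ0)⁻¹ := Units.ext rfl
      rw [einv, ← hw]
      group
  by_contra hfin
  rw [not_infinite_iff_finite] at hfin
  have := Fintype.ofFinite ((torusLink p q).nQuandle n)
  choose w hw using hform
  -- the barycentre
  have hS : ∑ z, Units.coeHom (Matrix (Fin 2) (Fin 2) ℂ) (f z) =
      !![Fintype.card ((torusLink p q).nQuandle n) * ζ, ∑ z, w z;
        0, Fintype.card ((torusLink p q).nQuandle n)] := by
    have e : ∀ z, Units.coeHom (Matrix (Fin 2) (Fin 2) ℂ) (f z) = !![ζ, w z; 0, 1] :=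
      fun z => by rw [hw]; rfl
    ext i j
    rw [Matrix.sum_apply]
    fin_cases i <;> fin_cases j <;> simp [e]
  have hN : (Fintype.card ((torusLink p q).nQuandle n) : ℂ) ≠ 0 :=
    haveI : Nonempty ((torusLink p q).nQuandle n) := ⟨torusGen p q n hp ⟨0, by omega⟩⟩
    Nat.cast_ne_zero.2 Fintype.card_ne_zero
  -- it is fixed by the rotations about both `1` and `ω`
  have key : ∀ k : Fin p, ∑ z, w z =
      Fintype.card ((torusLink p q).nQuandle n) * (ω ^ (k : ℕ) * (1 - ζ)) := fun k => by
    have hc := (commute_sum_of_hom_conj (Units.coeHom _) f (torusGen p q n hp k)).eq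
    rw [hS, hf, hρ] at hc
    have h01 := congrFun (congrFun hc 0) 1
    simp [affineUnit, affineMatrix, Matrix.mul_apply, Fin.sum_univ_two] at h01
    refine mul_left_cancel₀ (sub_ne_zero.2 hζ1.symm) ?_
    linear_combination h01
  have h1 := (key ⟨0, by omega⟩).symm.trans (key ⟨1, by omega⟩)
  simp only [pow_zero, one_mul, pow_one] at h1
  have h2 := mul_right_cancel₀ (sub_ne_zero.2 hζ1.symm)
    ((one_mul _).trans (mul_left_cancel₀ hN h1))
  exact hω1 h2.symm

end Euclidean

theorem infinite_nQuandle_of_le_one {p q n : ℕ} (hp : 2 ≤ p) (hq : 2 ≤ q) (hn : 2 ≤ n)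
    (h : (1 / p + 1 / q + 1 / n : ℚ) ≤ 1) : Infinite ((torusLink p q).nQuandle n) := by
  rcases h.lt_or_eq with h | h
  · exact infinite_nQuandle_of_hyperbolic hp hq hn (by
      have := (Rat.cast_lt (K := ℝ)).2 h
      push_cast at this
      exact this)
  · exact infinite_nQuandle_of_euclidean hp hq hn (by
      have := congrArg (Rat.cast (K := ℂ)) h
      push_cast at this
      exact this)

/-- The triples for which the triangle with angles `π / p`, `π / q`, `π / n` is spherical. -/
theorem one_lt_sum_inv_iff {p q n : ℕ} (hp : 2 ≤ p) (hpq : p ≤ q) (hn : 2 ≤ n) :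
    1 < (1 / p + 1 / q + 1 / n : ℚ) ↔
      (p = 2 ∧ q = 2) ∨ (p = 2 ∧ n = 2) ∨
        (p, q, n) ∈ ({(2, 3, 3), (2, 3, 4), (2, 3, 5), (2, 4, 3), (2, 5, 3),
          (3, 3, 2), (3, 4, 2), (3, 5, 2)} : Set (ℕ × ℕ × ℕ)) := by
  have e : 1 < (1 / p + 1 / q + 1 / n : ℚ) ↔ p * q * n < q * n + p * n + p * q := by
    have h1 : (0 : ℚ) < p * q * n := by
      have : 0 < p * q * n := Nat.mul_pos (Nat.mul_pos (by omega) (by omega)) (by omega)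
      exact_mod_cast this
    rw [← mul_lt_mul_iff_right₀ h1]
    have hp0 : (p : ℚ) ≠ 0 := by positivity
    have hq0 : (q : ℚ) ≠ 0 := by
      have : q ≠ 0 := by omega
      exact_mod_cast this
    have hn0 : (n : ℚ) ≠ 0 := by positivity
    have e2 : (p * q * n : ℚ) * (1 / p + 1 / q + 1 / n) = q * n + p * n + p * q := by
      field_simp
    rw [e2, mul_one]
    exact_mod_cast Iff.rfl
  rw [e]
  simp only [Set.mem_insert_iff, Set.mem_singleton_iff, Prod.mk.injEq]
  constructor
  · intro h
    have hp3 : p ≤ 3 := by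
      by_contra! h4
      have h1 : 4 * (q * n) ≤ p * (q * n) := Nat.mul_le_mul_right _ h4
      have h2 : 4 * (p * n) ≤ q * (p * n) := Nat.mul_le_mul_right _ (h4.trans_le hpq)
      have h3 : 2 * (p * q) ≤ n * (p * q) := Nat.mul_le_mul_right _ hn
      nlinarith
    rcases eq_or_ne q 2 with rfl | hq
    · omega
    rcases eq_or_ne n 2 with rfl | hn2
    · interval_cases p <;> omega
    have hq3 : 3 ≤ q := by omega
    have hn3 : 3 ≤ n := by omega
    have h33 : 3 * n ≤ q * n ∧ 3 * q ≤ q * n :=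
      ⟨Nat.mul_le_mul_right _ hq3, by nlinarith⟩
    interval_cases p
    · have hq6 : q < 6 := by
        by_contra! h6
        nlinarith
      have hn6 : n < 6 := by
        by_contra! h6
        nlinarith
      interval_cases q <;> interval_cases n <;> omega
    · nlinarith
  · rintro (⟨rfl, rfl⟩ | ⟨rfl, rfl⟩ | h)
    · omega
    · omega
    · rcases h with h | h | h | h | h | h | h | h <;> obtain ⟨rfl, rfl, rfl⟩ := h <;> norm_num

/-! ### Isomorphisms and orientations -/

namespace QuandleIso

theorem refl (Q : Type) [Quandle Q] : QuandleIso Q Q :=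
  ⟨Equiv.refl Q, fun _ _ => rfl⟩

end QuandleIso

namespace LinkDiagram

/-- Involutory point symmetries at the generators of a `2`-quandle. -/
theorem act'_act'_gen_two {D : LinkDiagram} (y : D.Arc) (x : D.nQuandle 2) :
    D.gen 2 y ◃ D.gen 2 y ◃ x = x := by
  have h := D.act'_gen_pow 2 y
  rw [pow_two] at h
  exact Equiv.congr_fun h x

theorem reverse_eq_self (D : LinkDiagram) {S : Set D.Arc} (hS : ∀ a, a ∉ S) :
    D.reverse S = D := by
  cases D
  simp only [reverse, hS, if_false]

/-! #### The quandle of a reversed diagram -/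

/-- The generator of the `n`-quandle of the diagram with the arcs in `S` reversed that belongs
to an arc of the original diagram. -/
noncomputable def revGen (D : LinkDiagram) (S : Set D.Arc) (n : ℕ) (a : D.Arc) :
    (D.reverse S).nQuandle n :=
  (D.reverse S).gen n a

theorem generates_revGen (D : LinkDiagram) (S : Set D.Arc) (n : ℕ) :
    QuandleGenerates (D.revGen S n) :=
  (D.reverse S).generates_gen n

theorem act'_revGen_pow (D : LinkDiagram) (S : Set D.Arc) (n : ℕ) (a : D.Arc) :
    Rack.act' (D.revGen S n a) ^ n = 1 :=
  (D.reverse S).act'_gen_pow n a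

theorem revGen_leftArc (D : LinkDiagram) {S : Set D.Arc} (n : ℕ) {k : D.Crossing}
    (hk : D.overArc k ∉ S) : D.revGen S n (D.leftArc k) =
      D.revGen S n (D.overArc k) ◃ D.revGen S n (D.rightArc k) := by
  have h := (D.reverse S).gen_leftArc n k
  simp only [reverse, if_neg hk] at h
  exact h

theorem revGen_rightArc (D : LinkDiagram) {S : Set D.Arc} (n : ℕ) {k : D.Crossing}
    (hk : D.overArc k ∈ S) : D.revGen S n (D.rightArc k) =
      D.revGen S n (D.overArc k) ◃ D.revGen S n (D.leftArc k) := by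
  have h := (D.reverse S).gen_leftArc n k
  simp only [reverse, if_pos hk] at h
  exact h

theorem exists_hom_reverse (D : LinkDiagram) (S : Set D.Arc) (n : ℕ) {X : Type} [Quandle X]
    (c : D.Arc → X)
    (hc : ∀ k, D.overArc k ∉ S → c (D.leftArc k) = c (D.overArc k) ◃ c (D.rightArc k))
    (hc' : ∀ k, D.overArc k ∈ S → c (D.rightArc k) = c (D.overArc k) ◃ c (D.leftArc k))
    (hn : ∀ y, Rack.act' (c y) ^ n = 1) :
    ∃ f : (D.reverse S).nQuandle n →◃ X, ∀ a, f (D.revGen S n a) = c a := by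
  refine ⟨(D.reverse S).lift n c (fun k => ?_) (fun x y => Equiv.congr_fun (hn y) (c x)),
    fun _ => rfl⟩
  by_cases hk : D.overArc k ∈ S
  · simp only [reverse, if_pos hk]
    exact hc' k hk
  · simp only [reverse, if_neg hk]
    exact hc k hk

/-- A bijection between the arcs of two diagrams under which the crossing relations of each
diagram hold in the `n`-quandle of the other one. -/
theorem quandleIso_reverse_of_equiv {D D' : LinkDiagram} {S : Set D.Arc} {T : Set D'.Arc} {n : ℕ}
    (e : D.Arc ≃ D'.Arc)
    (h₁ : ∀ k, D.overArc k ∉ S → D'.revGen T n (e (D.leftArc k)) =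
      D'.revGen T n (e (D.overArc k)) ◃ D'.revGen T n (e (D.rightArc k)))
    (h₂ : ∀ k, D.overArc k ∈ S → D'.revGen T n (e (D.rightArc k)) =
      D'.revGen T n (e (D.overArc k)) ◃ D'.revGen T n (e (D.leftArc k)))
    (h₃ : ∀ k, D'.overArc k ∉ T → D.revGen S n (e.symm (D'.leftArc k)) =
      D.revGen S n (e.symm (D'.overArc k)) ◃ D.revGen S n (e.symm (D'.rightArc k)))
    (h₄ : ∀ k, D'.overArc k ∈ T → D.revGen S n (e.symm (D'.rightArc k)) =
      D.revGen S n (e.symm (D'.overArc k)) ◃ D.revGen S n (e.symm (D'.leftArc k))) :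
    QuandleIso ((D.reverse S).nQuandle n) ((D'.reverse T).nQuandle n) := by
  obtain ⟨f, hf⟩ := D.exists_hom_reverse S n (fun a => D'.revGen T n (e a)) h₁ h₂
    fun y => D'.act'_revGen_pow T n _
  obtain ⟨g, hg⟩ := D'.exists_hom_reverse T n (fun a => D.revGen S n (e.symm a)) h₃ h₄
    fun y => D.act'_revGen_pow S n _
  refine ⟨⟨f, g, fun x => ?_, fun x => ?_⟩, fun x y => f.map_act⟩
  · refine (D.generates_revGen S n).hom_ext (f := g.comp f) (g := ShelfHom.id _) (fun a => ?_) x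
    rw [ShelfHom.comp_apply, hf, hg, Equiv.symm_apply_apply]
    rfl
  · refine (D'.generates_revGen T n).hom_ext (f := f.comp g) (g := ShelfHom.id _) (fun a => ?_) x
    rw [ShelfHom.comp_apply, hg, hf, Equiv.apply_symm_apply]
    rfl

/-- Involutory quandles do not see orientations. -/
theorem quandleIso_reverse_two (D : LinkDiagram) (S : Set D.Arc) :
    QuandleIso ((D.reverse S).nQuandle 2) (D.nQuandle 2) := by
  have hinv : ∀ (T : Set D.Arc) (k : D.Crossing), D.revGen T 2 (D.leftArc k) =
      D.revGen T 2 (D.overArc k) ◃ D.revGen T 2 (D.rightArc k) := fun T k => by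
    by_cases hk : D.overArc k ∈ T
    · rw [D.revGen_rightArc 2 hk]
      exact (act'_act'_gen_two (D := D.reverse T) _ _).symm
    · exact D.revGen_leftArc 2 hk
  have hinv' : ∀ (T : Set D.Arc) (k : D.Crossing), D.revGen T 2 (D.rightArc k) =
      D.revGen T 2 (D.overArc k) ◃ D.revGen T 2 (D.leftArc k) := fun T k => by
    rw [hinv T k]
    exact (act'_act'_gen_two (D := D.reverse T) _ _).symm
  have h := quandleIso_reverse_of_equiv (D := D) (D' := D) (S := S) (T := ∅) (n := 2)
    (Equiv.refl _) (fun k _ => hinv ∅ k) (fun k _ => hinv' ∅ k) (fun k _ => hinv S k)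
    (fun k _ => hinv' S k)
  rwa [reverse_eq_self D fun a => Set.notMem_empty a] at h

end LinkDiagram

/-! #### Two-strand torus links -/

/-- The arc of the standard diagram of `T_{2,q}` that passes over at the crossing number `i`. -/
def twoStrandArc (q : ℕ) (i : ZMod q) : (torusLink 2 q).Arc :=
  ((i, 0) : ZMod q × Fin 1)

theorem torusLink_two_arc_cases {q : ℕ} {P : (torusLink 2 q).Arc → Prop}
    (h : ∀ i, P (twoStrandArc q i)) (a : (torusLink 2 q).Arc) : P a := by
  obtain ⟨i, k⟩ := a
  have hk : k = (0 : Fin 1) := Subsingleton.elim (α := Fin 1) _ _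
  subst hk
  exact h i

theorem torusLink_two_overArc {q : ℕ} (k : (torusLink 2 q).Crossing) :
    (torusLink 2 q).overArc k = twoStrandArc q k.1 :=
  rfl

theorem torusLink_two_rightArc {q : ℕ} (k : (torusLink 2 q).Crossing) :
    (torusLink 2 q).rightArc k = twoStrandArc q (k.1 - 1) := by
  obtain ⟨i, k⟩ := k
  have hk : k = (0 : Fin 1) := Subsingleton.elim (α := Fin 1) _ _
  subst hk
  exact torusStrand_of_eq (k := 1) one_lt_two i rfl

theorem torusLink_two_leftArc {q : ℕ} (k : (torusLink 2 q).Crossing) :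
    (torusLink 2 q).leftArc k = twoStrandArc q (k.1 + 1) :=
  Prod.ext rfl (Subsingleton.elim (α := Fin 1) _ _)

/-- The crossing number `i` of `T_{2,q}`. -/
def twoStrandCrossing (q : ℕ) (i : ZMod q) : (torusLink 2 q).Crossing :=
  ((i, 0) : ZMod q × Fin 1)

theorem twoStrand_revGen_succ {q : ℕ} (n : ℕ) {S : Set (torusLink 2 q).Arc} {i : ZMod q}
    (hi : twoStrandArc q i ∉ S) : (torusLink 2 q).revGen S n (twoStrandArc q (i + 1)) =
      (torusLink 2 q).revGen S n (twoStrandArc q i) ◃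
        (torusLink 2 q).revGen S n (twoStrandArc q (i - 1)) := by
  have h := (torusLink 2 q).revGen_leftArc n (k := twoStrandCrossing q i) hi
  rwa [torusLink_two_leftArc, torusLink_two_rightArc] at h

theorem twoStrand_revGen_pred {q : ℕ} (n : ℕ) {S : Set (torusLink 2 q).Arc} {i : ZMod q}
    (hi : twoStrandArc q i ∈ S) : (torusLink 2 q).revGen S n (twoStrandArc q (i - 1)) =
      (torusLink 2 q).revGen S n (twoStrandArc q i) ◃
        (torusLink 2 q).revGen S n (twoStrandArc q (i + 1)) := by
  have h := (torusLink 2 q).revGen_rightArc n (k := twoStrandCrossing q i) hi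
  rwa [torusLink_two_leftArc, torusLink_two_rightArc] at h

theorem twoStrand_gen_succ {q : ℕ} (n : ℕ) (i : ZMod q) :
    (torusLink 2 q).gen n (twoStrandArc q (i + 1)) =
      (torusLink 2 q).gen n (twoStrandArc q i) ◃
        (torusLink 2 q).gen n (twoStrandArc q (i - 1)) := by
  have h := (torusLink 2 q).gen_leftArc n (twoStrandCrossing q i)
  rwa [torusLink_two_leftArc, torusLink_two_rightArc] at h

/-- Rotating the closed braid. -/
theorem twoStrand_quandleIso_of_shift {q : ℕ} (n : ℕ) {S T : Set (torusLink 2 q).Arc} (s : ZMod q)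
    (hS : ∀ i, twoStrandArc q i ∈ S ↔ twoStrandArc q (i + s) ∈ T) :
    QuandleIso (((torusLink 2 q).reverse S).nQuandle n)
      (((torusLink 2 q).reverse T).nQuandle n) := by
  let e : (torusLink 2 q).Arc ≃ (torusLink 2 q).Arc :=
    Equiv.prodCongr (Equiv.addRight s) (Equiv.refl (Fin 1))
  have he : ∀ i, e (twoStrandArc q i) = twoStrandArc q (i + s) := fun _ => rfl
  have he' : ∀ i, e.symm (twoStrandArc q i) = twoStrandArc q (i - s) := fun i => by
    rw [Equiv.symm_apply_eq, he, sub_add_cancel]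
  have hT : ∀ i, twoStrandArc q i ∈ T ↔ twoStrandArc q (i - s) ∈ S := fun i => by
    rw [hS, sub_add_cancel]
  refine LinkDiagram.quandleIso_reverse_of_equiv e ?_ ?_ ?_ ?_ <;> intro k hk <;>
    rw [torusLink_two_overArc] at hk <;>
    simp only [torusLink_two_overArc, torusLink_two_leftArc, torusLink_two_rightArc, he, he']
  · rw [hS] at hk
    rw [add_right_comm, sub_add_eq_add_sub]
    exact twoStrand_revGen_succ n hk
  · rw [hS] at hk
    rw [add_right_comm, sub_add_eq_add_sub]
    exact twoStrand_revGen_pred n hk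
  · rw [hT] at hk
    rw [add_sub_right_comm, sub_right_comm]
    exact twoStrand_revGen_succ n hk
  · rw [hT] at hk
    rw [add_sub_right_comm, sub_right_comm]
    exact twoStrand_revGen_pred n hk

/-- Reversing all arcs amounts to reading the closed braid backwards. -/
theorem twoStrand_quandleIso_reverse_all {q : ℕ} (n : ℕ) {S : Set (torusLink 2 q).Arc}
    (hS : ∀ i, twoStrandArc q i ∈ S) :
    QuandleIso (((torusLink 2 q).reverse S).nQuandle n) ((torusLink 2 q).nQuandle n) := by
  let e : (torusLink 2 q).Arc ≃ (torusLink 2 q).Arc :=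
    Equiv.prodCongr (Equiv.neg _) (Equiv.refl (Fin 1))
  have he : ∀ i, e (twoStrandArc q i) = twoStrandArc q (-i) := fun _ => rfl
  have he' : ∀ i, e.symm (twoStrandArc q i) = twoStrandArc q (-i) := fun i => by
    rw [Equiv.symm_apply_eq, he, neg_neg]
  have h : QuandleIso (((torusLink 2 q).reverse S).nQuandle n)
      (((torusLink 2 q).reverse ∅).nQuandle n) := by
    refine LinkDiagram.quandleIso_reverse_of_equiv e ?_ ?_ ?_ ?_ <;> intro k hk <;>
      rw [torusLink_two_overArc] at hk <;>
      simp only [torusLink_two_overArc, torusLink_two_leftArc, torusLink_two_rightArc, he, he',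
        neg_add, neg_sub, ← sub_eq_add_neg, sub_eq_neg_add (1 : ZMod q)]
    · exact absurd (hS _) hk
    · exact twoStrand_revGen_succ n (Set.notMem_empty _)
    · exact twoStrand_revGen_pred n (hS _)
    · exact absurd hk (Set.notMem_empty _)
  rwa [LinkDiagram.reverse_eq_self _ fun a => Set.notMem_empty a] at h

theorem twoStrand_quandleIso_reverse_none {q : ℕ} (n : ℕ) {S : Set (torusLink 2 q).Arc}
    (hS : ∀ i, twoStrandArc q i ∉ S) :
    QuandleIso (((torusLink 2 q).reverse S).nQuandle n) ((torusLink 2 q).nQuandle n) := by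
  rw [LinkDiagram.reverse_eq_self _ (torusLink_two_arc_cases hS)]
  exact QuandleIso.refl _

theorem twoStrandArc_add_two_mem_iff {q : ℕ} {S : Set (torusLink 2 q).Arc}
    (hS : (torusLink 2 q).IsUnionOfComponents S) (i : ZMod q) :
    twoStrandArc q (i + 2) ∈ S ↔ twoStrandArc q i ∈ S := by
  have h := hS (twoStrandCrossing q (i + 1))
  rw [torusLink_two_leftArc, torusLink_two_rightArc] at h
  change twoStrandArc q (i + 1 + 1) ∈ S ↔ twoStrandArc q (i + 1 - 1) ∈ S at h
  rwa [add_sub_cancel_right, add_assoc, one_add_one_eq_two] at h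

theorem mem_component_b_iff (i : ZMod 4) :
    twoStrandArc 4 i ∈ (torusLink 2 4).component (torusStrand 2 4 Nat.one_lt_two 0 1) ↔
      i = 1 ∨ i = 3 := by
  have hb : torusStrand 2 4 Nat.one_lt_two 0 1 = twoStrandArc 4 3 := rfl
  rw [hb]
  constructor
  · intro h
    have : ∀ a b : (torusLink 2 4).Arc, Relation.EqvGen (fun x y => ∃ c,
        x = (torusLink 2 4).leftArc c ∧ y = (torusLink 2 4).rightArc c) a b →
        ((a.1 = 1 ∨ a.1 = 3) ↔ (b.1 = 1 ∨ b.1 = 3)) := by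
      intro a b hab
      induction hab with
      | rel x y h =>
        obtain ⟨k, rfl, rfl⟩ := h
        rw [torusLink_two_leftArc, torusLink_two_rightArc]
        change (k.1 + 1 = 1 ∨ k.1 + 1 = 3) ↔ (k.1 - 1 = 1 ∨ k.1 - 1 = 3)
        generalize k.1 = j
        change ZMod 4 at j
        revert j
        decide
      | refl => rfl
      | symm _ _ _ ih => exact ih.symm
      | trans _ _ _ _ _ ih₁ ih₂ => exact ih₁.trans ih₂
    exact (this _ _ h).1 (Or.inr rfl)
  · rintro (rfl | rfl)
    · exact Relation.EqvGen.rel _ _ ⟨twoStrandCrossing 4 2, rfl, rfl⟩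
    · exact Relation.EqvGen.refl _

/-- For `T_{2,4}` every orientation is equivalent to the parallel one or to the one with
the component of `b` reversed. -/
theorem torusLink24_quandleIso_reverse (n : ℕ) {S : Set (torusLink 2 4).Arc}
    (hS : (torusLink 2 4).IsUnionOfComponents S) :
    QuandleIso (((torusLink 2 4).reverse S).nQuandle n) ((torusLink 2 4).nQuandle n) ∨
      QuandleIso (((torusLink 2 4).reverse S).nQuandle n) (torusLink24pm.nQuandle n) := by
  have h2 : twoStrandArc 4 2 ∈ S ↔ twoStrandArc 4 0 ∈ S := twoStrandArc_add_two_mem_iff hS 0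
  have h3 : twoStrandArc 4 3 ∈ S ↔ twoStrandArc 4 1 ∈ S := twoStrandArc_add_two_mem_iff hS 1
  have hall : ∀ P : ZMod 4 → Prop, P 0 → P 1 → P 2 → P 3 → ∀ i, P i := by
    intro P h0 h1 h2 h3 i
    fin_cases i <;> assumption
  by_cases h0 : twoStrandArc 4 0 ∈ S <;> by_cases h1 : twoStrandArc 4 1 ∈ S <;>
    simp only [h0, h1, iff_true, iff_false] at h2 h3
  · exact Or.inl (twoStrand_quandleIso_reverse_all n (hall _ h0 h1 h2 h3))
  · refine Or.inr (twoStrand_quandleIso_of_shift n 1 fun i => ?_)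
    rw [mem_component_b_iff]
    revert i
    refine hall _ ?_ ?_ ?_ ?_ <;> simp only [h0, h1, h2, h3] <;> decide
  · refine Or.inr (twoStrand_quandleIso_of_shift n 0 fun i => ?_)
    rw [mem_component_b_iff]
    revert i
    refine hall _ ?_ ?_ ?_ ?_ <;> simp only [h0, h1, h2, h3] <;> decide
  · exact Or.inl (twoStrand_quandleIso_reverse_none n (hall _ h0 h1 h2 h3))

/-- If `q` is odd, `T_{2,q}` is a knot, and its orientation does not matter. -/
theorem twoStrand_quandleIso_reverse_of_odd {q : ℕ} (hq : Odd q) (n : ℕ)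
    {S : Set (torusLink 2 q).Arc} (hS : (torusLink 2 q).IsUnionOfComponents S) :
    QuandleIso (((torusLink 2 q).reverse S).nQuandle n) ((torusLink 2 q).nQuandle n) := by
  have hq0 : NeZero q := ⟨hq.pos.ne'⟩
  have hstep : ∀ k : ℕ, twoStrandArc q ((2 * k : ℕ) : ZMod q) ∈ S ↔ twoStrandArc q 0 ∈ S := by
    intro k
    induction k with
    | zero => simp
    | succ k ih =>
      rw [← ih, ← twoStrandArc_add_two_mem_iff hS ((2 * k : ℕ) : ZMod q)]
      push_cast
      rw [mul_add, mul_one]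
  have hall : ∀ i : ZMod q, twoStrandArc q i ∈ S ↔ twoStrandArc q 0 ∈ S := by
    intro i
    obtain ⟨m, hm⟩ := hq
    -- `2 (m + 1) = 1` modulo `q = 2 m + 1`
    rw [← hstep ((m + 1) * i.val)]
    have e : ((2 * ((m + 1) * i.val) : ℕ) : ZMod q) = i := by
      have : 2 * ((m + 1) * i.val) = i.val + (2 * m + 1) * i.val := by ring
      rw [this, ← hm]
      simp
    rw [e]
  by_cases h0 : twoStrandArc q 0 ∈ S
  · exact twoStrand_quandleIso_reverse_all n fun i => (hall i).2 h0
  · exact twoStrand_quandleIso_reverse_none n fun i => (hall i).not.2 h0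

/-- At each crossing of the Hopf link `T_{2,2}` the two under-arcs are the same. -/
theorem torusLink22_quandleIso_reverse (n : ℕ) (S : Set (torusLink 2 2).Arc) :
    QuandleIso (((torusLink 2 2).reverse S).nQuandle n) ((torusLink 2 2).nQuandle n) := by
  have h : ∀ k, (torusLink 2 2).leftArc k = (torusLink 2 2).rightArc k := fun k => by
    rw [torusLink_two_leftArc, torusLink_two_rightArc]
    congr 1
    generalize k.1 = i
    change ZMod 2 at i
    revert i
    decide
  have h' : (torusLink 2 2).reverse S = torusLink 2 2 := by
    simp only [LinkDiagram.reverse, ← h, ite_self]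
    exact congrArg (LinkDiagram.mk _ _ _ _) (funext h)
  rw [h']
  exact QuandleIso.refl _

theorem quandleIso_reverse_of_finite {p q n : ℕ} (hp : 2 ≤ p) (hpq : p ≤ q) (hn : 2 ≤ n)
    (hfin : Finite ((torusLink p q).nQuandle n)) {S : Set (torusLink p q).Arc}
    (hS : (torusLink p q).IsUnionOfComponents S) :
    QuandleIso (((torusLink p q).reverse S).nQuandle n) ((torusLink p q).nQuandle n) ∨
      ((p, q, n) = (2, 4, 3) ∧
        QuandleIso (((torusLink p q).reverse S).nQuandle n) (torusLink24pm.nQuandle 3)) := by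
  have h : 1 < (1 / p + 1 / q + 1 / n : ℚ) := by
    by_contra! hle
    exact not_finite_iff_infinite.2
      (infinite_nQuandle_of_le_one hp (hp.trans hpq) hn hle) hfin
  rw [one_lt_sum_inv_iff hp hpq hn] at h
  simp only [Set.mem_insert_iff, Set.mem_singleton_iff, Prod.mk.injEq] at h
  rcases h with ⟨rfl, rfl⟩ | ⟨rfl, rfl⟩ | h
  · exact Or.inl (torusLink22_quandleIso_reverse n S)
  · exact Or.inl (LinkDiagram.quandleIso_reverse_two _ S)
  · rcases h with h | h | h | h | h | h | h | h <;> obtain ⟨rfl, rfl, rfl⟩ := h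
    · exact Or.inl (twoStrand_quandleIso_reverse_of_odd (by decide) _ hS)
    · exact Or.inl (twoStrand_quandleIso_reverse_of_odd (by decide) _ hS)
    · exact Or.inl (twoStrand_quandleIso_reverse_of_odd (by decide) _ hS)
    · exact (torusLink24_quandleIso_reverse 3 hS).imp_right fun h => ⟨rfl, h⟩
    · exact Or.inl (twoStrand_quandleIso_reverse_of_odd (by decide) _ hS)
    all_goals exact Or.inl (LinkDiagram.quandleIso_reverse_two _ S)

/-! ### Computing automorphism groups -/

/-- Isomorphic quandles have isomorphic automorphism groups, with corresponding point
symmetries. -/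
theorem exists_quandleAut_mulEquiv {Q Q' : Type} [Quandle Q] [Quandle Q'] (e : Q ≃ Q')
    (he : ∀ x y, e (x ◃ y) = e x ◃ e y) :
    ∃ ψ : quandleAut Q ≃* quandleAut Q', ∀ x, ψ (pointSymmetry x) = pointSymmetry (e x) := by
  have he' : ∀ x y, e.symm (x ◃ y) = e.symm x ◃ e.symm y := fun x y =>
    e.injective (by simp [he])
  let ψ : quandleAut Q ≃* quandleAut Q' :=
    { toFun := fun f => ⟨e.permCongr f.1, fun x y => by
        simp only [Equiv.permCongr_apply]
        rw [he', f.2, he]⟩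
      invFun := fun f => ⟨e.symm.permCongr f.1, fun x y => by
        simp only [Equiv.permCongr_apply, Equiv.symm_symm]
        rw [he, f.2, he']⟩
      left_inv := fun f => by ext; simp
      right_inv := fun f => by ext; simp
      map_mul' := fun f g => by ext; simp }
  refine ⟨ψ, fun x => Subtype.ext (Equiv.ext fun y => ?_)⟩
  change e (x ◃ e.symm y) = e x ◃ y
  rw [he, Equiv.apply_symm_apply]

theorem HasQuandleData.of_iso {Q Q' : Type} [Quandle Q] [Quandle Q'] (h : QuandleIso Q Q')
    {N : ℕ} {A I T : Type} [Group A] [Group I] [Group T] (hQ' : HasQuandleData Q' N A I T) :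
    HasQuandleData Q N A I T := by
  obtain ⟨e, he⟩ := h
  obtain ⟨ψ, hψ⟩ := exists_quandleAut_mulEquiv e he
  obtain ⟨hN, ⟨a⟩, ⟨i⟩, ⟨t⟩⟩ := hQ'
  have hI : (quandleInn Q).map ψ.toMonoidHom = quandleInn Q' := by
    rw [quandleInn, quandleInn, MonoidHom.map_closure]
    congr 1
    ext f
    constructor
    · rintro ⟨_, ⟨x, rfl⟩, rfl⟩
      exact ⟨e x, hψ x⟩
    · rintro ⟨x, rfl⟩
      refine ⟨_, ⟨e.symm x, rfl⟩, ?_⟩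
      exact (hψ _).trans (by rw [Equiv.apply_symm_apply])
  have hT : (quandleTrans Q).map ψ.toMonoidHom = quandleTrans Q' := by
    rw [quandleTrans, quandleTrans, MonoidHom.map_closure]
    congr 1
    ext f
    constructor
    · rintro ⟨_, ⟨x, y, rfl⟩, rfl⟩
      refine ⟨e x, e y, ?_⟩
      rw [← hψ, ← hψ, ← map_inv, ← map_mul]
      rfl
    · rintro ⟨x, y, rfl⟩
      refine ⟨_, ⟨e.symm x, e.symm y, rfl⟩, ?_⟩
      change ψ _ = _
      rw [map_mul, map_inv, hψ, hψ, Equiv.apply_symm_apply, Equiv.apply_symm_apply]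
  exact ⟨(Nat.card_congr e).trans hN, ⟨ψ.trans a⟩,
    ⟨((ψ.subgroupMap _).trans (MulEquiv.subgroupCongr hI)).trans i⟩,
    ⟨((ψ.subgroupMap _).trans (MulEquiv.subgroupCongr hT)).trans t⟩⟩

/-- If `φ` identifies `A` with the automorphism group of `Q` and `γ x` is the element of `A` that
gives the point symmetry at `x`, then the inner automorphism group and the transvection
group can be computed in `A`. -/
theorem hasQuandleData_of_bijective {Q : Type} [Quandle Q] {N : ℕ} {A I T : Type} [Group A]
    [Group I] [Group T] (hN : Nat.card Q = N) (φ : A →* quandleAut Q)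
    (hφ : Function.Bijective φ) (γ : Q → A) (hγ : ∀ x, φ (γ x) = pointSymmetry x)
    (θI : I →* A) (hθI : Function.Injective θI)
    (hI : Subgroup.closure (Set.range γ) = θI.range)
    (θT : T →* A) (hθT : Function.Injective θT)
    (hT : Subgroup.closure {g | ∃ x y, g = γ x * (γ y)⁻¹} = θT.range) :
    HasQuandleData Q N A I T := by
  have hInn : quandleInn Q = (φ.comp θI).range := by
    rw [MonoidHom.range_comp, ← hI, MonoidHom.map_closure, quandleInn]
    congr 1
    ext f
    simp [← hγ, eq_comm]
  have hTrans : quandleTrans Q = (φ.comp θT).range := by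
    rw [MonoidHom.range_comp, ← hT, MonoidHom.map_closure, quandleTrans]
    congr 1
    ext f
    simp only [← hγ, Set.mem_image, Set.mem_ofPred_eq]
    constructor
    · rintro ⟨x, y, rfl⟩
      exact ⟨_, ⟨x, y, rfl⟩, by simp⟩
    · rintro ⟨_, ⟨x, y, rfl⟩, rfl⟩
      exact ⟨x, y, by simp⟩
  exact ⟨hN, ⟨(MulEquiv.ofBijective φ hφ).symm⟩,
    ⟨(MulEquiv.subgroupCongr hInn).trans
      (MonoidHom.ofInjective (f := φ.comp θI) (hφ.1.comp hθI)).symm⟩,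
    ⟨(MulEquiv.subgroupCongr hTrans).trans
      (MonoidHom.ofInjective (f := φ.comp θT) (hφ.1.comp hθT)).symm⟩⟩

/-! ### Dihedral quandles -/

/-- If the generators of the quandle of `T_{2,q}` multiply like the elements of the dihedral
quandle, they are all of its elements. -/
theorem twoStrand_equiv_dihedral {q n : ℕ}
    (hx : ∀ i j, (torusLink 2 q).gen n (twoStrandArc q i) ◃
      (torusLink 2 q).gen n (twoStrandArc q j) =
        (torusLink 2 q).gen n (twoStrandArc q (2 * i - j)))
    (hn : ∀ a : Quandle.Dihedral q, Rack.act' a ^ n = 1) :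
    ∃ e : (torusLink 2 q).nQuandle n ≃ ZMod q,
      (∀ x y, e (x ◃ y) = 2 * e x - e y) ∧
      ∀ i, e ((torusLink 2 q).gen n (twoStrandArc q i)) = -i := by
  let c : (torusLink 2 q).Arc → Quandle.Dihedral q := fun a => (-a.1 : ZMod q)
  have hc : ∀ i, c (twoStrandArc q i) = (-i : ZMod q) := fun _ => rfl
  let f := (torusLink 2 q).lift n c (fun k => by
    rw [torusLink_two_overArc, torusLink_two_leftArc, torusLink_two_rightArc]
    obtain ⟨i, k⟩ := k
    change (-(i + 1) : ZMod q) = 2 * -i - -(i - 1)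
    ring) fun x y => by rw [hn]; rfl
  have hf : ∀ i, f ((torusLink 2 q).gen n (twoStrandArc q i)) = (-i : ZMod q) := fun _ => rfl
  have hall : ∀ y, ∃ i, y = (torusLink 2 q).gen n (twoStrandArc q i) := by
    refine (torusLink 2 q).generates_gen n _
      (torusLink_two_arc_cases fun i => ⟨i, rfl⟩) (torusLink_two_arc_cases fun i y => ⟨?_, ?_⟩)
    · rintro ⟨j, rfl⟩
      exact ⟨_, hx i j⟩
    · rintro ⟨j, hj⟩
      refine ⟨2 * i - j, (Rack.left_cancel ((torusLink 2 q).gen n (twoStrandArc q i))).1 ?_⟩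
      rw [hx, hj, sub_sub_cancel]
  refine ⟨⟨f, fun w => (torusLink 2 q).gen n (twoStrandArc q (-w)), fun y => ?_, fun w => ?_⟩,
    fun x y => f.map_act, hf⟩
  · obtain ⟨i, rfl⟩ := hall y
    exact congrArg (fun j => (torusLink 2 q).gen n (twoStrandArc q j)) (neg_neg i)
  · exact (hf _).trans (neg_neg w)

theorem twoStrand_gen_act_two {q : ℕ} [NeZero q] (i j : ZMod q) :
    (torusLink 2 q).gen 2 (twoStrandArc q i) ◃ (torusLink 2 q).gen 2 (twoStrandArc q j) =
      (torusLink 2 q).gen 2 (twoStrandArc q (2 * i - j)) := by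
  have h1 : ∀ i, (torusLink 2 q).gen 2 (twoStrandArc q i) ◃
      (torusLink 2 q).gen 2 (twoStrandArc q (i + 1)) =
        (torusLink 2 q).gen 2 (twoStrandArc q (i - 1)) := fun i => by
    rw [twoStrand_gen_succ, LinkDiagram.act'_act'_gen_two]
  have key : ∀ m : ℕ, (torusLink 2 q).gen 2 (twoStrandArc q i) ◃
      (torusLink 2 q).gen 2 (twoStrandArc q (i + m)) =
        (torusLink 2 q).gen 2 (twoStrandArc q (i - m)) := by
    intro m
    induction m using Nat.twoStepInduction with
    | zero => simp
    | one => simpa using h1 i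
    | more m ih₀ ih₁ =>
      have e : i + ((m + 2 : ℕ) : ZMod q) = i + ((m + 1 : ℕ) : ZMod q) + 1 := by
        push_cast
        ring
      rw [e, twoStrand_gen_succ, Shelf.self_distrib, ih₁]
      have e' : i + ((m + 1 : ℕ) : ZMod q) - 1 = i + m := by
        push_cast
        ring
      have e'' : i - (m : ZMod q) = i - ((m + 1 : ℕ) : ZMod q) + 1 := by
        push_cast
        ring
      rw [e', ih₀, e'', h1]
      congr 2
      push_cast
      ring
  have := key (j - i).val
  rw [ZMod.natCast_val, ZMod.cast_id] at this
  rw [add_sub_cancel] at this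
  rw [this]
  congr 2
  ring

theorem dihedral_act'_sq {q : ℕ} (a : Quandle.Dihedral q) : Rack.act' a ^ 2 = 1 := by
  ext b
  rw [pow_two]
  change (2 * _ - (2 * _ - _) : ZMod q) = _
  exact sub_sub_cancel _ _

theorem torusGen_two_zero (q n : ℕ) (h : 1 < 2) :
    torusGen 2 q n h 0 = (torusLink 2 q).gen n (twoStrandArc q 0) :=
  rfl

theorem torusGen_two_one (q n : ℕ) (h : 1 < 2) :
    torusGen 2 q n h 1 = (torusLink 2 q).gen n (twoStrandArc q (-1)) := by
  rw [← zero_sub]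
  rfl

theorem cayleyGraph_two_strand (q : ℕ) (hq : 2 ≤ q) :
    HasCayleyGraph (torusGen 2 q 2 (by norm_num)) ![(0 : ZMod q), 1]
      ![fun w => -w, fun w => 2 - w] := by
  have : NeZero q := ⟨by omega⟩
  obtain ⟨e, he, hgen⟩ := twoStrand_equiv_dihedral (q := q) twoStrand_gen_act_two dihedral_act'_sq
  refine ⟨e, Fin.forall_fin_two.2 ⟨?_, ?_⟩⟩
  · rw [torusGen_two_zero]
    refine ⟨(hgen 0).trans neg_zero, fun y => ?_⟩
    rw [he, hgen]
    simp
  · rw [torusGen_two_one]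
    refine ⟨(hgen _).trans (neg_neg 1), fun y => ?_⟩
    rw [he, hgen]
    simp

theorem quandleIso_two_strand_dihedral (q : ℕ) [NeZero q] :
    QuandleIso ((torusLink 2 q).nQuandle 2) (Quandle.Dihedral q) := by
  obtain ⟨e, he, -⟩ := twoStrand_equiv_dihedral (q := q) twoStrand_gen_act_two dihedral_act'_sq
  exact ⟨e, he⟩

/-- The affine permutation of `ℤ/q` given by an element of `ℤ_q ⋊ ℤ_q^*`. -/
def affinePerm {q : ℕ} (g : CycHol q) : Equiv.Perm (ZMod q) where
  toFun w := (g.right : ZMod q) * w + Multiplicative.toAdd g.left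
  invFun w := ((g.right⁻¹ : (ZMod q)ˣ) : ZMod q) * (w - Multiplicative.toAdd g.left)
  left_inv w := by simp
  right_inv w := by simp

/-- The affine permutations of `ℤ/q` as automorphisms of the dihedral quandle. -/
def dihedralAffine (q : ℕ) : CycHol q →* quandleAut (Quandle.Dihedral q) where
  toFun g := ⟨affinePerm g, fun (x y : ZMod q) => by
    change affinePerm g (2 * x - y) = 2 * affinePerm g x - affinePerm g y
    simp only [affinePerm, Equiv.coe_fn_mk]
    ring⟩
  map_one' := by
    refine Subtype.ext (Equiv.ext fun (w : ZMod q) => ?_)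
    change ((1 : (ZMod q)ˣ) : ZMod q) * w + 0 = w
    simp
  map_mul' g h := by
    refine Subtype.ext (Equiv.ext fun (w : ZMod q) => ?_)
    change (((g.right * h.right : (ZMod q)ˣ)) : ZMod q) * w +
        (Multiplicative.toAdd g.left + (g.right : ZMod q) * Multiplicative.toAdd h.left) =
      (g.right : ZMod q) * ((h.right : ZMod q) * w + Multiplicative.toAdd h.left) +
        Multiplicative.toAdd g.left
    push_cast
    ring

/-- An automorphism `F` satisfies `F (m + 2) = 2 F (m + 1) - F m`, so that it is affine. -/
theorem dihedralAffine_bijective (q : ℕ) [NeZero q] :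
    Function.Bijective (dihedralAffine q) := by
  constructor
  · intro g h hgh
    have hw : ∀ w : ZMod q, (g.right : ZMod q) * w + Multiplicative.toAdd g.left =
        (h.right : ZMod q) * w + Multiplicative.toAdd h.left := fun w =>
      Equiv.congr_fun (congrArg Subtype.val hgh) w
    have h0 := hw 0
    have h1 := hw 1
    simp only [mul_zero, zero_add] at h0
    rw [h0] at h1
    simp only [mul_one, add_left_inj] at h1
    exact SemidirectProduct.ext h0 (Units.ext h1)
  · intro f
    let F : ZMod q → ZMod q := fun w => (f : Equiv.Perm (Quandle.Dihedral q)) w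
    have hF : ∀ x y, F (2 * x - y) = 2 * F x - F y := f.2
    have haff : ∀ m : ℕ, F m = (F 1 - F 0) * m + F 0 := by
      intro m
      induction m using Nat.twoStepInduction with
      | zero => simp
      | one => simp
      | more m ih₀ ih₁ =>
        have e : ((m + 2 : ℕ) : ZMod q) = 2 * ((m + 1 : ℕ) : ZMod q) - m := by
          push_cast
          ring
        rw [e, hF, ih₀, ih₁]
        ring
    have haff' : ∀ w, F w = (F 1 - F 0) * w + F 0 := fun w => by
      have := haff w.val
      rwa [ZMod.natCast_val, ZMod.cast_id] at this
    obtain ⟨w, hw'⟩ : ∃ w : ZMod q, F w = F 0 + 1 :=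
      (f : Equiv.Perm (Quandle.Dihedral q)).surjective (F 0 + 1 : ZMod q)
    rw [haff' w, add_comm, add_right_inj] at hw'
    let u : (ZMod q)ˣ := ⟨F 1 - F 0, w, hw', by rw [mul_comm, hw']⟩
    refine ⟨⟨Multiplicative.ofAdd (F 0), u⟩, Subtype.ext (Equiv.ext fun w => ?_)⟩
    exact (haff' w).symm

/-- The embedding `i ↦ 2 i` of `ℤ/(q / gcd (2, q))` in `ℤ/q`. -/
def zmodDouble (q : ℕ) : ZMod (q / Nat.gcd 2 q) →+ ZMod q :=
  ZMod.lift _ ⟨zmultiplesHom (ZMod q) 2, by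
    have h : (((q / Nat.gcd 2 q) * 2 : ℕ) : ZMod q) = 0 := by
      rw [ZMod.natCast_eq_zero_iff]
      calc q = q / Nat.gcd 2 q * Nat.gcd 2 q := (Nat.div_mul_cancel (Nat.gcd_dvd_right 2 q)).symm
        _ ∣ q / Nat.gcd 2 q * 2 := Nat.mul_dvd_mul_left _ (Nat.gcd_dvd_left 2 q)
    rw [zmultiplesHom_apply, natCast_zsmul, nsmul_eq_mul]
    exact_mod_cast h⟩

theorem zmodDouble_natCast (q m : ℕ) : zmodDouble q m = 2 * m := by
  have h : zmodDouble q ((m : ℤ) : ZMod (q / Nat.gcd 2 q)) = _ := ZMod.lift_coe _ _ (m : ℤ)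
  rw [Int.cast_natCast] at h
  rw [h]
  simp [mul_comm]

theorem zmodDouble_injective {q : ℕ} (hq : q ≠ 0) : Function.Injective (zmodDouble q) := by
  have hg : Nat.gcd 2 q ≠ 0 := Nat.gcd_ne_zero_left two_ne_zero
  have hm : q / Nat.gcd 2 q ≠ 0 :=
    (Nat.div_pos (Nat.le_of_dvd (by omega) (Nat.gcd_dvd_right 2 q)) (by omega)).ne'
  have : NeZero (q / Nat.gcd 2 q) := ⟨hm⟩
  rw [injective_iff_map_eq_zero]
  intro a ha
  obtain ⟨m, rfl⟩ := ZMod.natCast_zmod_surjective a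
  rw [zmodDouble_natCast] at ha
  have h2 : ((2 * m : ℕ) : ZMod q) = 0 := by exact_mod_cast ha
  rw [ZMod.natCast_eq_zero_iff] at h2 ⊢
  refine Nat.Coprime.dvd_of_dvd_mul_left
    (Nat.coprime_div_gcd_div_gcd (Nat.pos_of_ne_zero hg)).symm
    (m := 2 / Nat.gcd 2 q) ?_
  rw [Nat.div_mul_right_comm (Nat.gcd_dvd_left 2 q)]
  exact Nat.div_dvd_div (Nat.gcd_dvd_right 2 q) h2

theorem exists_zmodDouble_eq {q : ℕ} [NeZero q] (x : ZMod q) : ∃ i, zmodDouble q i = 2 * x := by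
  refine ⟨(x.val : ZMod (q / Nat.gcd 2 q)), ?_⟩
  rw [zmodDouble_natCast, ZMod.natCast_val, ZMod.cast_id]

theorem exists_eq_zmodDouble {q : ℕ} [NeZero q] (i : ZMod (q / Nat.gcd 2 q)) :
    ∃ x : ZMod q, zmodDouble q i = 2 * x := by
  obtain ⟨m, rfl⟩ := ZMod.intCast_surjective i
  refine ⟨m, ?_⟩
  have h : zmodDouble q ((m : ℤ) : ZMod (q / Nat.gcd 2 q)) = _ := ZMod.lift_coe _ _ (m : ℤ)
  rw [h]
  simp [mul_comm]

/-- The translation by `t` in `ℤ_q ⋊ ℤ_q^*`. -/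
def cycTranslation {q : ℕ} (t : ZMod q) : CycHol q := ⟨Multiplicative.ofAdd t, 1⟩

/-- The reflection `w ↦ t - w` in `ℤ_q ⋊ ℤ_q^*`. -/
def cycReflection {q : ℕ} (t : ZMod q) : CycHol q := ⟨Multiplicative.ofAdd t, -1⟩

theorem cycTranslation_mul_cycTranslation {q : ℕ} (s t : ZMod q) :
    cycTranslation s * cycTranslation t = cycTranslation (s + t) := by
  refine SemidirectProduct.ext ?_ (mul_one 1)
  change (s + (((1 : (ZMod q)ˣ) : ZMod q)) * t : ZMod q) = s + t
  simp

theorem cycTranslation_mul_cycReflection {q : ℕ} (s t : ZMod q) :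
    cycTranslation s * cycReflection t = cycReflection (s + t) := by
  refine SemidirectProduct.ext ?_ (one_mul _)
  change (s + (((1 : (ZMod q)ˣ) : ZMod q)) * t : ZMod q) = s + t
  simp

theorem cycReflection_mul_cycTranslation {q : ℕ} (s t : ZMod q) :
    cycReflection s * cycTranslation t = cycReflection (s - t) := by
  refine SemidirectProduct.ext ?_ (mul_one _)
  change (s + (((-1 : (ZMod q)ˣ) : ZMod q)) * t : ZMod q) = s - t
  simp [sub_eq_add_neg]

theorem cycReflection_mul_cycReflection {q : ℕ} (s t : ZMod q) :
    cycReflection s * cycReflection t = cycTranslation (s - t) := by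
  refine SemidirectProduct.ext ?_ ((neg_mul_neg (1 : (ZMod q)ˣ) 1).trans (mul_one 1))
  change (s + (((-1 : (ZMod q)ˣ) : ZMod q)) * t : ZMod q) = s - t
  simp [sub_eq_add_neg]

theorem cycReflection_inv {q : ℕ} (t : ZMod q) : (cycReflection t)⁻¹ = cycReflection t :=
  inv_eq_of_mul_eq_one_left (by
    rw [cycReflection_mul_cycReflection, sub_self]
    rfl)

/-- The dihedral group as the group of the maps `w ↦ ± w + 2 i`. -/
def dihedralEmbedding (q : ℕ) : DihedralGroup (q / Nat.gcd 2 q) →* CycHol q where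
  toFun
    | .r i => cycTranslation (zmodDouble q i)
    | .sr i => cycReflection (zmodDouble q (-i))
  map_one' := by
    change cycTranslation (zmodDouble q 0) = 1
    rw [map_zero]
    rfl
  map_mul' := by
    rintro (i | i) (j | j)
    · change cycTranslation (zmodDouble q (i + j)) = cycTranslation _ * cycTranslation _
      rw [cycTranslation_mul_cycTranslation, map_add]
    · change cycReflection (zmodDouble q (-(j - i))) = cycTranslation _ * cycReflection _
      rw [cycTranslation_mul_cycReflection, ← map_add]
      congr 2
      ring
    · change cycReflection (zmodDouble q (-(i + j))) = cycReflection _ * cycTranslation _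
      rw [cycReflection_mul_cycTranslation, ← map_sub]
      congr 2
      ring
    · change cycTranslation (zmodDouble q (j - i)) = cycReflection _ * cycReflection _
      rw [cycReflection_mul_cycReflection, ← map_sub]
      congr 2
      ring

theorem dihedralEmbedding_injective {q : ℕ} (hq : 3 ≤ q) :
    Function.Injective (dihedralEmbedding q) := by
  have : Fact (2 < q) := ⟨hq⟩
  have hd := zmodDouble_injective (q := q) (by omega)
  have hne : (-1 : (ZMod q)ˣ) ≠ 1 := fun h => ZMod.neg_one_ne_one (congrArg Units.val h)
  rintro (i | i) (j | j) h
  · exact congrArg _ (hd (congrArg SemidirectProduct.left h))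
  · exact absurd (congrArg SemidirectProduct.right h).symm hne
  · exact absurd (congrArg SemidirectProduct.right h) hne
  · exact congrArg _ (neg_injective (hd (congrArg SemidirectProduct.left h)))

/-- The translations by even residues. -/
def evenTranslations (q : ℕ) : Cyc (q / Nat.gcd 2 q) →* CycHol q where
  toFun i := cycTranslation (zmodDouble q (Multiplicative.toAdd i))
  map_one' := by
    rw [toAdd_one, map_zero]
    rfl
  map_mul' i j := by
    rw [cycTranslation_mul_cycTranslation, toAdd_mul, map_add]

theorem hasQuandleData_dihedral {q : ℕ} (hq : 3 ≤ q) :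
    HasQuandleData (Quandle.Dihedral q) q (CycHol q) (DihedralGroup (q / Nat.gcd 2 q))
      (Cyc (q / Nat.gcd 2 q)) := by
  have : NeZero q := ⟨by omega⟩
  let γ : ZMod q → CycHol q := fun x => cycReflection (2 * x)
  have hγ : ∀ x y, γ x * (γ y)⁻¹ = cycTranslation (2 * (x - y)) := fun x y => by
    rw [cycReflection_inv, cycReflection_mul_cycReflection, mul_sub]
  have hI : Subgroup.closure (Set.range γ) = (dihedralEmbedding q).range := by
    refine le_antisymm ?_ ?_
    · rw [Subgroup.closure_le]
      rintro _ ⟨x, rfl⟩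
      obtain ⟨i, hi⟩ := exists_zmodDouble_eq x
      refine ⟨.sr (-i), ?_⟩
      change cycReflection (zmodDouble q (- -i)) = cycReflection (2 * x)
      rw [neg_neg, hi]
    · rintro _ ⟨i | i, rfl⟩
      · obtain ⟨x, hx⟩ := exists_eq_zmodDouble i
        change cycTranslation (zmodDouble q i) ∈ _
        rw [hx, ← sub_zero x, ← hγ]
        exact mul_mem (Subgroup.subset_closure ⟨x, rfl⟩)
          (inv_mem (Subgroup.subset_closure ⟨0, rfl⟩))
      · obtain ⟨x, hx⟩ := exists_eq_zmodDouble (-i)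
        change cycReflection (zmodDouble q (-i)) ∈ _
        rw [hx]
        exact Subgroup.subset_closure ⟨x, rfl⟩
  have hT : Subgroup.closure {g | ∃ x y, g = γ x * (γ y)⁻¹} = (evenTranslations q).range := by
    refine le_antisymm ?_ ?_
    · rw [Subgroup.closure_le]
      rintro _ ⟨x, y, rfl⟩
      obtain ⟨i, hi⟩ := exists_zmodDouble_eq (x - y)
      refine ⟨Multiplicative.ofAdd i, ?_⟩
      rw [hγ, ← hi]
      rfl
    · rintro _ ⟨i, rfl⟩
      obtain ⟨x, hx⟩ := exists_eq_zmodDouble (Multiplicative.toAdd i)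
      refine Subgroup.subset_closure ⟨x, 0, ?_⟩
      change cycTranslation (zmodDouble q _) = _
      rw [hγ, hx, sub_zero]
  have hsym : ∀ x : ZMod q, dihedralAffine q (γ x) =
      pointSymmetry (show Quandle.Dihedral q from x) := fun x => by
    refine Subtype.ext (Equiv.ext fun (w : ZMod q) => ?_)
    change (((-1 : (ZMod q)ˣ) : ZMod q)) * w + 2 * x = 2 * x - w
    push_cast
    ring
  exact hasQuandleData_of_bijective (Nat.card_zmod q) (dihedralAffine q)
    (dihedralAffine_bijective q) γ hsym (dihedralEmbedding q)
    (dihedralEmbedding_injective hq) hI (evenTranslations q)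
    (fun i j h => zmodDouble_injective (by omega) (congrArg SemidirectProduct.left h)) hT

/-! ### The Hopf link -/

/-- Modulo `2` one has `2 i - j = j`, so that the generators act trivially. -/
theorem torusLink22_gen_act (n : ℕ) (i j : ZMod 2) :
    (torusLink 2 2).gen n (twoStrandArc 2 i) ◃ (torusLink 2 2).gen n (twoStrandArc 2 j) =
      (torusLink 2 2).gen n (twoStrandArc 2 (2 * i - j)) := by
  have h2 : 2 * i - j = j := by
    revert i j
    decide
  rw [h2]
  rcases (by revert i j; decide : j = i ∨ j = i - 1 ∧ j = i + 1) with rfl | ⟨h, h'⟩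
  · exact Quandle.fix
  · conv_rhs => rw [h', twoStrand_gen_succ]
    rw [h]

theorem dihedral_two_act' (a : Quandle.Dihedral 2) : Rack.act' a = 1 := by
  refine Equiv.ext fun b => ?_
  change (2 * _ - _ : ZMod 2) = _
  have : ∀ a b : ZMod 2, 2 * a - b = b := by decide
  exact this a b

theorem hasQuandleData_dihedral_two :
    HasQuandleData (Quandle.Dihedral 2) 2 (Cyc 2) Unit Unit := by
  let φ : Cyc 2 →* quandleAut (Quandle.Dihedral 2) :=
    (dihedralAffine 2).comp SemidirectProduct.inl
  have hφ : Function.Bijective φ := by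
    refine (dihedralAffine_bijective 2).comp ⟨SemidirectProduct.inl_injective, fun g => ?_⟩
    exact ⟨g.left, SemidirectProduct.ext rfl (Subsingleton.elim _ _)⟩
  refine hasQuandleData_of_bijective (Nat.card_zmod 2) φ hφ 1
    (fun x => ?_) 1 (fun _ _ _ => rfl) ?_ 1 (fun _ _ _ => rfl) ?_
  · rw [Pi.one_apply, map_one]
    exact Subtype.ext (dihedral_two_act' x).symm
  · rw [MonoidHom.range_one, Subgroup.closure_eq_bot_iff]
    rintro _ ⟨x, rfl⟩
    rfl
  · rw [MonoidHom.range_one, Subgroup.closure_eq_bot_iff]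
    rintro _ ⟨x, y, rfl⟩
    exact mul_inv_cancel (1 : Cyc 2)

theorem quandleData_hopf (n : ℕ) :
    HasQuandleData ((torusLink 2 2).nQuandle n) 2 (Cyc 2) Unit Unit ∧
      HasCayleyGraph (torusGen 2 2 n (by norm_num)) ![(0 : Fin 2), 1] (fun _ => id) := by
  obtain ⟨e, he, hgen⟩ := twoStrand_equiv_dihedral (torusLink22_gen_act n)
    fun a => by rw [dihedral_two_act', one_pow]
  have htriv : ∀ x y, e (x ◃ y) = e y := fun x y => by
    rw [he]
    have : ∀ a b : ZMod 2, 2 * a - b = b := by decide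
    exact this _ _
  have h0 : e (torusGen 2 2 n (by norm_num) 0) = 0 := hgen 0
  have h1 : e (torusGen 2 2 n (by norm_num) 1) = 1 := by rw [torusGen_two_one, hgen, neg_neg]
  refine ⟨HasQuandleData.of_iso (Q' := Quandle.Dihedral 2) ⟨e, he⟩ hasQuandleData_dihedral_two,
    e, ?_⟩
  exact Fin.forall_fin_two.2 ⟨⟨h0, fun y => htriv _ y⟩, ⟨h1, fun y => htriv _ y⟩⟩

/-! ### Coset enumeration in a quandle -/

namespace QuandleEnum

/-- The value `f k`, computed after the evaluation of `k` to a numeral: without this the kernel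
would copy unevaluated arguments. -/
def forced {α : Type} (k : ℕ) (f : ℕ → α) : α :=
  Nat.rec (f 0) (fun m _ => f (m + 1)) k

theorem forced_eq {α : Type} (k : ℕ) (f : ℕ → α) : forced k f = f k := by
  cases k <;> rfl

/-- A left fold that evaluates its state after each step. -/
def iter {α : Type} (f : ℕ → α → ℕ) : List α → ℕ → ℕ
  | [], K => K
  | a :: l, K => forced (f K a) (iter f l)

variable {p N : ℕ}

/-- The number of the edge labelled `i` that starts at the vertex `w`. A set of edges is encoded by
the natural number with the binary digits `1` at the numbers of its elements. -/
def edgeIndex (i : Fin p) (w : ℕ) : ℕ := i + p * w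

/-- Whether an edge belongs to a set of edges. -/
def hasEdge (K : ℕ) (i : Fin p) (w : ℕ) : Bool := K.testBit (edgeIndex i w)

/-- A set of edges with one edge added. -/
def addEdge (K : ℕ) (i : Fin p) (w : ℕ) : ℕ := K ||| 2 ^ edgeIndex i w

/-- The graph `E` as a natural number with the digits `E i w` in base `N`. -/
def graphCode (E : Fin p → Fin N → Fin N) : ℕ :=
  (List.finRange N).foldr (fun w T => (List.finRange p).foldr (fun i T => E i w + N * T) T) 0

/-- The end of the edge labelled `i` that starts at `w`, in the graph with code `T`. -/
def target (N T : ℕ) (i : Fin p) (w : ℕ) : ℕ := T / N ^ edgeIndex i w % N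

/-- The end of the path that starts at a vertex and reads a word, if all its edges
are in `K`. -/
def follow (E : Fin p → ℕ → ℕ) (K : ℕ) : List (Fin p) → ℕ → Option ℕ
  | [], w => some w
  | i :: u, w => bif hasEdge K i w then forced (E i w) (follow E K u) else none

/-- Knowing that reading the word `u` leads from `w` to `t`, and if all the edges on the way but one
are in `K`, the remaining edge can be added. -/
def close (E : Fin p → ℕ → ℕ) (K : ℕ) (t : ℕ) : List (Fin p) → ℕ → ℕ
  | [], _ => K
  | i :: u, w =>
    bif hasEdge K i w then forced (E i w) (close E K t u)
    else match forced (E i w) (follow E K u) with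
      | none => K
      | some t' => bif t' == t then addEdge K i w else K

/-- Use of the relation between two words at the vertex `w`. -/
def scan (E : Fin p → ℕ → ℕ) (w : ℕ) (K : ℕ) (r : List (Fin p) × List (Fin p)) : ℕ :=
  match follow E K r.2 w with
  | none => K
  | some t => forced t fun t => close E K t r.1 w

/-- The first edge that leads to `w` from a vertex with a smaller number. -/
def parent (E : Fin p → ℕ → ℕ) (w : ℕ) : Option (Fin p × ℕ) :=
  ((List.range w).flatMap fun v => (List.finRange p).map fun i => (i, v)).find?
    fun e => E e.1 e.2 == w

/-- The edges of a spanning forest, rooted at the first `p` vertices. -/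
def treeEdges (E : Fin p → ℕ → ℕ) (N : ℕ) : ℕ :=
  iter (fun K w => match parent E w with
      | none => K
      | some e => addEdge K e.1 e.2) (List.range' p (N - p)) 0

/-- One round of the enumeration: the relations `P` between generators, then the relations `R`
at all vertices. -/
def enumRound (E : Fin p → ℕ → ℕ) (N : ℕ) (P : List (List (Fin p) × Fin p × Fin p))
    (R : List (List (Fin p) × List (Fin p))) (K : ℕ) : ℕ :=
  iter (fun K w => iter (scan E w) R K) (List.range N)
    (iter (fun K r => close E K r.2.2 r.1 r.2.1) P K)

/-- There is a spanning forest, rooted at the first `p` vertices, and beginning with its edges,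
all the edges are obtained in `k` rounds of the enumeration. -/
def complete (E : Fin p → Fin N → Fin N) (P : List (List (Fin p) × Fin p × Fin p))
    (R : List (List (Fin p) × List (Fin p))) (k : ℕ) : Bool :=
  forced (graphCode E) fun T =>
    (List.finRange N).all (fun w => (List.finRange p).all fun i => target N T i w == E i w) &&
    (List.range' p (N - p)).all (fun w => (parent (p := p) (target N T) w).isSome) &&
    iter (fun K _ => enumRound (target N T) N P R K) (List.range k)
      (treeEdges (target (p := p) N T) N) == 2 ^ (p * N) - 1

/-! The enumeration is sound: if `g w` is an element for each vertex `w`, and the edges that are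
already in the set describe the action of the generators, then so do the added ones. -/

theorem edgeIndex_injective {i i' : Fin p} {w w' : ℕ} (h : edgeIndex i w = edgeIndex i' w') :
    i = i' ∧ w = w' := by
  have hi := i.2
  have hi' := i'.2
  have hp : 0 < p := by omega
  have h1 := congrArg (· % p) h
  have h2 := congrArg (· / p) h
  simp only [edgeIndex, Nat.add_mul_mod_self_left, Nat.add_mul_div_left _ _ hp,
    Nat.mod_eq_of_lt hi, Nat.mod_eq_of_lt hi', Nat.div_eq_of_lt hi, Nat.div_eq_of_lt hi',
    zero_add] at h1 h2
  exact ⟨Fin.ext h1, h2⟩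

theorem iter_induction {α : Type} {f : ℕ → α → ℕ} {I : ℕ → Prop} :
    ∀ {l : List α}, (∀ a ∈ l, ∀ K, I K → I (f K a)) → ∀ {K}, I K → I (iter f l K)
  | [], _, _, hK => hK
  | a :: l, hf, K, hK => by
    rw [iter, forced_eq]
    exact iter_induction (fun b hb => hf b (List.mem_cons_of_mem a hb))
      (hf a List.mem_cons_self K hK)

section Soundness

variable {Q : Type} [Quandle Q]

/-- The action of a word in the generators, the first letter acting first. -/
def wordAct (x : Fin p → Q) (u : List (Fin p)) (y : Q) : Q :=
  u.foldl (fun y i => x i ◃ y) y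

theorem wordAct_injective (x : Fin p → Q) :
    ∀ u : List (Fin p), Function.Injective (wordAct x u)
  | [] => fun _ _ h => h
  | i :: u => fun _ _ h => (Rack.left_cancel (x i)).1 (wordAct_injective x u h)

theorem wordAct_append (x : Fin p → Q) (u v : List (Fin p)) (y : Q) :
    wordAct x (u ++ v) y = wordAct x v (wordAct x u y) :=
  List.foldl_append

theorem wordAct_act (x : Fin p → Q) :
    ∀ (u : List (Fin p)) (y z : Q), wordAct x u (y ◃ z) = wordAct x u y ◃ wordAct x u z
  | [], _, _ => rfl
  | i :: u, y, z => by
    change wordAct x u (x i ◃ (y ◃ z)) = _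
    rw [Shelf.self_distrib, wordAct_act x u]
    rfl

/-- The edges in `K` describe the action of the generators on the elements `g w`. -/
def Valid (x : Fin p → Q) (E : Fin p → ℕ → ℕ) (g : ℕ → Q) (K : ℕ) : Prop :=
  ∀ i w, hasEdge K i w = true → x i ◃ g w = g (E i w)

variable {x : Fin p → Q} {E : Fin p → ℕ → ℕ} {g : ℕ → Q} {K : ℕ}

theorem Valid.addEdge (hK : Valid x E g K) {i : Fin p} {w : ℕ} (h : x i ◃ g w = g (E i w)) :
    Valid x E g (addEdge K i w) := by
  intro j v hj
  rw [hasEdge, QuandleEnum.addEdge, Nat.testBit_or, Bool.or_eq_true, Nat.testBit_two_pow,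
    decide_eq_true_eq] at hj
  rcases hj with hj | hj
  · exact hK j v hj
  · obtain ⟨rfl, rfl⟩ := edgeIndex_injective hj
    exact h

theorem Valid.follow (hK : Valid x E g K) :
    ∀ {u : List (Fin p)} {w t : ℕ}, follow E K u w = some t → wordAct x u (g w) = g t
  | [], w, t, h => congrArg g (Option.some.inj h)
  | i :: u, w, t, h => by
    rw [QuandleEnum.follow] at h
    cases hi : hasEdge K i w with
    | false => simp [hi] at h
    | true =>
      rw [hi, cond_true, forced_eq] at h
      change wordAct x u (x i ◃ g w) = g t
      rw [hK i w hi]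
      exact hK.follow h

theorem Valid.close (hK : Valid x E g K) {t : ℕ} :
    ∀ {u : List (Fin p)} {w : ℕ}, wordAct x u (g w) = g t → Valid x E g (close E K t u w)
  | [], _, _ => hK
  | i :: u, w, h => by
    change wordAct x u (x i ◃ g w) = g t at h
    rw [QuandleEnum.close]
    cases hi : hasEdge K i w with
    | true =>
      rw [cond_true, forced_eq]
      rw [hK i w hi] at h
      exact hK.close h
    | false =>
      rw [cond_false, forced_eq]
      cases hf : QuandleEnum.follow E K u (E i w) with
      | none => exact hK
      | some t' =>
        cases ht : t' == t with
        | false => simpa [ht] using hK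
        | true =>
          simp only [ht, cond_true]
          refine hK.addEdge (wordAct_injective x u ?_)
          rw [h, hK.follow hf, eq_of_beq ht]

theorem Valid.scan (hK : Valid x E g K) {r : List (Fin p) × List (Fin p)}
    (hr : ∀ y, wordAct x r.1 y = wordAct x r.2 y) (w : ℕ) : Valid x E g (scan E w K r) := by
  rw [QuandleEnum.scan]
  cases hf : QuandleEnum.follow E K r.2 w with
  | none => exact hK
  | some t =>
    simp only [forced_eq]
    exact hK.close (by rw [hr, hK.follow hf])

theorem Valid.enumRound (hK : Valid x E g K) {P : List (List (Fin p) × Fin p × Fin p)}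
    {R : List (List (Fin p) × List (Fin p))} (hg : ∀ i : Fin p, g i = x i)
    (hP : ∀ r ∈ P, wordAct x r.1 (x r.2.1) = x r.2.2)
    (hR : ∀ r ∈ R, ∀ y, wordAct x r.1 y = wordAct x r.2 y) (N : ℕ) :
    Valid x E g (enumRound E N P R K) := by
  refine iter_induction (fun w _ K hK => iter_induction (fun r hr K hK => ?_) hK)
    (iter_induction (fun r hr K hK => ?_) hK)
  · exact hK.scan (hR r hr) w
  · refine hK.close ?_
    rw [hg, hg, hP r hr]

/-- The element that belongs to a vertex, defined along the forest. -/
def vertexLift (x : Fin p → Q) (d : Q) (E : Fin p → ℕ → ℕ) (w : ℕ) : Q :=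
  if h : w < p then x ⟨w, h⟩
  else match parent E w with
    | none => d
    | some e => if e.2 < w then x e.1 ◃ vertexLift x d E e.2 else d
termination_by w

theorem parent_eq_some {w : ℕ} {e : Fin p × ℕ} (h : parent E w = some e) :
    e.2 < w ∧ E e.1 e.2 = w := by
  refine ⟨?_, eq_of_beq (List.find?_some (p := fun e : Fin p × ℕ => E e.1 e.2 == w) h)⟩
  have := List.mem_of_find?_eq_some h
  simp only [List.mem_flatMap, List.mem_map, List.mem_range] at this
  obtain ⟨v, hv, i, -, rfl⟩ := this
  exact hv

theorem vertexLift_of_lt (d : Q) (i : Fin p) : vertexLift x d E i = x i := by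
  rw [vertexLift, dif_pos i.2]

theorem vertexLift_of_parent (d : Q) {w : ℕ} (hw : p ≤ w) {e : Fin p × ℕ}
    (he : parent E w = some e) : vertexLift x d E w = x e.1 ◃ vertexLift x d E e.2 := by
  rw [vertexLift, dif_neg (by omega), he]
  exact if_pos (parent_eq_some he).1

theorem valid_treeEdges (d : Q) (N : ℕ) : Valid x E (vertexLift x d E) (treeEdges E N) := by
  refine iter_induction (fun w hw K hK => ?_) fun i w h => by simp [hasEdge] at h
  cases he : parent E w with
  | none => exact hK
  | some e =>
    refine hK.addEdge ?_
    rw [(parent_eq_some he).2, vertexLift_of_parent d (List.mem_range'_1.1 hw).1 he]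

/-- If the enumeration is complete, a quandle that satisfies the relations and maps onto a quandle
with the given graph has this graph itself. -/
theorem exists_equiv_of_complete [NeZero p] {Y : Type} [Quandle Y] {E : Fin p → Fin N → Fin N}
    {P : List (List (Fin p) × Fin p × Fin p)} {R : List (List (Fin p) × List (Fin p))} {k : ℕ}
    (h : complete E P R k = true) (hx : QuandleGenerates x)
    (hP : ∀ r ∈ P, wordAct x r.1 (x r.2.1) = x r.2.2)
    (hR : ∀ r ∈ R, ∀ y, wordAct x r.1 y = wordAct x r.2 y)
    (f : Q →◃ Y) {c : Fin N → Y} (hc : Function.Injective c) {v : Fin p → Fin N}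
    (hv : ∀ i, (v i : ℕ) = i) (hf : ∀ i, f (x i) = c (v i))
    (hE : ∀ i w, c (v i) ◃ c w = c (E i w)) :
    ∃ e : Q ≃ Fin N, (∀ i, e (x i) = v i) ∧ (∀ i y, e (x i ◃ y) = E i (e y)) ∧
      ∀ y, f y = c (e y) := by
  rw [complete, forced_eq] at h
  generalize graphCode E = T at h
  simp only [Bool.and_eq_true, List.all_eq_true, beq_iff_eq, List.mem_finRange, true_imp_iff,
    List.mem_range'_1] at h
  obtain ⟨⟨hT, hpar⟩, hfull⟩ := h
  let g := vertexLift x (x 0) (target (p := p) N T)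
  have hg : ∀ i : Fin p, g i = x i := vertexLift_of_lt _
  have hvalid : Valid x (target N T) g (2 ^ (p * N) - 1) := by
    rw [← hfull]
    exact iter_induction (fun _ _ K hK => hK.enumRound hg hP hR N) (valid_treeEdges _ N)
  have hact : ∀ i (w : Fin N), x i ◃ g w = g (E i w) := fun i w => by
    rw [← hT w i]
    refine hvalid i w ?_
    rw [hasEdge, Nat.testBit_two_pow_sub_one, decide_eq_true_eq, edgeIndex]
    calc (i : ℕ) + p * w < p * (w + 1) := by rw [mul_add_one]; omega
      _ ≤ p * N := Nat.mul_le_mul_left p w.2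
  have hEinj : ∀ i, Function.Injective (E i) := fun i w w' hw => by
    have := congrArg c hw
    rw [← hE, ← hE, Rack.left_cancel] at this
    exact hc this
  have hsurj : ∀ y, ∃ w : Fin N, g w = y := by
    refine hx _ (fun i => ⟨v i, by rw [hv, hg]⟩) fun i y => ⟨?_, ?_⟩
    · rintro ⟨w, rfl⟩
      exact ⟨E i w, (hact i w).symm⟩
    · rintro ⟨w, hw⟩
      obtain ⟨w', rfl⟩ := (Finite.injective_iff_surjective.1 (hEinj i)) w
      refine ⟨w', (Rack.left_cancel (x i)).1 ?_⟩
      rw [hact, hw]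
  have hfg : ∀ (m : ℕ) (hm : m < N), f (g m) = c ⟨m, hm⟩ := by
    intro m
    induction m using Nat.strong_induction_on with
    | _ m ih =>
      intro hm
      by_cases hmp : m < p
      · refine (congrArg f (hg ⟨m, hmp⟩)).trans ((hf _).trans (congrArg c (Fin.ext (hv _))))
      · obtain ⟨e, he⟩ := Option.isSome_iff_exists.1 (hpar m ⟨by omega, by omega⟩)
        obtain ⟨hlt, htar⟩ := parent_eq_some he
        have h1 : g m = x e.1 ◃ g e.2 := vertexLift_of_parent _ (by omega) he
        rw [h1, f.map_act, hf, ih e.2 hlt (hlt.trans hm), hE]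
        exact congrArg c (Fin.ext ((hT ⟨e.2, hlt.trans hm⟩ e.1).symm.trans htar))
  have hinj : Function.Injective fun w : Fin N => g w := fun w w' hw => by
    have := congrArg f hw
    simp only [hfg _ (Fin.is_lt _)] at this
    exact hc this
  let e : Fin N ≃ Q := Equiv.ofBijective (fun w : Fin N => g w) ⟨hinj, hsurj⟩
  refine ⟨e.symm, fun i => ?_, fun i y => ?_, fun y => ?_⟩
  · rw [Equiv.symm_apply_eq]
    change x i = g (v i)
    rw [hv, hg]
  · obtain ⟨w, rfl⟩ := e.surjective y
    rw [Equiv.symm_apply_eq, Equiv.symm_apply_apply]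
    exact hact i w
  · obtain ⟨w, rfl⟩ := e.surjective y
    rw [Equiv.symm_apply_apply]
    exact hfg w w.2

end Soundness

/-- The word whose action is the product of the point symmetries `S_{x_0} ⋯ S_{x_{q-1}}`. -/
def torusWord (p q : ℕ) [NeZero p] : List (Fin p) :=
  ((List.range q).map (Fin.ofNat p)).reverse

/-- The relations `x_i ◃ x_i = x_i` and `S_{x_0} ⋯ S_{x_{q-1}} x_{q+k} = x_k`. -/
def torusPoints (p q : ℕ) [NeZero p] : List (List (Fin p) × Fin p × Fin p) :=
  (List.finRange p).flatMap fun k => [([k], k, k), (torusWord p q, Fin.ofNat p (q + k), k)]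

/-- The relations between point symmetries of the generators that follow from those of
`torusPoints`, and the relations `S_{x_i} ^ n = 1`. If `p` divides `q`, then
`S_{x_0} ⋯ S_{x_{q-1}}` fixes all generators. The conjugation relations are listed in both
directions, since an application adds edges to the path of the first word only. -/
def torusRelators (p q n : ℕ) [NeZero p] : List (List (Fin p) × List (Fin p)) :=
  (if p ∣ q then [(torusWord p q, [])] else []) ++
    (List.finRange p).flatMap fun k =>
      [(List.replicate n k, []),
        (Fin.ofNat p (q + k) :: torusWord p q, torusWord p q ++ [k]),
        (torusWord p q ++ [k], Fin.ofNat p (q + k) :: torusWord p q)]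

theorem wordAct_torusWord {p : ℕ} [NeZero p] {Q : Type} [Quandle Q] (x : Fin p → Q) (q : ℕ)
    (z : Q) : wordAct x (torusWord p q) z =
      (symmetryProd (fun j => x (Fin.ofNat p j)) q : Equiv.Perm Q) z := by
  induction q generalizing z with
  | zero => rfl
  | succ q ih =>
    rw [symmetryProd_succ_apply, ← ih]
    simp only [torusWord, List.range_succ, List.map_append, List.reverse_append]
    rfl

theorem wordAct_replicate {p : ℕ} {Q : Type} [Quandle Q] (x : Fin p → Q) (n : ℕ) (i : Fin p)
    (z : Q) : wordAct x (List.replicate n i) z = (Rack.act' (x i) ^ n) z := by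
  induction n generalizing z with
  | zero => rfl
  | succ n ih =>
    rw [pow_succ]
    exact ih _

theorem torusPoints_sound {p q n : ℕ} [NeZero p] (hp : 1 < p)
    {r : List (Fin p) × Fin p × Fin p} (hr : r ∈ torusPoints p q) :
    wordAct (torusGen p q n hp) r.1 (torusGen p q n hp r.2.1) = torusGen p q n hp r.2.2 := by
  simp only [torusPoints, List.mem_flatMap, List.mem_cons, List.not_mem_nil, or_false] at hr
  obtain ⟨k, -, rfl | rfl⟩ := hr
  · exact Quandle.fix
  · rw [wordAct_torusWord]
    exact (symmetryProd_torusGenMod n hp k.2).trans (torusGenMod_of_lt hp k.2)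

theorem torusRelators_sound {p q n : ℕ} [NeZero p] [NeZero q] (hp : 1 < p)
    {r : List (Fin p) × List (Fin p)} (hr : r ∈ torusRelators p q n)
    (y : (torusLink p q).nQuandle n) :
    wordAct (torusGen p q n hp) r.1 y = wordAct (torusGen p q n hp) r.2 y := by
  have hW : ∀ z (k : Fin p), wordAct (torusGen p q n hp) (torusWord p q)
      (torusGen p q n hp (Fin.ofNat p (q + k)) ◃ z) =
        torusGen p q n hp k ◃ wordAct (torusGen p q n hp) (torusWord p q) z := fun z k => by
    rw [wordAct_torusWord, wordAct_torusWord, symmetryProd_act]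
    exact congrArg (· ◃ _)
      ((symmetryProd_torusGenMod n hp k.2).trans (torusGenMod_of_lt hp k.2))
  simp only [torusRelators, List.mem_append, List.mem_flatMap, List.mem_cons, List.not_mem_nil,
    or_false] at hr
  rcases hr with hr | ⟨k, -, rfl | rfl | rfl⟩
  · split_ifs at hr with hpq
    · obtain rfl := List.mem_singleton.1 hr
      rw [wordAct_torusWord]
      have h1 : symmetryProd (fun j => torusGen p q n hp (Fin.ofNat p j)) q = 1 := by
        refine (generates_torusGen p q n hp).perm_ext fun k => ?_
        refine Eq.trans ?_ ((symmetryProd_torusGenMod n hp k.2).trans (torusGenMod_of_lt hp k.2))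
        refine congrArg _ (congrArg (torusGen p q n hp) (Fin.ext ?_))
        obtain ⟨m, rfl⟩ := hpq
        exact ((Nat.mul_add_mod _ _ _).trans (Nat.mod_eq_of_lt k.2)).symm
      rw [h1]
      rfl
    · exact absurd hr List.not_mem_nil
  · rw [wordAct_replicate, act'_torusGen_pow]
    rfl
  · rw [wordAct_append]
    exact hW y k
  · rw [wordAct_append]
    exact (hW y k).symm

/-- The action of a word on the vertices of a graph. -/
def wordTarget (E : Fin p → Fin N → Fin N) (u : List (Fin p)) (w : Fin N) : Fin N :=
  u.foldl (fun w i => E i w) w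

theorem wordAct_eq_wordTarget {p N : ℕ} {Y : Type} [Quandle Y] {E : Fin p → Fin N → Fin N}
    {v : Fin p → Fin N} {c : Fin N → Y} (hE : ∀ i w, c (v i) ◃ c w = c (E i w)) :
    ∀ (u : List (Fin p)) (w : Fin N),
      wordAct (fun i => c (v i)) u (c w) = c (wordTarget E u w)
  | [], _ => rfl
  | i :: u, w => by
    change wordAct _ u (c (v i) ◃ c w) = _
    rw [hE]
    exact wordAct_eq_wordTarget hE u (E i w)

/-- Coset enumeration for the `n`-quandle of a torus link: a quandle `Y` in which the relations hold
is isomorphic to it, and generated by the images of the generators, if the enumeration is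
complete for the graph of `Y`. -/
theorem torus_quandleIso_and_cayleyGraph {p q n : ℕ} [NeZero p] [NeZero q] (hp : 1 < p) {N : ℕ}
    {E : Fin p → Fin N → Fin N} {k : ℕ} {v : Fin p → Fin N}
    (h : complete E (torusPoints p q) (torusRelators p q n) k = true)
    (hv : ∀ i, (v i : ℕ) = i)
    (hpts : ∀ r ∈ torusPoints p q, wordTarget E r.1 (v r.2.1) = v r.2.2)
    (hpow : ∀ i w, wordTarget E (List.replicate n i) w = w)
    {Y : Type} [Quandle Y] {c : Fin N → Y} (hc : Function.Bijective c)
    (hE : ∀ i w, c (v i) ◃ c w = c (E i w)) :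
    QuandleIso ((torusLink p q).nQuandle n) Y ∧ HasCayleyGraph (torusGen p q n hp) v E ∧
      QuandleGenerates fun i => c (v i) := by
  obtain ⟨f, hf⟩ := exists_hom_of_torus_relations (q := q) n hp
    (fun j => c (v (Fin.ofNat p j)))
    (fun j => congrArg (fun i => c (v i)) (Fin.ext (Nat.add_mod_right j p)))
    (fun k hk => by
      have := hpts (torusWord p q, Fin.ofNat p (q + k), ⟨k, hk⟩)
        (List.mem_flatMap.2 ⟨⟨k, hk⟩, List.mem_finRange _, by simp [Fin.ofNat]⟩)
      rw [← wordAct_torusWord (fun i => c (v i)), wordAct_eq_wordTarget hE, this]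
      exact congrArg (fun i => c (v i)) (Fin.ext (Nat.mod_eq_of_lt hk).symm))
    (fun j => Equiv.ext fun y => by
      obtain ⟨w, rfl⟩ := hc.2 y
      rw [← wordAct_replicate (fun i => c (v i)), wordAct_eq_wordTarget hE, hpow]
      rfl)
  obtain ⟨e, he, heE, hfe⟩ := exists_equiv_of_complete h (generates_torusGen p q n hp)
    (fun r hr => torusPoints_sound hp hr) (fun r hr => torusRelators_sound hp hr) f hc.1 hv
    (fun i => (hf i).trans (congrArg (fun i => c (v i)) (Fin.ext (Nat.mod_eq_of_lt i.2)))) hE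
  have hgen : QuandleGenerates fun i => f (torusGen p q n hp i) :=
    (generates_torusGen p q n hp).map f fun y => by
      obtain ⟨w, rfl⟩ := hc.2 y
      exact ⟨e.symm w, by rw [hfe, e.apply_symm_apply]⟩
  simp only [hfe, he] at hgen
  refine ⟨⟨e.trans (Equiv.ofBijective c hc), fun x y => ?_⟩, ⟨e, fun i => ⟨he i, heE i⟩⟩, hgen⟩
  change c (e (x ◃ y)) = c (e x) ◃ c (e y)
  rw [← hfe, ← hfe, ← hfe, f.map_act]

end QuandleEnum

/-! ### Coset enumeration for the link `T_{2,4}` with one component reversed -/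

theorem act_act_eq_of_act'_pow_three {Q : Type} [Quandle Q] {y : Q} (h : Rack.act' y ^ 3 = 1)
    (x z : Q) : (y ◃ x) ◃ z = y ◃ (x ◃ (y ◃ (y ◃ z))) := by
  have hz : y ◃ (y ◃ (y ◃ z)) = z := Equiv.congr_fun h z
  calc (y ◃ x) ◃ z = (y ◃ x) ◃ (y ◃ (y ◃ (y ◃ z))) := by rw [hz]
    _ = y ◃ (x ◃ (y ◃ (y ◃ z))) := Shelf.self_distrib.symm

theorem invariant_act {Q : Type} [Quandle Q] {P : Q → Prop} {x y : Q}
    (hx : ∀ z, P z ↔ P (x ◃ z)) (hy : ∀ z, P z ↔ P (y ◃ z)) (z : Q) :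
    P z ↔ P ((x ◃ y) ◃ z) := by
  obtain ⟨z, rfl⟩ := (Rack.act' x).surjective z
  change P (x ◃ z) ↔ P ((x ◃ y) ◃ (x ◃ z))
  rw [← Shelf.self_distrib, ← hx, ← hx, ← hy]

theorem act'_act_pow {Q : Type} [Quandle Q] {n : ℕ} {y : Q} (h : Rack.act' y ^ n = 1)
    (x : Q) : Rack.act' (x ◃ y) ^ n = 1 := by
  have := quandleAut.act'_map (pointSymmetry x) y
  change Rack.act' (x ◃ y) = _ at this
  rw [this, conj_pow, h, mul_one, mul_inv_cancel]

/-- The generators of `Q_n(T_{2,4}^{+-})`, indexed by the levels of the braid. -/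
noncomputable def pmGen (n : ℕ) (i : ZMod 4) : torusLink24pm.nQuandle n :=
  (torusLink 2 4).revGen ((torusLink 2 4).component (torusStrand 2 4 Nat.one_lt_two 0 1)) n
    (twoStrandArc 4 i)

theorem pmGen_succ (n : ℕ) {i : ZMod 4} (hi : ¬ (i = 1 ∨ i = 3)) :
    pmGen n (i + 1) = pmGen n i ◃ pmGen n (i - 1) :=
  twoStrand_revGen_succ n (mt (mem_component_b_iff i).1 hi)

theorem pmGen_pred (n : ℕ) {i : ZMod 4} (hi : i = 1 ∨ i = 3) :
    pmGen n (i - 1) = pmGen n i ◃ pmGen n (i + 1) :=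
  twoStrand_revGen_pred n ((mem_component_b_iff i).2 hi)

theorem pmGen_one (n : ℕ) : pmGen n 1 = torusGen24pm n 0 ◃ torusGen24pm n 1 :=
  pmGen_succ n (i := 0) (by decide)

theorem pmGen_two (n : ℕ) : pmGen n 2 = torusGen24pm n 1 ◃ torusGen24pm n 0 :=
  pmGen_pred n (i := 3) (by decide)

theorem act'_torusGen24pm_pow (n : ℕ) (k : Fin 2) : Rack.act' (torusGen24pm n k) ^ n = 1 :=
  torusLink24pm.act'_gen_pow n _

theorem generates_torusGen24pm (n : ℕ) : QuandleGenerates (torusGen24pm n) := by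
  refine ((torusLink 2 4).generates_revGen _ n).of_subset fun P hP hact => ?_
  have hprod : ∀ i j, P (torusGen24pm n i ◃ torusGen24pm n j) ∧
      ∀ y, P y ↔ P ((torusGen24pm n i ◃ torusGen24pm n j) ◃ y) := fun i j =>
    ⟨(hact _ _).1 (hP _), invariant_act (hact i) (hact j)⟩
  refine torusLink_two_arc_cases fun i => ?_
  change P (pmGen n i) ∧ ∀ y, P y ↔ P (pmGen n i ◃ y)
  rcases (by revert i; decide : i = 0 ∨ i = 1 ∨ i = 2 ∨ i = 3) with rfl | rfl | rfl | rfl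
  · exact ⟨hP 0, hact 0⟩
  · rw [pmGen_one]
    exact hprod 0 1
  · rw [pmGen_two]
    exact hprod 1 0
  · exact ⟨hP 1, hact 1⟩

namespace QuandleEnum

/-- The word of `S_{x ◃ y} S_y`, where `x` is the generator `i` and `y` the other one, if the third
powers of the point symmetries are trivial. -/
def pmWord (i : Fin 2) : List (Fin 2) := [i + 1, i, i, i + 1, i]

/-- The relations `x_i ◃ x_i = x_i` and `S_{x_i ◃ x_j} (x_j ◃ x_i) = x_i` for `j ≠ i`. -/
def pmPoints : List (List (Fin 2) × Fin 2 × Fin 2) :=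
  (List.finRange 2).flatMap fun i => [([i], i, i), (pmWord i, i, i)]

/-- The relations between point symmetries that follow from those of `pmPoints`, and the
relations `S_{x_i} ^ 3 = 1`. -/
def pmRelators : List (List (Fin 2) × List (Fin 2)) :=
  (List.finRange 2).flatMap fun i =>
    [(List.replicate 3 i, []), (i :: pmWord i, pmWord i ++ [i]),
      (pmWord i ++ [i], i :: pmWord i)]

theorem wordAct_pmWord {Q : Type} [Quandle Q] {x : Fin 2 → Q}
    (hx : ∀ i, Rack.act' (x i) ^ 3 = 1) (i : Fin 2) (z : Q) :
    wordAct x (pmWord i) z = (x i ◃ x (i + 1)) ◃ (x (i + 1) ◃ z) := by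
  rw [act_act_eq_of_act'_pow_three (hx i)]
  rfl

theorem wordAct_pmWord_torusGen24pm (i : Fin 2) :
    wordAct (torusGen24pm 3) (pmWord i) (torusGen24pm 3 i) = torusGen24pm 3 i := by
  rw [wordAct_pmWord (act'_torusGen24pm_pow 3)]
  rcases Fin.exists_fin_two.1 ⟨i, rfl⟩ with rfl | rfl
  · refine (congrArg₂ (· ◃ ·) (pmGen_one 3) (pmGen_two 3)).symm.trans ?_
    exact (pmGen_pred 3 (i := 1) (by decide)).symm
  · refine (congrArg₂ (· ◃ ·) (pmGen_two 3) (pmGen_one 3)).symm.trans ?_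
    exact (pmGen_succ 3 (i := 2) (by decide)).symm

theorem pmRelators_sound {r : List (Fin 2) × List (Fin 2)} (hr : r ∈ pmRelators)
    (y : torusLink24pm.nQuandle 3) :
    wordAct (torusGen24pm 3) r.1 y = wordAct (torusGen24pm 3) r.2 y := by
  have hW : ∀ z i, wordAct (torusGen24pm 3) (pmWord i) (torusGen24pm 3 i ◃ z) =
      torusGen24pm 3 i ◃ wordAct (torusGen24pm 3) (pmWord i) z := fun z i => by
    rw [wordAct_act, wordAct_pmWord_torusGen24pm]
  simp only [pmRelators, List.mem_flatMap, List.mem_cons, List.not_mem_nil, or_false] at hr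
  obtain ⟨i, -, rfl | rfl | rfl⟩ := hr
  · rw [wordAct_replicate, act'_torusGen24pm_pow]
    rfl
  · rw [wordAct_append]
    exact hW y i
  · rw [wordAct_append]
    exact (hW y i).symm

/-- Coset enumeration for the `3`-quandle of `T_{2,4}^{+-}`. -/
theorem torus24pm_quandleIso_and_cayleyGraph {N : ℕ} {E : Fin 2 → Fin N → Fin N} {k : ℕ}
    {v : Fin 2 → Fin N} (h : complete E pmPoints pmRelators k = true)
    (hv : ∀ i, (v i : ℕ) = i)
    (hpts : ∀ r ∈ pmPoints, wordTarget E r.1 (v r.2.1) = v r.2.2)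
    (hpow : ∀ i w, wordTarget E (List.replicate 3 i) w = w)
    {Y : Type} [Quandle Y] {c : Fin N → Y} (hc : Function.Bijective c)
    (hE : ∀ i w, c (v i) ◃ c w = c (E i w)) :
    QuandleIso (torusLink24pm.nQuandle 3) Y ∧ HasCayleyGraph (torusGen24pm 3) v E ∧
      QuandleGenerates fun i => c (v i) := by
  have hn : ∀ i, Rack.act' (c (v i)) ^ 3 = 1 := fun i => Equiv.ext fun y => by
    obtain ⟨w, rfl⟩ := hc.2 y
    rw [← wordAct_replicate (fun i => c (v i)), wordAct_eq_wordTarget hE, hpow]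
    rfl
  have hW : ∀ i, (c (v i) ◃ c (v (i + 1))) ◃ (c (v (i + 1)) ◃ c (v i)) = c (v i) := fun i => by
    refine (wordAct_pmWord (x := fun i => c (v i)) hn i _).symm.trans ?_
    rw [wordAct_eq_wordTarget hE]
    exact congrArg c (hpts (pmWord i, i, i)
      (List.mem_flatMap.2 ⟨i, List.mem_finRange _, by simp⟩))
  let y : ZMod 4 → Y := ![c (v 0), c (v 0) ◃ c (v 1), c (v 1) ◃ c (v 0), c (v 1)]
  obtain ⟨f, hf⟩ := (torusLink 2 4).exists_hom_reverse
    ((torusLink 2 4).component (torusStrand 2 4 Nat.one_lt_two 0 1)) 3 (fun a => y a.1) (by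
      refine torusLink_two_arc_cases fun i => ?_
      change twoStrandArc 4 i ∉ _ → y (i + 1) = y i ◃ y (i - 1)
      rw [mem_component_b_iff]
      rcases (by revert i; decide : i = 0 ∨ i = 1 ∨ i = 2 ∨ i = 3) with rfl | rfl | rfl | rfl
      · exact fun _ => rfl
      · exact fun h => absurd (Or.inl rfl) h
      · exact fun _ => (hW 1).symm
      · exact fun h => absurd (Or.inr rfl) h) (by
      refine torusLink_two_arc_cases fun i => ?_
      change twoStrandArc 4 i ∈ _ → y (i - 1) = y i ◃ y (i + 1)
      rw [mem_component_b_iff]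
      rcases (by revert i; decide : i = 0 ∨ i = 1 ∨ i = 2 ∨ i = 3) with rfl | rfl | rfl | rfl
      · exact fun h => absurd h (by decide)
      · exact fun _ => (hW 0).symm
      · exact fun h => absurd h (by decide)
      · exact fun _ => rfl) (by
      refine torusLink_two_arc_cases fun i => ?_
      change Rack.act' (y i) ^ 3 = 1
      rcases (by revert i; decide : i = 0 ∨ i = 1 ∨ i = 2 ∨ i = 3) with rfl | rfl | rfl | rfl
      · exact hn 0
      · exact act'_act_pow (hn 1) _
      · exact act'_act_pow (hn 0) _
      · exact hn 1)
  obtain ⟨e, he, heE, hfe⟩ := exists_equiv_of_complete h (generates_torusGen24pm 3)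
    (fun r hr => by
      simp only [pmPoints, List.mem_flatMap, List.mem_cons, List.not_mem_nil, or_false] at hr
      obtain ⟨i, -, rfl | rfl⟩ := hr
      · exact Quandle.fix
      · exact wordAct_pmWord_torusGen24pm i)
    (fun r hr => pmRelators_sound hr) f hc.1 hv
    (Fin.forall_fin_two.2 ⟨hf (twoStrandArc 4 0), hf (twoStrandArc 4 3)⟩) hE
  have hgen : QuandleGenerates fun i => c (v i) := by
    have h := (generates_torusGen24pm 3).map f fun y => by
      obtain ⟨w, rfl⟩ := hc.2 y
      exact ⟨e.symm w, (hfe _).trans (congrArg c (e.apply_symm_apply w))⟩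
    have hfun : (fun i => f (torusGen24pm 3 i)) = fun i => c (v i) :=
      funext fun i => (hfe _).trans (congrArg c (he i))
    exact (congrArg QuandleGenerates hfun).mp h
  refine ⟨⟨e.trans (Equiv.ofBijective c hc), fun x y => ?_⟩, ⟨e, fun i => ⟨he i, heE i⟩⟩, hgen⟩
  change c (e (x ◃ y)) = c (e x) ◃ c (e y)
  rw [← hfe, ← hfe, ← hfe]
  exact f.map_act

end QuandleEnum

/-! ### Quandles from group actions -/

theorem normal_closure_of_conj_mem {G : Type} [Group G] {s : Set G}
    (h : ∀ g, ∀ x ∈ s, g * x * g⁻¹ ∈ s) : (Subgroup.closure s).Normal := by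
  have hs : Group.conjugatesOfSet s = s := by
    refine Set.Subset.antisymm (fun y hy => ?_) Group.subset_conjugatesOfSet
    obtain ⟨x, hx, hxy⟩ := Group.mem_conjugatesOfSet_iff.1 hy
    obtain ⟨g, rfl⟩ := isConj_iff.1 hxy
    exact h g x hx
  rw [← hs]
  exact Subgroup.normalClosure_normal

/-- An augmented quandle: a subset `carrier` of a set `X` on which a group `A` acts, and an
equivariant map `sym` to `A` such that `sym x` fixes `x`. The values of `sym` outside of `carrier`
are irrelevant. -/
structure AugmentedQuandle (A X : Type) [Group A] where
  /-- the action -/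
  act : A →* Equiv.Perm X
  /-- the element of the group that gives the point symmetry -/
  sym : X → A
  /-- the set of elements of the quandle -/
  carrier : Set X
  act_mem : ∀ g x, x ∈ carrier → act g x ∈ carrier
  sym_act : ∀ g x, x ∈ carrier → sym (act g x) = g * sym x * g⁻¹
  act_sym : ∀ x ∈ carrier, act (sym x) x = x

namespace AugmentedQuandle

variable {A X : Type} [Group A] (a : AugmentedQuandle A X)

/-- The action of `A` on the elements of the quandle. -/
def carrierAct (g : A) (x : a.carrier) : a.carrier := ⟨a.act g x, a.act_mem g x x.2⟩

theorem carrierAct_mul (g h : A) (x : a.carrier) :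
    a.carrierAct (g * h) x = a.carrierAct g (a.carrierAct h x) :=
  Subtype.ext (by simp [carrierAct])

theorem carrierAct_one (x : a.carrier) : a.carrierAct 1 x = x :=
  Subtype.ext (by simp [carrierAct])

theorem carrierAct_inv_left (g : A) (x : a.carrier) :
    a.carrierAct g⁻¹ (a.carrierAct g x) = x := by
  rw [← carrierAct_mul, inv_mul_cancel, carrierAct_one]

theorem carrierAct_inv_right (g : A) (x : a.carrier) :
    a.carrierAct g (a.carrierAct g⁻¹ x) = x := by
  rw [← carrierAct_mul, mul_inv_cancel, carrierAct_one]

theorem sym_carrierAct (g : A) (x : a.carrier) :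
    a.sym (a.carrierAct g x) = g * a.sym x * g⁻¹ :=
  a.sym_act g x x.2

theorem carrierAct_sym (g : A) (x y : a.carrier) :
    a.carrierAct g (a.carrierAct (a.sym x) y) =
      a.carrierAct (a.sym (a.carrierAct g x)) (a.carrierAct g y) := by
  rw [sym_carrierAct, ← carrierAct_mul, ← carrierAct_mul, inv_mul_cancel_right]

instance instQuandle : Quandle a.carrier where
  act x y := a.carrierAct (a.sym x) y
  invAct x y := a.carrierAct (a.sym x)⁻¹ y
  self_distrib := a.carrierAct_sym _ _ _
  left_inv _ y := a.carrierAct_inv_left _ y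
  right_inv _ y := a.carrierAct_inv_right _ y
  fix {x} := Subtype.ext (a.act_sym x x.2)

/-- The group acts by automorphisms. -/
def autHom : A →* quandleAut a.carrier where
  toFun g := ⟨⟨a.carrierAct g, a.carrierAct g⁻¹, a.carrierAct_inv_left g,
    a.carrierAct_inv_right g⟩, a.carrierAct_sym g⟩
  map_one' := Subtype.ext (Equiv.ext a.carrierAct_one)
  map_mul' g h := Subtype.ext (Equiv.ext (a.carrierAct_mul g h))

theorem autHom_sym (x : a.carrier) : a.autHom (a.sym x) = pointSymmetry x :=
  rfl

theorem normal_closure_sym :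
    (Subgroup.closure (Set.range fun x : a.carrier => a.sym x)).Normal := by
  refine normal_closure_of_conj_mem ?_
  rintro g _ ⟨x, rfl⟩
  exact ⟨a.carrierAct g x, a.sym_carrierAct g x⟩

theorem normal_closure_sym_mul_inv :
    (Subgroup.closure {g | ∃ x y : a.carrier, g = a.sym x * (a.sym y)⁻¹}).Normal := by
  refine normal_closure_of_conj_mem ?_
  rintro g _ ⟨x, y, rfl⟩
  refine ⟨a.carrierAct g x, a.carrierAct g y, ?_⟩
  rw [sym_carrierAct, sym_carrierAct]
  group

end AugmentedQuandle

/-! ### Bounds for automorphism groups -/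

namespace QuandleEnum

variable {p N : ℕ}

/-- The value at `(x, y)` of the operation with code `T`, a table written in base `N`. -/
def opAt (N T x y : ℕ) : ℕ := T / N ^ (N * x + y) % N

/-- The code of the operation of a quandle with given graph: the point symmetry at `E i w` is the
conjugate by `E i` of the one at `w`. -/
def opCode (E : Fin p → ℕ → ℕ) (N : ℕ) : ℕ :=
  iter (fun T w => T + N ^ (N * w) *
      if h : w < p then iter (fun K y => K + E ⟨w, h⟩ y * N ^ y) (List.range N) 0
      else match parent E w with
        | none => 0
        | some e =>
          iter (fun K y => K + E e.1 (opAt N T e.2 y) * N ^ E e.1 y) (List.range N) 0)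
    (List.range N) 0

/-- Whether the operation with code `T` is equivariant and extends the graph. -/
def isOpCode (E : Fin p → ℕ → ℕ) (N T : ℕ) : Bool :=
  (List.finRange p).all fun i => (List.range N).all fun y =>
    opAt N T i y == E i y &&
    (List.range N).all fun x => opAt N T (E i x) (E i y) == E i (opAt N T x y)

/-- The result of the action of a word in the elements of the list `l`, the first letter acting
first. -/
def wordOp (N T : ℕ) (l : List ℕ) : List (Fin p) → ℕ → ℕ
  | [], y => y
  | i :: u, y => forced (opAt N T (l.getD i 0) y) (wordOp N T l u)

/-- Whether an equation holds for the elements of the list `l`. -/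
def holds (N T : ℕ) (l : List ℕ) (r : List (Fin p) × Fin p × Fin p) : Bool :=
  wordOp N T l r.1 (l.getD r.2.1 0) == l.getD r.2.2 0

/-- The lists of length `k` of numbers less than `N`. -/
def tuples (N : ℕ) : ℕ → List (List ℕ)
  | 0 => [[]]
  | k + 1 => (List.range N).flatMap fun t => (tuples N k).map fun l => t :: l

/-- The lists that begin with the vertex `0` and satisfy the same of the equations in `tests` as
the list of the generators. -/
def candidates (N T : ℕ) (tests : List (List (Fin p) × Fin p × Fin p)) : List (List ℕ) :=
  (tuples N (p - 1)).filter fun l =>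
    tests.all fun r => holds N T (0 :: l) r == holds N T (List.range p) r

/-- There are at most `m` possibilities for the images of the generators under an automorphism that
fixes the first one. -/
def autBound (E : Fin p → Fin N → Fin N) (tests : List (List (Fin p) × Fin p × Fin p))
    (m : ℕ) : Bool :=
  forced (graphCode E) fun G => forced (opCode (p := p) (target N G) N) fun T =>
    (List.finRange N).all (fun w => (List.finRange p).all fun i => target N G i w == E i w) &&
    isOpCode (p := p) (target N G) N T && Nat.ble (candidates N T tests).length m

theorem mem_tuples {k : ℕ} {l : List ℕ} (hl : l.length = k) (h : ∀ t ∈ l, t < N) :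
    l ∈ tuples N k := by
  induction k generalizing l with
  | zero =>
    rw [List.length_eq_zero_iff.1 hl]
    exact List.mem_cons_self
  | succ k ih =>
    obtain ⟨t, l, rfl⟩ := List.exists_cons_of_length_eq_add_one hl
    simp only [tuples, List.mem_flatMap, List.mem_map, List.mem_range]
    exact ⟨t, h t List.mem_cons_self, l,
      ih (by simpa using hl) fun s hs => h s (List.mem_cons_of_mem t hs), rfl⟩

variable {Y : Type} [Quandle Y] {E : Fin p → Fin N → Fin N} {v : Fin p → Fin N} {c : Fin N → Y}

/-- An operation that is equivariant under the point symmetries of the generators and agrees with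
the graph is that of the quandle. -/
theorem act_eq_opAt {G T : ℕ} (hG : ∀ i (w : Fin N), target N G i w = E i w)
    (hT : isOpCode (p := p) (target N G) N T = true)
    (hx : QuandleGenerates fun i => c (v i)) (hc : Function.Bijective c)
    (hv : ∀ i, (v i : ℕ) = i) (hE : ∀ i w, c (v i) ◃ c w = c (E i w)) (x y : Fin N) :
    c x ◃ c y = c ⟨opAt N T x y, Nat.mod_lt _ x.pos⟩ := by
  simp only [isOpCode, List.all_eq_true, List.mem_finRange, List.mem_range, true_imp_iff,
    Bool.and_eq_true, beq_iff_eq] at hT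
  have hEsurj : ∀ i, Function.Surjective (E i) := fun i => by
    refine Finite.injective_iff_surjective.1 fun w w' hw => ?_
    have := congrArg c hw
    rw [← hE, ← hE, Rack.left_cancel] at this
    exact hc.1 this
  let M : Fin N → Fin N → Fin N := fun x y => ⟨opAt N T x y, Nat.mod_lt _ x.pos⟩
  have hM : ∀ i x y, M (E i x) (E i y) = E i (M x y) := fun i x y => by
    refine Fin.ext ?_
    have := (hT i y y.2).2 x x.2
    rw [hG, hG] at this
    exact this.trans (hG i (M x y))
  refine hx (fun z => ∀ x, c x = z → ∀ y, z ◃ c y = c (M x y)) (fun i x h y => ?_)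
    (fun i z => ?_) (c x) x rfl y
  · obtain rfl := hc.1 h
    rw [hE]
    refine congrArg c (Fin.ext ?_)
    rw [← hG, ← (hT i y y.2).1, ← hv i]
  · obtain ⟨w, rfl⟩ := hc.2 z
    rw [hE]
    constructor
    · intro h x hxw y
      obtain rfl := hc.1 hxw
      obtain ⟨y, rfl⟩ := hEsurj i y
      rw [hM, ← hE, ← hE, ← hE, ← h w rfl y]
      exact Shelf.self_distrib.symm
    · intro h x hxw y
      obtain rfl := hc.1 hxw
      refine (Rack.left_cancel (c (v i))).1 ?_
      rw [hE, ← hM, ← h _ rfl, Shelf.self_distrib, hE, hE]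

/-- Endomorphisms commute with the action of words. -/
theorem wordOp_map {T : ℕ} {F : Fin N → Fin N}
    (hF : ∀ x y : Fin N, (F ⟨opAt N T x y, Nat.mod_lt _ x.pos⟩ : ℕ) = opAt N T (F x) (F y))
    {l l' : List ℕ} (hl : ∀ i : Fin p, l.getD i 0 = v i)
    (hl' : ∀ i : Fin p, l'.getD i 0 = F (v i)) :
    ∀ (u : List (Fin p)) (y : Fin N),
      ∃ z : Fin N, wordOp N T l u y = z ∧ wordOp N T l' u (F y) = F z
  | [], y => ⟨y, rfl, rfl⟩
  | i :: u, y => by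
    simp only [wordOp, forced_eq, hl, hl']
    rw [← hF]
    exact wordOp_map hF hl hl' u ⟨opAt N T (v i) y, Nat.mod_lt _ y.pos⟩

theorem getD_range_map (f : ℕ → ℕ) {n i : ℕ} (hi : i < n) :
    ((List.range n).map f).getD i 0 = f i := by
  simp [List.getD, hi]

/-- The orbit of the first generator has at most `N` elements, and the automorphisms in its
stabilizer are determined by the images of the other generators, which are among the
candidates. -/
theorem card_quandleAut_le {tests : List (List (Fin p) × Fin p × Fin p)} {m : ℕ} [NeZero p]
    (h : autBound E tests m = true) (hx : QuandleGenerates fun i => c (v i))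
    (hc : Function.Bijective c) (hv : ∀ i, (v i : ℕ) = i)
    (hE : ∀ i w, c (v i) ◃ c w = c (E i w)) : Nat.card (quandleAut Y) ≤ N * m := by
  rw [autBound, forced_eq, forced_eq] at h
  generalize opCode (target (p := p) N (graphCode E)) N = T at h
  generalize graphCode E = G at h
  simp only [Bool.and_eq_true, List.all_eq_true, beq_iff_eq, List.mem_finRange, true_imp_iff,
    Nat.ble_eq] at h
  obtain ⟨⟨hG, hT⟩, hm⟩ := h
  have hop := act_eq_opAt (fun i w => hG w i) hT hx hc hv hE
  have : Finite Y := Finite.of_surjective c hc.2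
  have hp : 0 < p := Nat.pos_of_ne_zero (NeZero.ne p)
  let e := Equiv.ofBijective c hc
  have he : ∀ y, c (e.symm y) = y := e.apply_symm_apply
  let F : quandleAut Y → Fin N → Fin N := fun f w => e.symm (f.1 (c w))
  have hcF : ∀ f w, c (F f w) = f.1 (c w) := fun f w => he _
  have hF : ∀ f (x y : Fin N),
      (F f ⟨opAt N T x y, Nat.mod_lt _ x.pos⟩ : ℕ) = opAt N T (F f x) (F f y) := fun f x y => by
    have := hop (F f x) (F f y)
    rw [hcF, hcF, ← f.2, hop, ← hcF] at this
    exact congrArg Fin.val (hc.1 this)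
  have hFinj : ∀ f, Function.Injective (F f) := fun f =>
    e.symm.injective.comp (f.1.injective.comp hc.1)
  let tail : quandleAut Y → List ℕ := fun f =>
    (List.range (p - 1)).map fun j => if hj : j + 1 < p then (F f (v ⟨j + 1, hj⟩) : ℕ) else 0
  let St := MulAction.stabilizer (quandleAut Y) (c (v 0))
  have hget : ∀ f ∈ St, ∀ i : Fin p, (0 :: tail f).getD i 0 = F f (v i) := by
    intro f hf i
    obtain ⟨i, hi⟩ := i
    cases i with
    | zero =>
      have h0 : F f (v 0) = v 0 := hc.1 ((hcF f _).trans hf)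
      have h1 : (⟨0, hi⟩ : Fin p) = 0 := Fin.ext (by simp)
      rw [h1, h0, hv]
      rfl
    | succ j =>
      refine (getD_range_map _ (i := j) (n := p - 1) (by omega)).trans ?_
      rw [dif_pos hi]
  have hbase : ∀ i : Fin p, (List.range p).getD i 0 = v i := fun i => by
    rw [hv]
    simp
  have hmem : ∀ f ∈ St, tail f ∈ candidates N T tests := by
    intro f hf
    refine List.mem_filter.2 ⟨mem_tuples (by simp [tail]) fun t ht => ?_, ?_⟩
    · obtain ⟨j, hj, rfl⟩ := List.mem_map.1 ht
      have hj' : j + 1 < p := by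
        have := List.mem_range.1 hj
        omega
      rw [dif_pos hj']
      exact Fin.is_lt _
    · rw [List.all_eq_true]
      rintro ⟨u, i, j⟩ -
      obtain ⟨z, hz, hz'⟩ := wordOp_map (hF f) hbase (hget f hf) u (v i)
      simp only [holds, hbase, hget f hf, hz, hz', beq_iff_eq]
      rw [Bool.eq_iff_iff, beq_iff_eq, beq_iff_eq, ← Fin.ext_iff, ← Fin.ext_iff]
      exact (hFinj f).eq_iff
  have hSt : Nat.card St ≤ m := by
    let g : St → (candidates N T tests).toFinset := fun f =>
      ⟨tail f, List.mem_toFinset.2 (hmem f f.2)⟩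
    have hg : Function.Injective g := by
      intro f f' hff
      refine Subtype.ext (hx.perm_ext fun i => ?_)
      have h1 := congrArg (fun l : List ℕ => (0 :: l).getD i 0) (congrArg Subtype.val hff)
      have h2 : F f (v i) = F f' (v i) :=
        Fin.ext ((hget f f.2 i).symm.trans (h1.trans (hget f' f'.2 i)))
      have h3 := congrArg c h2
      rwa [hcF, hcF] at h3
    refine (Nat.card_le_card_of_injective g hg).trans ?_
    rw [Nat.card_eq_fintype_card, Fintype.card_coe]
    exact (List.toFinset_card_le _).trans hm
  calc Nat.card (quandleAut Y) = St.index * Nat.card St := (St.index_mul_card).symm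
    _ ≤ N * m := by
      refine Nat.mul_le_mul ?_ hSt
      rw [MulAction.index_stabilizer]
      refine (Set.ncard_le_card _).trans ?_
      rw [Nat.card_congr e.symm, Nat.card_fin]

end QuandleEnum

namespace AugmentedQuandle

/-! ### Computations in augmented quandles -/

variable {A X : Type} [Group A]

/-- The elements `c w` are those of the quandle, each of them once, and `E` is the Cayley graph
with respect to the elements `c (v i)`. -/
structure HasGraph (a : AugmentedQuandle A X) {p N : ℕ} (v : Fin p → Fin N)
    (E : Fin p → Fin N → Fin N) (c : Fin N → X) : Prop where
  mem : ∀ w, c w ∈ a.carrier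
  injective : Function.Injective c
  surjective : ∀ x ∈ a.carrier, ∃ w, c w = x
  act_eq : ∀ i w, a.act (a.sym (c (v i))) (c w) = c (E i w)

namespace HasGraph

variable {a : AugmentedQuandle A X} {p N : ℕ} {v : Fin p → Fin N} {E : Fin p → Fin N → Fin N}
  {c : Fin N → X}

theorem bijective (h : a.HasGraph v E c) :
    Function.Bijective fun w => (⟨c w, h.mem w⟩ : a.carrier) :=
  ⟨fun _ _ hw => h.injective (congrArg Subtype.val hw), fun x =>
    (h.surjective x x.2).imp fun _ hw => Subtype.ext hw⟩

theorem range_sym (h : a.HasGraph v E c) :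
    (Set.range fun x : a.carrier => a.sym x) = Set.range fun w => a.sym (c w) := by
  ext g
  constructor
  · rintro ⟨x, rfl⟩
    obtain ⟨w, hw⟩ := h.surjective x x.2
    exact ⟨w, congrArg a.sym hw⟩
  · rintro ⟨w, rfl⟩
    exact ⟨⟨c w, h.mem w⟩, rfl⟩

theorem setOf_sym_mul_inv (h : a.HasGraph v E c) :
    {g | ∃ x y : a.carrier, g = a.sym x * (a.sym y)⁻¹} =
      {g | ∃ w w', g = a.sym (c w) * (a.sym (c w'))⁻¹} := by
  ext g
  constructor
  · rintro ⟨x, y, rfl⟩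
    obtain ⟨w, hw⟩ := h.surjective x x.2
    obtain ⟨w', hw'⟩ := h.surjective y y.2
    exact ⟨w, w', by rw [hw, hw']⟩
  · rintro ⟨w, w', rfl⟩
    exact ⟨⟨c w, h.mem w⟩, ⟨c w', h.mem w'⟩, rfl⟩

/-- A faithful action of a group whose order equals the bound of the enumeration gives the
automorphism group. -/
theorem hasQuandleData (h : a.HasGraph v E c) [NeZero p] (hv : ∀ i, (v i : ℕ) = i)
    (hx : QuandleGenerates fun i => (⟨c (v i), h.mem (v i)⟩ : a.carrier))
    {tests : List (List (Fin p) × Fin p × Fin p)} {m : ℕ}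
    (hbound : QuandleEnum.autBound E tests m = true) (hcard : Nat.card A = N * m)
    (hfaithful : ∀ g, (∀ i, a.act g (c (v i)) = c (v i)) → g = 1)
    {I T : Type} [Group I] [Group T]
    (θI : I →* A) (hθI : Function.Injective θI)
    (hI : Subgroup.closure (Set.range fun w => a.sym (c w)) = θI.range)
    (θT : T →* A) (hθT : Function.Injective θT)
    (hT : Subgroup.closure {g | ∃ w w', g = a.sym (c w) * (a.sym (c w'))⁻¹} = θT.range) :
    HasQuandleData a.carrier N A I T := by
  have hbij := h.bijective
  have hcardX : Nat.card a.carrier = N := by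
    rw [← Nat.card_congr (Equiv.ofBijective _ hbij), Nat.card_fin]
  have : Finite a.carrier := Finite.of_surjective _ hbij.2
  have hinj : Function.Injective a.autHom := by
    rw [injective_iff_map_eq_one]
    refine fun g hg => hfaithful g fun i => ?_
    have := Equiv.congr_fun (congrArg Subtype.val hg) ⟨c (v i), h.mem (v i)⟩
    exact congrArg Subtype.val this
  have hle : Nat.card (quandleAut a.carrier) ≤ Nat.card A := by
    rw [hcard]
    exact QuandleEnum.card_quandleAut_le hbound hx hbij hv fun i w =>
      Subtype.ext (h.act_eq i w)
  have : Finite A := Finite.of_injective _ hinj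
  refine hasQuandleData_of_bijective hcardX a.autHom
    ((Nat.bijective_iff_injective_and_card _).2
      ⟨hinj, le_antisymm (Nat.card_le_card_of_injective _ hinj) hle⟩)
    (fun x => a.sym x) a.autHom_sym θI hθI ?_ θT hθT ?_
  · rw [h.range_sym, hI]
  · rw [h.setOf_sym_mul_inv, hT]

/-- The data of the `n`-quandle of a torus link, from an augmented quandle with the same graph. The
number `k` of rounds has to suffice for the enumeration, and the equations `tests` have to be
such that at most `m` tuples of elements, beginning with the first generator, satisfy
the same of them as the generators. -/
theorem torusLink (h : a.HasGraph v E c) [NeZero p] {q n : ℕ} [NeZero q] (hp : 1 < p)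
    (hv : ∀ i, (v i : ℕ) = i) {k : ℕ}
    (hcomplete : QuandleEnum.complete E (QuandleEnum.torusPoints p q)
      (QuandleEnum.torusRelators p q n) k = true)
    (hpts : ∀ r ∈ QuandleEnum.torusPoints p q,
      QuandleEnum.wordTarget E r.1 (v r.2.1) = v r.2.2)
    (hpow : ∀ i w, QuandleEnum.wordTarget E (List.replicate n i) w = w)
    {tests : List (List (Fin p) × Fin p × Fin p)} {m : ℕ}
    (hbound : QuandleEnum.autBound E tests m = true) (hcard : Nat.card A = N * m)
    (hfaithful : ∀ g, (∀ i, a.act g (c (v i)) = c (v i)) → g = 1)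
    {I T : Type} [Group I] [Group T]
    (θI : I →* A) (hθI : Function.Injective θI)
    (hI : Subgroup.closure (Set.range fun w => a.sym (c w)) = θI.range)
    (θT : T →* A) (hθT : Function.Injective θT)
    (hT : Subgroup.closure {g | ∃ w w', g = a.sym (c w) * (a.sym (c w'))⁻¹} = θT.range) :
    HasQuandleData ((_root_.torusLink p q).nQuandle n) N A I T ∧
      HasCayleyGraph (torusGen p q n hp) v E := by
  obtain ⟨hiso, hgraph, hx⟩ := QuandleEnum.torus_quandleIso_and_cayleyGraph hp hcomplete hv hpts
    hpow h.bijective fun i w => Subtype.ext (h.act_eq i w)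
  exact ⟨HasQuandleData.of_iso hiso (h.hasQuandleData hv hx hbound hcard hfaithful θI hθI hI
    θT hθT hT), hgraph⟩

/-- The data of `Q_3(T_{2,4}^{+-})`, from an augmented quandle with the same graph. -/
theorem torusLink24pm {v : Fin 2 → Fin N} {E : Fin 2 → Fin N → Fin N} (h : a.HasGraph v E c)
    (hv : ∀ i, (v i : ℕ) = i) {k : ℕ}
    (hcomplete : QuandleEnum.complete E QuandleEnum.pmPoints QuandleEnum.pmRelators k = true)
    (hpts : ∀ r ∈ QuandleEnum.pmPoints, QuandleEnum.wordTarget E r.1 (v r.2.1) = v r.2.2)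
    (hpow : ∀ i w, QuandleEnum.wordTarget E (List.replicate 3 i) w = w)
    {tests : List (List (Fin 2) × Fin 2 × Fin 2)} {m : ℕ}
    (hbound : QuandleEnum.autBound E tests m = true) (hcard : Nat.card A = N * m)
    (hfaithful : ∀ g, (∀ i, a.act g (c (v i)) = c (v i)) → g = 1)
    {I T : Type} [Group I] [Group T]
    (θI : I →* A) (hθI : Function.Injective θI)
    (hI : Subgroup.closure (Set.range fun w => a.sym (c w)) = θI.range)
    (θT : T →* A) (hθT : Function.Injective θT)
    (hT : Subgroup.closure {g | ∃ w w', g = a.sym (c w) * (a.sym (c w'))⁻¹} = θT.range) :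
    HasQuandleData (_root_.torusLink24pm.nQuandle 3) N A I T ∧
      HasCayleyGraph (torusGen24pm 3) v E := by
  obtain ⟨hiso, hgraph, hx⟩ := QuandleEnum.torus24pm_quandleIso_and_cayleyGraph hcomplete hv hpts
    hpow h.bijective fun i w => Subtype.ext (h.act_eq i w)
  exact ⟨HasQuandleData.of_iso hiso (h.hasQuandleData hv hx hbound hcard hfaithful θI hθI hI
    θT hθT hT), hgraph⟩

/-- As `A_5` is simple, a nontrivial normal subgroup of a group that lies in the image of `A_5` is
the whole image. -/
theorem eq_range_of_normal {H : Subgroup A} (hH : H.Normal) (θ : AltGrp 5 →* A)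
    (hle : H ≤ θ.range) {x : A} (hx : x ∈ H) (hx1 : x ≠ 1) : H = θ.range := by
  refine le_antisymm hle ?_
  have : IsSimpleGroup (AltGrp 5) := alternatingGroup.isSimpleGroup (by simp)
  rcases (hH.comap θ).eq_bot_or_eq_top with h | h
  · obtain ⟨t, rfl⟩ := hle hx
    have ht : t ∈ H.comap θ := hx
    rw [h, Subgroup.mem_bot] at ht
    exact absurd (by rw [ht, map_one]) hx1
  · rintro _ ⟨t, rfl⟩
    have ht : t ∈ H.comap θ := h ▸ Subgroup.mem_top t
    exact ht

/-- The symmetries generate the image of `A_5` if they lie in it and one of them is not trivial. -/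
theorem closure_sym_eq_range (h : a.HasGraph v E c) (θ : AltGrp 5 →* A)
    (hθ : ∀ w, a.sym (c w) ∈ θ.range) {w : Fin N} (hw : a.sym (c w) ≠ 1) :
    Subgroup.closure (Set.range fun w => a.sym (c w)) = θ.range := by
  have hn := a.normal_closure_sym
  rw [h.range_sym] at hn
  refine eq_range_of_normal hn θ ?_ (Subgroup.subset_closure ⟨w, rfl⟩) hw
  rw [Subgroup.closure_le]
  rintro _ ⟨w, rfl⟩
  exact hθ w

/-- The quotients of symmetries generate the image of `A_5` if the symmetries lie in it and
two of them are different. -/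
theorem closure_sym_mul_inv_eq_range (h : a.HasGraph v E c) (θ : AltGrp 5 →* A)
    (hθ : ∀ w, a.sym (c w) ∈ θ.range) {w w' : Fin N} (hw : a.sym (c w) ≠ a.sym (c w')) :
    Subgroup.closure {g | ∃ w w', g = a.sym (c w) * (a.sym (c w'))⁻¹} = θ.range := by
  have hn := a.normal_closure_sym_mul_inv
  rw [h.setOf_sym_mul_inv] at hn
  refine eq_range_of_normal hn θ ?_ (Subgroup.subset_closure ⟨w, w', rfl⟩)
    (mul_inv_eq_one.not.2 hw)
  rw [Subgroup.closure_le]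
  rintro _ ⟨w, w', rfl⟩
  exact mul_mem (hθ w) (inv_mem (hθ w'))

end HasGraph

/-- A criterion that can be evaluated: every element of the image is the product of two of the
elements `γ w * (γ w₀)⁻¹`. -/
theorem closure_mul_inv_eq_range {N : ℕ} {γ : Fin N → A} {T : Type} [Group T] {θ : T →* A}
    (w₀ : Fin N) (h : ∀ w, ∃ t, θ t = γ w * (γ w₀)⁻¹)
    (h' : ∀ t, ∃ w w', θ t = γ w * (γ w₀)⁻¹ * (γ w' * (γ w₀)⁻¹)) :
    Subgroup.closure {g | ∃ w w', g = γ w * (γ w')⁻¹} = θ.range := by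
  refine le_antisymm ?_ ?_
  · rw [Subgroup.closure_le]
    rintro _ ⟨w, w', rfl⟩
    obtain ⟨t, ht⟩ := h w
    obtain ⟨t', ht'⟩ := h w'
    exact ⟨t * t'⁻¹, by rw [map_mul, map_inv, ht, ht']; group⟩
  · rintro _ ⟨t, rfl⟩
    obtain ⟨w, w', ht⟩ := h' t
    rw [ht]
    exact mul_mem (Subgroup.subset_closure ⟨w, w₀, rfl⟩) (Subgroup.subset_closure ⟨w', w₀, rfl⟩)

/-- A criterion that can be evaluated: up to a power of `γ w₀`, every element of the image is
the product of two of the elements `γ w * (γ w₀)⁻¹`. -/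
theorem closure_range_eq_range {N : ℕ} {γ : Fin N → A} {I : Type} [Group I] {θ : I →* A}
    (n : ℕ) (w₀ : Fin N) (h : ∀ w, ∃ t, θ t = γ w)
    (h' : ∀ t, ∃ k < n, ∃ w w', θ t = γ w₀ ^ k * (γ w * (γ w₀)⁻¹ * (γ w' * (γ w₀)⁻¹))) :
    Subgroup.closure (Set.range γ) = θ.range := by
  have hmem : ∀ w, γ w ∈ Subgroup.closure (Set.range γ) := fun w =>
    Subgroup.subset_closure ⟨w, rfl⟩
  refine le_antisymm ?_ ?_
  · rw [Subgroup.closure_le]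
    rintro _ ⟨w, rfl⟩
    exact h w
  · rintro _ ⟨t, rfl⟩
    obtain ⟨k, -, w, w', ht⟩ := h' t
    rw [ht]
    exact mul_mem (pow_mem (hmem _) k) (mul_mem (mul_mem (hmem _) (inv_mem (hmem _)))
      (mul_mem (hmem _) (inv_mem (hmem _))))

/-! ### The augmented quandles of the finite cases -/

/-- The conjugation quandle on a union of conjugacy classes of a group. -/
def conj (G : Type) [Group G] (S : Set G) (hS : ∀ g, ∀ x ∈ S, g * x * g⁻¹ ∈ S) :
    AugmentedQuandle G G where
  act := (MulAut.toPerm G).comp MulAut.conj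
  sym x := x
  carrier := S
  act_mem := hS
  sym_act _ _ _ := rfl
  act_sym x _ := mul_inv_cancel_right x x

/-- The action of the group of order two by an involution. -/
def involutionHom {X : Type} (σ : Equiv.Perm X) (hσ : σ * σ = 1) : Cyc 2 →* Equiv.Perm X where
  toFun s := if s = 1 then 1 else σ
  map_one' := rfl
  map_mul' s t := by
    rcases (by revert s; decide : s = 1 ∨ s = .ofAdd 1) with rfl | rfl <;>
      rcases (by revert t; decide : t = 1 ∨ t = .ofAdd 1) with rfl | rfl
    · rfl
    · rfl
    · rfl
    · exact hσ.symm

/-- The elements of order four of a group, with the conjugation by squares as quandle operation.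
The automorphism that inverts all of them is that of the group of order two. -/
def squares (G : Type) [Group G] : AugmentedQuandle (Cyc 2 × G) G where
  act := (involutionHom (Equiv.inv G) (Equiv.ext inv_inv)).noncommCoprod
    ((MulAut.toPerm G).comp MulAut.conj) fun s g => by
      rcases (by revert s; decide : s = 1 ∨ s = .ofAdd 1) with rfl | rfl
      · exact Commute.one_left _
      · exact Equiv.ext fun x => (map_inv (MulAut.conj g) x).symm
  sym x := (1, x ^ 2)
  carrier := {x | x ^ 4 = 1 ∧ x ^ 2 ≠ 1}
  act_mem := by
    rintro ⟨s, g⟩ x ⟨h4, h2⟩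
    rcases (by revert s; decide : s = 1 ∨ s = .ofAdd 1) with rfl | rfl
    · change (g * x * g⁻¹) ^ 4 = 1 ∧ (g * x * g⁻¹) ^ 2 ≠ 1
      simpa [conj_pow, h4] using h2
    · change ((g * x * g⁻¹)⁻¹) ^ 4 = 1 ∧ ((g * x * g⁻¹)⁻¹) ^ 2 ≠ 1
      rw [inv_pow, inv_pow, inv_eq_one, Ne, inv_eq_one, conj_pow, conj_pow]
      simpa [h4] using h2
  sym_act := by
    rintro ⟨s, g⟩ x ⟨h4, -⟩
    rcases (by revert s; decide : s = 1 ∨ s = .ofAdd 1) with rfl | rfl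
    · exact Prod.ext (show (1 : Cyc 2) = 1 * 1 * 1⁻¹ by decide) conj_pow
    · refine Prod.ext (show (1 : Cyc 2) = .ofAdd 1 * 1 * (.ofAdd 1)⁻¹ by decide) ?_
      change ((g * x * g⁻¹)⁻¹) ^ 2 = g * x ^ 2 * g⁻¹
      rw [inv_pow, conj_pow, inv_eq_iff_mul_eq_one, conj_mul, ← pow_add, h4, mul_one,
        mul_inv_cancel]
  act_sym x _ := by
    change x ^ 2 * x * (x ^ 2)⁻¹ = x
    group

/-- The product of a conjugacy class with the trivial quandle with two elements. -/
def twoTimesConj (G : Type) [Group G] (S : Set G) (hS : ∀ g, ∀ x ∈ S, g * x * g⁻¹ ∈ S) :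
    AugmentedQuandle (Cyc 2 × G) (Cyc 2 × G) where
  act :=
    { toFun := fun g => (Equiv.mulLeft g.1).prodCongr (MulAut.toPerm G (MulAut.conj g.2))
      map_one' := by ext <;> simp
      map_mul' := fun g h => by ext <;> simp [mul_assoc] }
  sym x := (1, x.2)
  carrier := {x | x.2 ∈ S}
  act_mem g x hx := hS g.2 x.2 hx
  sym_act g x _ := Prod.ext (by simp) rfl
  act_sym x _ := Prod.ext (one_mul _) (mul_inv_cancel_right _ _)

/-- The pairs of distinct elements of a set. The point symmetry at `(x, y)` exchanges the elements
`x` and `y` and reverses the order of all pairs. -/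
def orderedPairs (α : Type) [DecidableEq α] :
    AugmentedQuandle (Cyc 2 × Equiv.Perm α) (α × α) where
  act := (involutionHom (Equiv.prodComm α α) rfl).noncommCoprod
    { toFun := fun g => g.prodCongr g
      map_one' := rfl
      map_mul' := fun _ _ => rfl } fun s g => by
      rcases (by revert s; decide : s = 1 ∨ s = .ofAdd 1) with rfl | rfl
      · exact Commute.one_left _
      · rfl
  sym x := (.ofAdd 1, Equiv.swap x.1 x.2)
  carrier := {x | x.1 ≠ x.2}
  act_mem := by
    rintro ⟨s, g⟩ ⟨x, y⟩ h
    rcases (by revert s; decide : s = 1 ∨ s = .ofAdd 1) with rfl | rfl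
    · exact g.injective.ne h
    · exact g.injective.ne (Ne.symm h)
  sym_act := by
    rintro ⟨s, g⟩ ⟨x, y⟩ -
    rcases (by revert s; decide : s = 1 ∨ s = .ofAdd 1) with rfl | rfl
    · exact Prod.ext (show (.ofAdd 1 : Cyc 2) = 1 * .ofAdd 1 * 1⁻¹ by decide)
        (Equiv.swap_apply_apply g x y)
    · refine Prod.ext
        (show (.ofAdd 1 : Cyc 2) = .ofAdd 1 * .ofAdd 1 * (.ofAdd 1)⁻¹ by decide) ?_
      exact (Equiv.swap_comm _ _).trans (Equiv.swap_apply_apply g x y)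
  act_sym := by
    rintro ⟨x, y⟩ -
    exact Prod.ext (Equiv.swap_apply_right x y) (Equiv.swap_apply_left x y)

end AugmentedQuandle

/-! ### The finite cases -/

open QuandleEnum AugmentedQuandle

/-- The square of a permutation, as an element of the alternating group. -/
def evenSquare {m : ℕ} (σ : SymGrp m) : AltGrp m :=
  ⟨σ ^ 2, by rw [Equiv.Perm.mem_alternatingGroup, map_pow, Int.units_sq]⟩

/-- The conjugation quandle on a conjugacy class. -/
def conjClass {G : Type} [Group G] (x : G) : AugmentedQuandle G G :=
  AugmentedQuandle.conj G {y | IsConj x y} fun g _ hy => hy.trans (isConj_iff.2 ⟨g, rfl⟩)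

/-- The product of a conjugacy class with the trivial quandle with two elements. -/
def twoTimesClass {G : Type} [Group G] (x : G) : AugmentedQuandle (Cyc 2 × G) (Cyc 2 × G) :=
  twoTimesConj G {y | IsConj x y} fun g _ hy => hy.trans (isConj_iff.2 ⟨g, rfl⟩)

/-- The conjugation quandle on the elements of order three. -/
def orderThree (G : Type) [Group G] : AugmentedQuandle G G :=
  AugmentedQuandle.conj G {x | x ^ 3 = 1 ∧ x ≠ 1} fun g x hx => by
    simpa [conj_pow, hx.1] using hx.2

/-- The conjugation quandle on the elements of order four. -/
def orderFour (G : Type) [Group G] : AugmentedQuandle G G :=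
  AugmentedQuandle.conj G {x | x ^ 4 = 1 ∧ x ^ 2 ≠ 1} fun g x hx => by
    simpa [conj_pow, hx.1] using hx.2

/-- The embedding of `ℤ/2 × ℤ/2` in the alternating group of degree four. -/
def kleinHom : Cyc 2 × Cyc 2 →* AltGrp 4 where
  toFun s := ⟨(if s.1 = 1 then 1 else Equiv.swap 0 1 * Equiv.swap 2 3) *
    (if s.2 = 1 then 1 else Equiv.swap 0 2 * Equiv.swap 1 3), by
      rw [Equiv.Perm.mem_alternatingGroup]
      revert s
      decide +kernel⟩
  map_one' := by decide +kernel
  map_mul' := by decide +kernel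

theorem kleinHom_injective : Function.Injective kleinHom := by
  decide +kernel

/-- The embedding of the symmetric group in its product with the group of order two, with the sign
as first component. -/
def withSign (m : ℕ) : SymGrp m →* Cyc 2 × SymGrp m :=
  MonoidHom.prod
    ((show ℤˣ →* Cyc 2 from
      { toFun := fun u => if u = 1 then 1 else .ofAdd 1
        map_one' := rfl
        map_mul' := by decide }).comp Equiv.Perm.sign) (MonoidHom.id _)

theorem withSign_injective (m : ℕ) : Function.Injective (withSign m) := fun _ _ h =>
  congrArg Prod.snd h

theorem card_altGrp_four : Nat.card (AltGrp 4) = 12 := by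
  rw [nat_card_alternatingGroup, Nat.card_fin]
  rfl

theorem card_altGrp_five : Nat.card (AltGrp 5) = 60 := by
  rw [nat_card_alternatingGroup, Nat.card_fin]
  rfl

theorem card_symGrp (m : ℕ) : Nat.card (SymGrp m) = m.factorial := by
  rw [Nat.card_perm, Nat.card_fin]

theorem card_cyc_two_prod {G : Type} : Nat.card (Cyc 2 × G) = 2 * Nat.card G := by
  rw [Nat.card_prod]
  congr 1
  exact Nat.card_zmod 2

/-! #### `Q_3(T_{2,3})` -/

/-- The Cayley graph of `Q_3(T_{2,3})`. -/
def graph233 : Fin 2 → Fin 4 → Fin 4 :=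
  ![![0, 3, 1, 2], ![2, 1, 3, 0]]

/-- A conjugacy class of elements of order three of `A_4`, written as squares so that they lie in
the alternating group by construction, numbered by the vertices of the graph. -/
def label233 (w : Fin 4) : AltGrp 4 :=
  evenSquare (List.formPerm (![[1, 2, 3], [0, 2, 1], [0, 3, 2], [0, 1, 3]] w))

theorem hasGraph233 : (conjClass (label233 0)).HasGraph ![0, 1] graph233 label233 where
  mem := (by decide +kernel : ∀ w, IsConj (label233 0) (label233 w))
  injective := by decide +kernel
  surjective := (by decide +kernel : ∀ x, IsConj (label233 0) x → ∃ w, label233 w = x)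
  act_eq := by decide +kernel

theorem quandleData233 :
    HasQuandleData ((torusLink 2 3).nQuandle 3) 4 (AltGrp 4) (AltGrp 4) (Cyc 2 × Cyc 2) ∧
      HasCayleyGraph (torusGen 2 3 3 (by norm_num)) ![(0 : Fin 4), 1] graph233 :=
  hasGraph233.torusLink (k := 3) (tests := [([], 0, 1)]) (m := 3) _ (by decide +kernel)
    (by decide +kernel) (by decide +kernel) (by decide +kernel) (by decide +kernel)
    card_altGrp_four (by decide +kernel)
    (MonoidHom.id _) Function.injective_id
    (closure_range_eq_range 3 0 (by decide +kernel) (by decide +kernel))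
    kleinHom kleinHom_injective (closure_mul_inv_eq_range 0 (by decide +kernel) (by decide +kernel))

/-! #### `Q_4(T_{2,3})` -/

/-- The Cayley graph of `Q_4(T_{2,3})`. -/
def graph234 : Fin 2 → Fin 6 → Fin 6 :=
  ![![0, 3, 1, 5, 4, 2],
    ![2, 1, 4, 0, 3, 5]]

/-- The cycles of length four in `S_4`,
numbered by the vertices of the graph. -/
def label234 (w : Fin 6) : SymGrp 4 :=
  List.formPerm
    (![[0, 1, 2, 3], [0, 1, 3, 2], [0, 2, 1, 3], [0, 3, 1, 2], [0, 3, 2, 1], [0, 2, 3, 1]] w)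

theorem hasGraph234 : (orderFour (SymGrp 4)).HasGraph ![0, 1] graph234 label234 where
  mem := (by decide +kernel : ∀ w, label234 w ^ 4 = 1 ∧ label234 w ^ 2 ≠ 1)
  injective := by decide +kernel
  surjective := (by decide +kernel :
    ∀ x, x ^ 4 = 1 ∧ x ^ 2 ≠ 1 → ∃ w, label234 w = x)
  act_eq := by decide +kernel

theorem quandleData234 :
    HasQuandleData ((torusLink 2 3).nQuandle 4) 6 (SymGrp 4) (SymGrp 4) (AltGrp 4) ∧
      HasCayleyGraph (torusGen 2 3 4 (by norm_num)) ![(0 : Fin 6), 1] graph234 :=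
  hasGraph234.torusLink (k := 3)
    (tests := [([0], 1, 1)]) (m := 4) _
    (by decide +kernel) (by decide +kernel) (by decide +kernel) (by decide +kernel)
    (by decide +kernel) (card_symGrp 4) (by decide +kernel)
    (MonoidHom.id _)
    Function.injective_id
    (closure_range_eq_range 5 0 (by decide +kernel) (by decide +kernel))
    (alternatingGroup (Fin 4)).subtype
    Subtype.val_injective
    (closure_mul_inv_eq_range 0 (by decide +kernel) (by decide +kernel))

/-! #### `Q_5(T_{2,3})` -/

/-- The Cayley graph of `Q_5(T_{2,3})`. -/
def graph235 : Fin 2 → Fin 12 → Fin 12 :=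
  ![![0, 3, 1, 5, 6, 7, 8, 2, 10, 4, 9, 11],
    ![2, 1, 4, 0, 6, 7, 3, 9, 5, 11, 10, 8]]

/-- A conjugacy class of elements of order five of `A_5`, written as squares so that they lie in
the alternating group by construction, numbered by the vertices of the graph. -/
def label235 (w : Fin 12) : AltGrp 5 :=
  evenSquare (List.formPerm
    (![[0, 3, 1, 4, 2], [0, 3, 2, 1, 4], [0, 3, 4, 2, 1], [0, 1, 4, 3, 2], [0, 2, 1, 3, 4],
      [0, 4, 3, 1, 2], [0, 1, 3, 2, 4], [0, 4, 2, 3, 1], [0, 1, 2, 4, 3], [0, 2, 3, 4, 1],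
      [0, 4, 1, 2, 3], [0, 2, 4, 1, 3]] w))

theorem hasGraph235 : (conjClass (label235 0)).HasGraph ![0, 1] graph235 label235 where
  mem := (by decide +kernel : ∀ w, IsConj (label235 0) (label235 w))
  injective := by decide +kernel
  surjective x hx := by
    obtain ⟨g, rfl⟩ := isConj_iff.1 hx
    exact (by decide +kernel : ∀ g, ∃ w, label235 w = g * label235 0 * g⁻¹) g
  act_eq := by decide +kernel

theorem quandleData235 :
    HasQuandleData ((torusLink 2 3).nQuandle 5) 12 (AltGrp 5) (AltGrp 5) (AltGrp 5) ∧
      HasCayleyGraph (torusGen 2 3 5 (by norm_num)) ![(0 : Fin 12), 1] graph235 :=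
  hasGraph235.torusLink (k := 3)
    (tests := [([0, 1, 1, 1, 0], 1, 1)]) (m := 5) _
    (by decide +kernel) (by decide +kernel) (by decide +kernel) (by decide +kernel)
    (by decide +kernel) card_altGrp_five (by decide +kernel)
    (MonoidHom.id _)
    Function.injective_id
    (hasGraph235.closure_sym_eq_range _ (fun _ => ⟨_, rfl⟩)
      (w := 0) (by decide +kernel))
    (MonoidHom.id _)
    Function.injective_id
    (hasGraph235.closure_sym_mul_inv_eq_range _ (fun _ => ⟨_, rfl⟩)
      (w := 0) (w' := 1) (by decide +kernel))

/-! #### `Q_3(T_{2,4})` -/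

/-- The Cayley graph of `Q_3(T_{2,4})`. -/
def graph243 : Fin 2 → Fin 8 → Fin 8 :=
  ![![0, 3, 4, 5, 6, 1, 2, 7],
    ![2, 1, 4, 5, 0, 7, 6, 3]]

/-- The cycles of length three in `S_4`,
numbered by the vertices of the graph. -/
def label243 (w : Fin 8) : SymGrp 4 :=
  List.formPerm
    (![[1, 2, 3], [0, 1, 2], [0, 3, 2], [0, 2, 3], [0, 1, 3], [0, 3, 1], [0, 2, 1], [1, 3, 2]] w)

theorem hasGraph243 : (orderThree (SymGrp 4)).HasGraph ![0, 1] graph243 label243 where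
  mem := (by decide +kernel : ∀ w, label243 w ^ 3 = 1 ∧ label243 w ≠ 1)
  injective := by decide +kernel
  surjective := (by decide +kernel :
    ∀ x, x ^ 3 = 1 ∧ x ≠ 1 → ∃ w, label243 w = x)
  act_eq := by decide +kernel

theorem quandleData243 :
    HasQuandleData ((torusLink 2 4).nQuandle 3) 8 (SymGrp 4) (AltGrp 4) (AltGrp 4) ∧
      HasCayleyGraph (torusGen 2 4 3 (by norm_num)) ![(0 : Fin 8), 1] graph243 :=
  hasGraph243.torusLink (k := 3)
    (tests := [([0, 1, 1, 0], 1, 1)]) (m := 3) _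
    (by decide +kernel) (by decide +kernel) (by decide +kernel) (by decide +kernel)
    (by decide +kernel) (card_symGrp 4) (by decide +kernel)
    (alternatingGroup (Fin 4)).subtype
    Subtype.val_injective
    (closure_range_eq_range 4 0 (by decide +kernel) (by decide +kernel))
    (alternatingGroup (Fin 4)).subtype
    Subtype.val_injective
    (closure_mul_inv_eq_range 0 (by decide +kernel) (by decide +kernel))

/-! #### `Q_3(T_{2,4}^{+-})` -/

/-- The Cayley graph of `Q_3(T_{2,4}^{+-})`. -/
def graph243pm : Fin 2 → Fin 8 → Fin 8 :=
  ![![0, 3, 4, 6, 5, 2, 1, 7],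
    ![2, 1, 5, 7, 4, 0, 3, 6]]

/-- A conjugacy class of elements of order three of `A_4`, in two copies,
numbered by the vertices of the graph. -/
def label243pm : Fin 8 → Cyc 2 × AltGrp 4 :=
  ![(1, label233 0), (.ofAdd 1, label233 1), (1, label233 2), (.ofAdd 1, label233 3),
    (1, label233 1), (1, label233 3), (.ofAdd 1, label233 2), (.ofAdd 1, label233 0)]

theorem hasGraph243pm : (twoTimesClass (label233 0)).HasGraph ![0, 1] graph243pm label243pm where
  mem := (by decide +kernel : ∀ w, IsConj (label233 0) (label243pm w).2)
  injective := by decide +kernel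
  surjective := (by decide +kernel :
    ∀ x : Cyc 2 × AltGrp 4, IsConj (label233 0) x.2 → ∃ w, label243pm w = x)
  act_eq := by decide +kernel

theorem quandleData243pm :
    HasQuandleData (torusLink24pm.nQuandle 3) 8 (Cyc 2 × AltGrp 4) (AltGrp 4) (Cyc 2 × Cyc 2) ∧
      HasCayleyGraph (torusGen24pm 3) ![(0 : Fin 8), 1] graph243pm :=
  hasGraph243pm.torusLink24pm (k := 3)
    (tests := [([0, 1], 1, 0), ([0], 1, 1)]) (m := 3)
    (by decide +kernel) (by decide +kernel) (by decide +kernel) (by decide +kernel)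
    (by decide +kernel) (by rw [card_cyc_two_prod, card_altGrp_four]) (by decide +kernel)
    (MonoidHom.inr _ _)
    (fun _ _ h => congrArg Prod.snd h)
    (closure_range_eq_range 4 0 (by decide +kernel) (by decide +kernel))
    ((MonoidHom.inr _ _).comp kleinHom)
    (fun _ _ h => kleinHom_injective (congrArg Prod.snd h))
    (closure_mul_inv_eq_range 0 (by decide +kernel) (by decide +kernel))

/-! #### `Q_3(T_{2,5})` -/

/-- The Cayley graph of `Q_3(T_{2,5})`. -/
def graph253 : Fin 2 → Fin 20 → Fin 20 :=
  ![![0, 3, 4, 6, 8, 9, 1, 5, 2, 7, 14, 15, 16, 11, 17, 13, 18, 10, 12, 19],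
    ![2, 1, 5, 7, 6, 0, 10, 11, 12, 13, 4, 3, 14, 16, 8, 17, 9, 19, 18, 15]]

/-- The cycles of length three in `S_5`,
numbered by the vertices of the graph. -/
def label253 (w : Fin 20) : SymGrp 5 :=
  List.formPerm
    (![[2, 3, 4], [0, 1, 2], [0, 3, 4], [0, 1, 3], [0, 4, 2], [1, 3, 4], [0, 1, 4], [1, 2, 3],
      [0, 2, 3], [1, 4, 2], [1, 2, 4], [0, 3, 2], [0, 3, 1], [0, 2, 4], [1, 3, 2], [0, 4, 3],
      [0, 4, 1], [1, 4, 3], [0, 2, 1], [2, 4, 3]] w)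

theorem hasGraph253 : (orderThree (SymGrp 5)).HasGraph ![0, 1] graph253 label253 where
  mem := (by decide +kernel : ∀ w, label253 w ^ 3 = 1 ∧ label253 w ≠ 1)
  injective := by decide +kernel
  surjective := (by decide +kernel :
    ∀ x, x ^ 3 = 1 ∧ x ≠ 1 → ∃ w, label253 w = x)
  act_eq := by decide +kernel

theorem label253_mem_range (w : Fin 20) :
    label253 w ∈ (alternatingGroup (Fin 5)).subtype.range := by
  rw [Subgroup.range_subtype, Equiv.Perm.mem_alternatingGroup]
  revert w
  decide +kernel

theorem quandleData253 :
    HasQuandleData ((torusLink 2 5).nQuandle 3) 20 (SymGrp 5) (AltGrp 5) (AltGrp 5) ∧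
      HasCayleyGraph (torusGen 2 5 3 (by norm_num)) ![(0 : Fin 20), 1] graph253 :=
  hasGraph253.torusLink (k := 3)
    (tests := [([0, 1, 0, 0, 1, 0], 1, 1)]) (m := 6) _
    (by decide +kernel) (by decide +kernel) (by decide +kernel) (by decide +kernel)
    (by decide +kernel) (card_symGrp 5) (by decide +kernel)
    (alternatingGroup (Fin 5)).subtype
    Subtype.val_injective
    (hasGraph253.closure_sym_eq_range _ label253_mem_range
      (w := 0) (by decide +kernel))
    (alternatingGroup (Fin 5)).subtype
    Subtype.val_injective
    (hasGraph253.closure_sym_mul_inv_eq_range _ label253_mem_range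
      (w := 0) (w' := 1) (by decide +kernel))

/-! #### `Q_2(T_{3,3})` -/

/-- The Cayley graph of `Q_2(T_{3,3})`. -/
def graph332 : Fin 3 → Fin 6 → Fin 6 :=
  ![![0, 4, 5, 3, 1, 2],
    ![3, 1, 5, 0, 4, 2],
    ![3, 4, 2, 0, 1, 5]]

/-- The cycles of length four in `S_4`,
numbered by the vertices of the graph. -/
def label332 (w : Fin 6) : SymGrp 4 :=
  List.formPerm
    (![[0, 1, 2, 3], [0, 1, 3, 2], [0, 2, 1, 3], [0, 3, 2, 1], [0, 2, 3, 1], [0, 3, 1, 2]] w)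

theorem hasGraph332 : (squares (SymGrp 4)).HasGraph ![0, 1, 2] graph332 label332 where
  mem := (by decide +kernel : ∀ w, label332 w ^ 4 = 1 ∧ label332 w ^ 2 ≠ 1)
  injective := by decide +kernel
  surjective := (by decide +kernel :
    ∀ x, x ^ 4 = 1 ∧ x ^ 2 ≠ 1 → ∃ w, label332 w = x)
  act_eq := by decide +kernel

theorem quandleData332 :
    HasQuandleData ((torusLink 3 3).nQuandle 2) 6 (Cyc 2 × SymGrp 4) (Cyc 2 × Cyc 2)
        (Cyc 2 × Cyc 2) ∧
      HasCayleyGraph (torusGen 3 3 2 (by norm_num)) ![(0 : Fin 6), 1, 2] graph332 :=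
  hasGraph332.torusLink (k := 3)
    (tests := [([0, 1], 2, 2), ([0], 1, 1)]) (m := 8) _
    (by decide +kernel) (by decide +kernel) (by decide +kernel) (by decide +kernel)
    (by decide +kernel) (by rw [card_cyc_two_prod, card_symGrp]; rfl) (by decide +kernel)
    ((MonoidHom.inr _ _).comp ((alternatingGroup (Fin 4)).subtype.comp kleinHom))
    (fun _ _ h => kleinHom_injective (Subtype.ext (congrArg Prod.snd h)))
    (closure_range_eq_range 3 0 (by decide +kernel) (by decide +kernel))
    ((MonoidHom.inr _ _).comp ((alternatingGroup (Fin 4)).subtype.comp kleinHom))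
    (fun _ _ h => kleinHom_injective (Subtype.ext (congrArg Prod.snd h)))
    (closure_mul_inv_eq_range 0 (by decide +kernel) (by decide +kernel))

/-! #### `Q_2(T_{3,4})` -/

/-- The Cayley graph of `Q_2(T_{3,4})`. -/
def graph342 : Fin 3 → Fin 12 → Fin 12 :=
  ![![0, 5, 7, 9, 10, 1, 8, 2, 6, 3, 4, 11],
    ![3, 1, 8, 0, 7, 11, 10, 4, 2, 9, 6, 5],
    ![4, 6, 2, 5, 0, 3, 1, 11, 9, 8, 10, 7]]

/-- The ordered pairs of different letters among four,
numbered by the vertices of the graph. -/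
def label342 : Fin 12 → Fin 4 × Fin 4 :=
  ![(0, 1), (0, 2), (0, 3), (1, 2), (1, 3), (2, 1), (2, 3), (3, 1), (3, 2), (2, 0), (3, 0),
    (1, 0)]

theorem hasGraph342 : (orderedPairs (Fin 4)).HasGraph ![0, 1, 2] graph342 label342 where
  mem := (by decide +kernel : ∀ w, (label342 w).1 ≠ (label342 w).2)
  injective := by decide +kernel
  surjective := (by decide +kernel :
    ∀ x : Fin 4 × Fin 4, x.1 ≠ x.2 → ∃ w, label342 w = x)
  act_eq := by decide +kernel

theorem quandleData342 :
    HasQuandleData ((torusLink 3 4).nQuandle 2) 12 (Cyc 2 × SymGrp 4) (SymGrp 4) (AltGrp 4) ∧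
      HasCayleyGraph (torusGen 3 4 2 (by norm_num)) ![(0 : Fin 12), 1, 2] graph342 :=
  hasGraph342.torusLink (k := 3)
    (tests := [([0, 1, 2], 2, 0), ([1], 0, 2), ([0, 1], 1, 0)]) (m := 4) _
    (by decide +kernel) (by decide +kernel) (by decide +kernel) (by decide +kernel)
    (by decide +kernel) (by rw [card_cyc_two_prod, card_symGrp]; rfl) (by decide +kernel)
    (withSign 4)
    (withSign_injective 4)
    (closure_range_eq_range 3 0 (by decide +kernel) (by decide +kernel))
    ((MonoidHom.inr _ _).comp (alternatingGroup (Fin 4)).subtype)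
    (fun _ _ h => Subtype.ext (congrArg Prod.snd h))
    (closure_mul_inv_eq_range 0 (by decide +kernel) (by decide +kernel))

/-! #### `Q_2(T_{3,5})` -/

/-- The Cayley graph of `Q_2(T_{3,5})`. -/
def graph352 : Fin 3 → Fin 30 → Fin 30 :=
  ![![0, 5, 7, 9, 11, 1, 12, 2, 10, 3, 8, 4, 6, 22, 23, 17, 25, 15, 27, 24, 28, 26, 13, 14, 19,
      16, 21, 18, 20, 29],
    ![3, 1, 8, 0, 12, 13, 15, 14, 2, 18, 19, 16, 4, 5, 7, 6, 11, 26, 9, 10, 23, 25, 29, 20, 28,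
      21, 17, 27, 24, 22],
    ![4, 6, 2, 10, 0, 14, 1, 16, 17, 13, 3, 20, 21, 9, 5, 24, 7, 8, 23, 22, 11, 12, 19, 18, 15,
      29, 27, 26, 28, 25]]

/-- The cycles of length four in `S_5`,
numbered by the vertices of the graph. -/
def label352 (w : Fin 30) : SymGrp 5 :=
  List.formPerm
    (![[1, 2, 3, 4], [0, 1, 2, 4], [0, 3, 1, 2], [0, 3, 1, 4], [0, 3, 2, 4], [0, 3, 4, 2],
      [0, 3, 4, 1], [0, 1, 3, 4], [0, 2, 3, 4], [0, 1, 3, 2], [0, 4, 1, 2], [0, 1, 4, 2],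
      [0, 1, 2, 3], [0, 2, 3, 1], [1, 2, 4, 3], [1, 4, 2, 3], [0, 2, 4, 1], [1, 3, 2, 4],
      [0, 2, 4, 3], [0, 2, 1, 4], [0, 4, 3, 1], [0, 3, 2, 1], [0, 4, 1, 3], [1, 3, 4, 2],
      [0, 4, 3, 2], [0, 4, 2, 3], [0, 1, 4, 3], [0, 4, 2, 1], [0, 2, 1, 3], [1, 4, 3, 2]] w)

theorem hasGraph352 : (squares (SymGrp 5)).HasGraph ![0, 1, 2] graph352 label352 where
  mem := (by decide +kernel : ∀ w, label352 w ^ 4 = 1 ∧ label352 w ^ 2 ≠ 1)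
  injective := by decide +kernel
  surjective := (by decide +kernel :
    ∀ x, x ^ 4 = 1 ∧ x ^ 2 ≠ 1 → ∃ w, label352 w = x)
  act_eq := by decide +kernel

theorem quandleData352 :
    HasQuandleData ((torusLink 3 5).nQuandle 2) 30 (Cyc 2 × SymGrp 5) (AltGrp 5) (AltGrp 5) ∧
      HasCayleyGraph (torusGen 3 5 2 (by norm_num)) ![(0 : Fin 30), 1, 2] graph352 :=
  hasGraph352.torusLink (k := 3)
    (tests := [([0, 1, 2, 0], 2, 1), ([1, 0, 2, 1], 2, 0), ([], 0, 1)]) (m := 8) _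
    (by decide +kernel) (by decide +kernel) (by decide +kernel) (by decide +kernel)
    (by decide +kernel) (by rw [card_cyc_two_prod, card_symGrp]; rfl) (by decide +kernel)
    ((MonoidHom.inr _ _).comp (alternatingGroup (Fin 5)).subtype)
    (fun _ _ h => Subtype.ext (congrArg Prod.snd h))
    (hasGraph352.closure_sym_eq_range _ (fun w => ⟨evenSquare (label352 w), rfl⟩)
      (w := 0) (by decide +kernel))
    ((MonoidHom.inr _ _).comp (alternatingGroup (Fin 5)).subtype)
    (fun _ _ h => Subtype.ext (congrArg Prod.snd h))
    (hasGraph352.closure_sym_mul_inv_eq_range _ (fun w => ⟨evenSquare (label352 w), rfl⟩)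
      (w := 0) (w' := 1) (by decide +kernel))

/-! ### The classification -/

theorem HasQuandleData.finite {Q : Type} [Quandle Q] {N : ℕ} {A I T : Type} [Group A] [Group I]
    [Group T] (h : HasQuandleData Q N A I T) (hN : N ≠ 0) : Finite Q :=
  Nat.finite_of_card_ne_zero (h.1.trans_ne hN)

theorem finite_nQuandle_iff {p q n : ℕ} (hp : 2 ≤ p) (hpq : p ≤ q) (hn : 2 ≤ n) :
    Finite ((torusLink p q).nQuandle n) ↔ 1 < (1 / p + 1 / q + 1 / n : ℚ) := by
  constructor
  · intro hfin
    by_contra! hle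
    exact not_finite_iff_infinite.2
      (infinite_nQuandle_of_le_one hp (hp.trans hpq) hn hle) hfin
  · rw [one_lt_sum_inv_iff hp hpq hn]
    simp only [Set.mem_insert_iff, Set.mem_singleton_iff, Prod.mk.injEq]
    rintro (⟨rfl, rfl⟩ | ⟨rfl, rfl⟩ | h)
    · exact (quandleData_hopf n).1.finite (by decide)
    · have : NeZero q := ⟨by omega⟩
      obtain ⟨e, -⟩ := cayleyGraph_two_strand q hpq
      exact Finite.of_equiv _ e.symm
    · rcases h with h | h | h | h | h | h | h | h <;> obtain ⟨rfl, rfl, rfl⟩ := h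
      · exact quandleData233.1.finite (by decide)
      · exact quandleData234.1.finite (by decide)
      · exact quandleData235.1.finite (by decide)
      · exact quandleData243.1.finite (by decide)
      · exact quandleData253.1.finite (by decide)
      · exact quandleData332.1.finite (by decide)
      · exact quandleData342.1.finite (by decide)
      · exact quandleData352.1.finite (by decide)

/-- The transvection groups have different orders. -/
theorem not_quandleIso_torusLink24pm :
    ¬ QuandleIso ((torusLink 2 4).nQuandle 3) (torusLink24pm.nQuandle 3) := by
  intro h
  obtain ⟨-, -, -, ⟨t⟩⟩ := quandleData243.1
  obtain ⟨-, -, -, ⟨t'⟩⟩ := quandleData243pm.1.of_iso h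
  have := Nat.card_congr (t.symm.trans t').toEquiv
  rw [card_altGrp_four, card_cyc_two_prod, show Nat.card (Cyc 2) = 2 from Nat.card_zmod 2] at this
  exact absurd this (by decide)

theorem mainTheorem5 :
    -- which of the quandles are finite
    (∀ p q n : ℕ, 2 ≤ p → p ≤ q → 2 ≤ n →
      (Finite ((torusLink p q).nQuandle n) ↔ 1 < (1 / p + 1 / q + 1 / n : ℚ)) ∧
      (1 < (1 / p + 1 / q + 1 / n : ℚ) ↔
        (p = 2 ∧ q = 2) ∨ (p = 2 ∧ n = 2) ∨
        (p, q, n) ∈ ({(2, 3, 3), (2, 3, 4), (2, 3, 5), (2, 4, 3), (2, 5, 3),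
          (3, 3, 2), (3, 4, 2), (3, 5, 2)} : Set (ℕ × ℕ × ℕ)))) ∧
    -- orientation matters only for the link `T_{2,4}` with `n = 3`
    (∀ p q n : ℕ, 2 ≤ p → p ≤ q → 2 ≤ n → Finite ((torusLink p q).nQuandle n) →
      ∀ S : Set (torusLink p q).Arc, (torusLink p q).IsUnionOfComponents S →
        QuandleIso (((torusLink p q).reverse S).nQuandle n) ((torusLink p q).nQuandle n) ∨
        ((p, q, n) = (2, 4, 3) ∧
          QuandleIso (((torusLink p q).reverse S).nQuandle n) (torusLink24pm.nQuandle 3))) ∧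
    ¬ QuandleIso ((torusLink 2 4).nQuandle 3) (torusLink24pm.nQuandle 3) ∧
    -- `Q_n(T_{2,2})`
    (∀ n : ℕ, 2 ≤ n →
      HasQuandleData ((torusLink 2 2).nQuandle n) 2 (Cyc 2) Unit Unit ∧
      HasCayleyGraph (torusGen 2 2 n (by norm_num)) ![(0 : Fin 2), 1] (fun _ => id)) ∧
    -- `Q_2(T_{2,q})`
    (∀ q : ℕ, 2 ≤ q →
      HasCayleyGraph (torusGen 2 q 2 (by norm_num)) ![(0 : ZMod q), 1]
        ![fun w => -w, fun w => 2 - w]) ∧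
    (∀ q : ℕ, 3 ≤ q →
      HasQuandleData ((torusLink 2 q).nQuandle 2) q (CycHol q)
        (DihedralGroup (q / Nat.gcd 2 q)) (Cyc (q / Nat.gcd 2 q))) ∧
    -- `Q_3(T_{2,3})`
    (HasQuandleData ((torusLink 2 3).nQuandle 3) 4 (AltGrp 4) (AltGrp 4) (Cyc 2 × Cyc 2) ∧
      HasCayleyGraph (torusGen 2 3 3 (by norm_num)) ![(0 : Fin 4), 1]
        ![![0, 3, 1, 2],
          ![2, 1, 3, 0]]) ∧
    -- `Q_4(T_{2,3})`
    (HasQuandleData ((torusLink 2 3).nQuandle 4) 6 (SymGrp 4) (SymGrp 4) (AltGrp 4) ∧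
      HasCayleyGraph (torusGen 2 3 4 (by norm_num)) ![(0 : Fin 6), 1]
        ![![0, 3, 1, 5, 4, 2],
          ![2, 1, 4, 0, 3, 5]]) ∧
    -- `Q_5(T_{2,3})`
    (HasQuandleData ((torusLink 2 3).nQuandle 5) 12 (AltGrp 5) (AltGrp 5) (AltGrp 5) ∧
      HasCayleyGraph (torusGen 2 3 5 (by norm_num)) ![(0 : Fin 12), 1]
        ![![0, 3, 1, 5, 6, 7, 8, 2, 10, 4, 9, 11],
          ![2, 1, 4, 0, 6, 7, 3, 9, 5, 11, 10, 8]]) ∧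
    -- `Q_3(T_{2,4})`
    (HasQuandleData ((torusLink 2 4).nQuandle 3) 8 (SymGrp 4) (AltGrp 4) (AltGrp 4) ∧
      HasCayleyGraph (torusGen 2 4 3 (by norm_num)) ![(0 : Fin 8), 1]
        ![![0, 3, 4, 5, 6, 1, 2, 7],
          ![2, 1, 4, 5, 0, 7, 6, 3]]) ∧
    -- `Q_3(T_{2,4}^{+-})`
    (HasQuandleData (torusLink24pm.nQuandle 3) 8 (Cyc 2 × AltGrp 4) (AltGrp 4)
        (Cyc 2 × Cyc 2) ∧
      HasCayleyGraph (torusGen24pm 3) ![(0 : Fin 8), 1]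
        ![![0, 3, 4, 6, 5, 2, 1, 7],
          ![2, 1, 5, 7, 4, 0, 3, 6]]) ∧
    -- `Q_3(T_{2,5})`
    (HasQuandleData ((torusLink 2 5).nQuandle 3) 20 (SymGrp 5) (AltGrp 5) (AltGrp 5) ∧
      HasCayleyGraph (torusGen 2 5 3 (by norm_num)) ![(0 : Fin 20), 1]
        ![![0, 3, 4, 6, 8, 9, 1, 5, 2, 7, 14, 15, 16, 11, 17, 13, 18, 10, 12, 19],
          ![2, 1, 5, 7, 6, 0, 10, 11, 12, 13, 4, 3, 14, 16, 8, 17, 9, 19, 18, 15]]) ∧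
    -- `Q_2(T_{3,3})`
    (HasQuandleData ((torusLink 3 3).nQuandle 2) 6 (Cyc 2 × SymGrp 4) (Cyc 2 × Cyc 2)
        (Cyc 2 × Cyc 2) ∧
      HasCayleyGraph (torusGen 3 3 2 (by norm_num)) ![(0 : Fin 6), 1, 2]
        ![![0, 4, 5, 3, 1, 2],
          ![3, 1, 5, 0, 4, 2],
          ![3, 4, 2, 0, 1, 5]]) ∧
    -- `Q_2(T_{3,4})`
    (HasQuandleData ((torusLink 3 4).nQuandle 2) 12 (Cyc 2 × SymGrp 4) (SymGrp 4)
        (AltGrp 4) ∧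
      HasCayleyGraph (torusGen 3 4 2 (by norm_num)) ![(0 : Fin 12), 1, 2]
        ![![0, 5, 7, 9, 10, 1, 8, 2, 6, 3, 4, 11],
          ![3, 1, 8, 0, 7, 11, 10, 4, 2, 9, 6, 5],
          ![4, 6, 2, 5, 0, 3, 1, 11, 9, 8, 10, 7]]) ∧
    -- `Q_2(T_{3,5})`
    (HasQuandleData ((torusLink 3 5).nQuandle 2) 30 (Cyc 2 × SymGrp 5) (AltGrp 5)
        (AltGrp 5) ∧
      HasCayleyGraph (torusGen 3 5 2 (by norm_num)) ![(0 : Fin 30), 1, 2]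
        ![![0, 5, 7, 9, 11, 1, 12, 2, 10, 3, 8, 4, 6, 22, 23, 17, 25, 15, 27, 24, 28, 26, 13, 14,
            19, 16, 21, 18, 20, 29],
          ![3, 1, 8, 0, 12, 13, 15, 14, 2, 18, 19, 16, 4, 5, 7, 6, 11, 26, 9, 10, 23, 25, 29, 20,
            28, 21, 17, 27, 24, 22],
          ![4, 6, 2, 10, 0, 14, 1, 16, 17, 13, 3, 20, 21, 9, 5, 24, 7, 8, 23, 22, 11, 12, 19, 18,
            15, 29, 27, 26, 28, 25]]) := by
  refine ⟨fun p q n hp hpq hn => ⟨finite_nQuandle_iff hp hpq hn, one_lt_sum_inv_iff hp hpq hn⟩,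
    fun p q n hp hpq hn hfin S hS => quandleIso_reverse_of_finite hp hpq hn hfin hS,
    not_quandleIso_torusLink24pm, fun n _ => quandleData_hopf n, cayleyGraph_two_strand,
    fun q hq => ?_, quandleData233, quandleData234, quandleData235, quandleData243,
    quandleData243pm, quandleData253, quandleData332, quandleData342, quandleData352⟩
  have : NeZero q := ⟨by omega⟩
  exact HasQuandleData.of_iso (quandleIso_two_strand_dihedral q) (hasQuandleData_dihedral hq)
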